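/- Throughout, measures are finite Borel measures on $\mathbb{R}$ of constant sign (positive or negative) whose support is compact and infinite. For such a measure $s$, $\mathrm{Co}(\mathrm{supp}\, s)$ is the smallest interval containing its support and $\widehat{s}(z)=\int \frac{ds(x)}{z-x}$ its Cauchy transform; $\langle \alpha,\beta\rangle$ is the measure with $d\langle \alpha,\beta\rangle(x)=\widehat{\beta}(x)\,d\alpha(x)$. Let $m\ge 0$ and let $\sigma_0,\ldots,\sigma_m$ be measures with $\mathrm{Co}(\mathrm{supp}\,\sigma_j)\cap \mathrm{Co}(\mathrm{supp}\,\sigma_{j+1})=\emptyset$ for $0\le j<m$. Let $(s_{0,0},\ldots,s_{0,m})=\mathcal{N}(\sigma_0,\ldots,\sigma_m)$ be the Nikishin system they generate: $s_{0,0}=\sigma_0$ and $s_{0,k}=\langle \sigma_0,\langle\sigma_1,\ldots,\langle\sigma_{k-1},\sigma_k\rangle\cdots\rangle\rangle$. For a multi-index $\mathbf{n}=(n_0,\ldots,n_m)\in\mathbb{Z}_+^{m+1}$ with $|\mathbf n|=n_0+\cdots+n_m$, there are a polynomial $Q_{\mathbf n}\not\equiv 0$, $\deg Q_{\mathbf n}\le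 |\mathbf n|$, and polynomials $P_{\mathbf n,0},\ldots,P_{\mathbf n,m}$ (with complex coefficients) such that $$Q_{\mathbf n}(z)\widehat{s}_{0,k}(z)-P_{\mathbf n,k}(z)=\mathcal{O}(1/z^{n_k+1}),\quad z\to\infty,\quad k=0,\ldots,m.$$ For every such choice, $Q_{\mathbf n}$ has exactly $|\mathbf n|$ zeros $x_{\mathbf n,1},\ldots,x_{\mathbf n,|\mathbf n|}$; they are simple, real, and lie in the interior of $\mathrm{Co}(\mathrm{supp}\,\sigma_0)$. Put $\lambda_{\mathbf n,k,i}=P_{\mathbf n,k}(x_{\mathbf n,i})/Q_{\mathbf n}'(x_{\mathbf n,i})$. (1) For every $\mathbf n\in\mathbb{Z}_+^{m+1}$, every $k=0,\ldots,m$ and every polynomial $p$ with $\deg p\le |\mathbf n|+n_k-1$, $$\int p(x)\,ds_{0,k}(x)=\sum_{i=1}^{|\mathbf n|}\lambda_{\mathbf n,k,i}\,p(x_{\mathbf n,i}).$$ (2) If $\mathbf n=(n,n+1,\ldots,n+1)$ with $n\in\mathbb{Z}_+$, then for every $k=0,\ldots,m$ the measure $s_{0,k}$ has constant sign and every $\lambda_{\mathbf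 n,k,i}$, $i=1,\ldots,|\mathbf n|$, is real, non-zero and has the sign of $s_{0,k}$. (3) Consequently, along the multi-indices $\mathbf n=(n,n+1,\ldots,n+1)$, $n\in\mathbb{Z}_+$, let $f$ be any real function, bounded on $\mathrm{Co}(\mathrm{supp}\,\sigma_0)$, that is Riemann–Stieltjes integrable on $\mathrm{Co}(\mathrm{supp}\,\sigma_0)$ (in the sense of limits of Riemann–Stieltjes sums as the mesh tends to $0$, masses at the end points included) with respect to at least one of the measures $s_{0,0},\ldots,s_{0,m}$. Then for every $k=0,\ldots,m$ the function $f$ is Riemann–Stieltjes integrable and Lebesgue integrable with respect to $s_{0,k}$, the two integrals coincide, and $$\int f(x)\,ds_{0,k}(x)=\lim_{n\to\infty}\sum_{i=1}^{|\mathbf n|}\lambda_{\mathbf n,k,i}\,f(x_{\mathbf n,i}).$$ -/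

import Mathlib

open MeasureTheory Polynomial

noncomputable section

namespace NikishinSystem

/-- The support of a finite signed Borel measure on the line. -/
def supp (s : SignedMeasure ℝ) : Set ℝ := s.variation.support

/-- `Co (supp s)`, the smallest interval containing the support of `s`. -/
def hull (s : SignedMeasure ℝ) : Set ℝ := convexHull ℝ (supp s)

/-- A finite Borel measure on the line with constant sign, whose support is compact and consists
of infinitely many points. -/
structure IsAdmissible (s : SignedMeasure ℝ) : Prop where
  constant_sign : 0 ≤ s ∨ s ≤ 0
  compact_supp : IsCompact (supp s)
  infinite_supp : (supp s).Infinite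

/-- The Cauchy transform `z ↦ ∫ ds(x) / (z - x)`, at a real or complex point `z`. -/
def cauchyTransform {𝕜 : Type*} [RCLike 𝕜] (s : SignedMeasure ℝ) (z : 𝕜) : 𝕜 :=
  ∫ᵛ x, (z - (x : 𝕜))⁻¹ ∂<•s

/-- `⟨α, β⟩`, the measure with density the Cauchy transform of `β` with respect to `α`. -/
def bracket (α β : SignedMeasure ℝ) : SignedMeasure ℝ :=
  α.withDensity (fun x : ℝ ↦ cauchyTransform β x) (ContinuousLinearMap.mul ℝ ℝ)

/-- The measures `s_{0,0} = σ_0`, `s_{0,k} = ⟨σ_0, ⟨σ_1, …, ⟨σ_{k-1}, σ_k⟩ …⟩⟩`. -/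
def nikishin : {m : ℕ} → (Fin (m + 1) → SignedMeasure ℝ) → Fin (m + 1) → SignedMeasure ℝ
  | 0, σ => fun _ ↦ σ 0
  | _ + 1, σ => Fin.cons (σ 0) fun k ↦ bracket (σ 0) (nikishin (Fin.tail σ) k)

/-- Generating measures of a Nikishin system: admissible, and consecutive ones live on disjoint
intervals. -/
structure IsGenerator {m : ℕ} (σ : Fin (m + 1) → SignedMeasure ℝ) : Prop where
  admissible : ∀ j, IsAdmissible (σ j)
  disjoint : ∀ j : Fin m, Disjoint (hull (σ j.castSucc)) (hull (σ j.succ))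

/-- `Q` is a type II polynomial relative to the multi-index `n` for the Cauchy transforms of the
measures `s`, and `P k` are the associated numerators. -/
structure IsTypeII {m : ℕ} (s : Fin (m + 1) → SignedMeasure ℝ) (n : Fin (m + 1) → ℕ)
    (Q : ℂ[X]) (P : Fin (m + 1) → ℂ[X]) : Prop where
  ne_zero : Q ≠ 0
  natDegree_le : Q.natDegree ≤ ∑ j, n j
  isBigO : ∀ k, (fun z : ℂ ↦ Q.eval z * cauchyTransform (s k) z - (P k).eval z)
    =O[Bornology.cobounded ℂ] fun z : ℂ ↦ (1 / z ^ (n k + 1) : ℂ)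

/-- `x` enumerates, without repetition, the zeros of `Q` in `ℂ`. -/
structure IsZeroEnumeration (Q : ℂ[X]) {N : ℕ} (x : Fin N → ℝ) : Prop where
  injective : Function.Injective x
  isRoot_iff : ∀ z : ℂ, Q.IsRoot z ↔ ∃ i, z = x i

/-- The coefficient of `1 / (z - ξ)` in `P / Q` at a simple zero `ξ` of `Q`. -/
def weight (Q P : ℂ[X]) (ξ : ℝ) : ℂ := P.eval (ξ : ℂ) / (derivative Q).eval (ξ : ℂ)

/-- The multi-index `(N, N + 1, …, N + 1)` with `m + 1` components. -/
def stepIndex (m N : ℕ) : Fin (m + 1) → ℕ := Fin.cons N fun _ ↦ N + 1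

/-- The integrator on an interval with left end point `a` associated with `s`:
`t ↦ s [a, t]` for `t > a`, with value `0` at `a`, so that a mass at `a` counts. -/
def distribution (s : SignedMeasure ℝ) (a t : ℝ) : ℝ := if t ≤ a then 0 else s (Set.Icc a t)

/-- `I` is the Riemann–Stieltjes integral `∫ f dα` over `[a, b]`: the limit of the sums
`∑ f(ξ_i) (α(t_{i+1}) - α(t_i))` as the mesh of the tagged partition tends to zero. -/
def HasRSIntegral (f α : ℝ → ℝ) (a b I : ℝ) : Prop :=
  ∀ ε > 0, ∃ δ > 0, ∀ (N : ℕ) (t ξ : ℕ → ℝ), t 0 = a → t N = b →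
    (∀ i < N, t i ≤ ξ i ∧ ξ i ≤ t (i + 1) ∧ t (i + 1) - t i < δ) →
    |∑ i ∈ Finset.range N, f (ξ i) * (α (t (i + 1)) - α (t i)) - I| < ε

/-- `I` is the Riemann–Stieltjes integral of `f` with respect to `s` over `Co (supp σ₀)`. -/
def HasRSIntegralOn (σ₀ s : SignedMeasure ℝ) (f : ℝ → ℝ) (I : ℝ) : Prop :=
  HasRSIntegral f (distribution s (sInf (supp σ₀))) (sInf (supp σ₀)) (sSup (supp σ₀)) I

end NikishinSystem

end

noncomputable section

namespace NikishinSystem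

/-! ### Real polynomials: sign, interpolation and interlacing -/

/-! The decay condition on `Q ŝ_{0,k} - P_k` says that `P_k` is the polynomial part of `Q ŝ_{0,k}`
and that `Q` is orthogonal to all polynomials of degree below `n_k` with respect to `s_{0,k}`. Up to
sign, `s_{0,k}` is `u_k dμ_0`, where `μ_0 = |σ_0|` and `u_k` is an iterated Cauchy transform
(`chain`) of positive measures, continuous and zero-free on the hull `Δ` of `supp σ_0`, with `u_0 =
1`. Everything then rests on the forms `∑ p_k u_k` with `deg p_k < n_k`: given fewer than `|n|`
points of `Δ`, some nonzero form has the weak sign of `∏ (x - z)` over them. Integrating `Q` against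
such a form gives `Q` its `|n|` sign changes in the interior of `Δ`, and division by `Q` turns
orthogonality into exact quadrature.

Signs of the weights (`PositiveSystem.weight_mul_chain_pos`). For a node `ξ` put `q = Q / (x - ξ)`,
and let `H = p_j u_j + (x - ξ) ∑_{k ≠ j} p_k u_k`, with `deg p_j ≤ n_j` and `deg p_k < n_k`, have
the sign of `q` on `Δ`. Orthogonality collapses `∫ q H dμ_0 > 0` to `p_j(ξ) ∫ q u_j dμ_0`, while
`q(ξ) H(ξ) = q(ξ) p_j(ξ) u_j(ξ)`. Comparing the two shows that the weight has the sign of `u_j(ξ)`.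
The special multi-index is needed only for the zero count of `H`.

Zero counts are first proved for finitely supported measures at levels `1, …, m`. Clearing
denominators makes the `u_k` the first row of an upper triangular matrix of polynomials. Its initial
minors, freed from trivial factors, form a family `N_A` satisfying three-term Plücker relations. By
induction each `N_A` has simple real roots in the interval of level `|A|` and alternates with its
neighbours (`MinorFamily.regular_of_sum_lt`, through `SplitsIn.of_alternates`). Evaluating a form at
the roots of a minor trades it for a form with one column fewer, and the identity `∑ h(η) / f'(η) =
0` for `deg h ≤ deg f - 2` excludes too many zeros (`MinorFamily.natDegree_add_lt_of_dvd`). General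
measures are limits of discrete ones. Only weak signs survive, normalisation keeps the coefficients
nonzero, and independence of the `u_k` over the polynomials
(`PositiveSystem.eq_zero_of_sum_chain_eq_zero`) keeps the limit form from vanishing on the support.

Convergence. Positive weights and exactness on polynomials give convergence for continuous
functions, then for functions squeezed between continuous ones with close integrals. A bounded
function is Riemann–Stieltjes integrable if and only if it is continuous almost everywhere. As the
`u_k` have no zeros on `Δ`, all `s_{0,k}` have the null sets of `μ_0`, so integrability passes from
one index to all. -/

theorem exists_sign_of_forall_eval_ne_zero {I : Set ℝ} (hI : I.OrdConnected) {g : ℝ[X]}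
    (hg : ∀ x ∈ I, g.eval x ≠ 0) : ∃ s : ℝ, s ≠ 0 ∧ ∀ x ∈ I, 0 < s * g.eval x := by
  rcases I.eq_empty_or_nonempty with rfl | ⟨x₀, hx₀⟩
  · exact ⟨1, one_ne_zero, by simp⟩
  refine ⟨g.eval x₀, hg x₀ hx₀, fun x hx ↦ ?_⟩
  by_contra! h
  have hivt := intermediate_value_uIcc (f := fun y ↦ g.eval y) (a := x₀) (b := x)
    g.continuous.continuousOn
  have h0 : (0 : ℝ) ∈ Set.uIcc (g.eval x₀) (g.eval x) := by
    rw [Set.mem_uIcc]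
    rcases mul_nonpos_iff.1 h with h | h
    · exact Or.inr ⟨h.2, h.1⟩
    · exact Or.inl h
  obtain ⟨y, hy, hy0⟩ := hivt h0
  exact hg y (hI.uIcc_subset hx₀ hx hy) hy0

/-- The roots of odd multiplicity in an interval account for the sign of a polynomial. -/
theorem exists_finset_roots_mul_nonneg {I : Set ℝ} (hI : I.OrdConnected) {g : ℝ[X]} (hg : g ≠ 0) :
    ∃ (Z : Finset ℝ) (s : ℝ), s ≠ 0 ∧ (∀ z ∈ Z, z ∈ I ∧ g.IsRoot z) ∧
      ∀ x ∈ I, 0 ≤ s * (g.eval x * ∏ z ∈ Z, (x - z)) := by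
  induction hd : g.natDegree using Nat.strong_induction_on generalizing g with
  | _ d ih =>
  by_cases hr : ∀ x ∈ I, g.eval x ≠ 0
  · obtain ⟨s, hs, h⟩ := exists_sign_of_forall_eval_ne_zero hI hr
    exact ⟨∅, s, hs, by simp, fun x hx ↦ by simpa using (h x hx).le⟩
  push Not at hr
  obtain ⟨z, hz, hz0⟩ := hr
  obtain ⟨g₁, rfl⟩ := dvd_iff_isRoot.2 (show g.IsRoot z from hz0)
  have hg₁ : g₁ ≠ 0 := right_ne_zero_of_mul hg
  have hdeg : g₁.natDegree < d := by
    rw [← hd, natDegree_mul (X_sub_C_ne_zero z) hg₁, natDegree_X_sub_C]; omega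
  obtain ⟨Z, s, hs, hZ, h⟩ := ih _ hdeg hg₁ rfl
  -- The factor `X - z` changes the parity of the multiplicity of `z`, so `z` leaves the list if it
  -- was there and enters it otherwise.
  by_cases hzZ : z ∈ Z
  · refine ⟨Z.erase z, s, hs, fun y hy ↦ ?_, fun x hx ↦ ?_⟩
    · have := hZ y (Finset.mem_of_mem_erase hy)
      exact ⟨this.1, this.2.dvd (dvd_mul_left _ _)⟩
    · have := h x hx
      rw [← Finset.mul_prod_erase _ _ hzZ] at this
      convert this using 2
      simp only [eval_mul, eval_sub, eval_X, eval_C]; ring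
  · refine ⟨insert z Z, s, hs, fun y hy ↦ ?_, fun x hx ↦ ?_⟩
    · rcases Finset.mem_insert.1 hy with rfl | hy
      · exact ⟨hz, by simp⟩
      · exact ⟨(hZ y hy).1, (hZ y hy).2.dvd (dvd_mul_left _ _)⟩
    · rw [Finset.prod_insert hzZ]
      have := mul_nonneg (h x hx) (sq_nonneg (x - z))
      refine this.trans_eq ?_
      simp only [eval_mul, eval_sub, eval_X, eval_C]; ring

theorem prod_X_sub_C_dvd {Z : Finset ℝ} {g : ℝ[X]} (h : ∀ z ∈ Z, g.IsRoot z) :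
    (∏ z ∈ Z, (X - C z)) ∣ g :=
  Finset.prod_dvd_of_coprime
    (fun _ _ _ _ hab ↦ pairwise_coprime_X_sub_C Function.injective_id hab)
    fun z hz ↦ dvd_iff_isRoot.2 (h z hz)

theorem natDegree_prod_X_sub_C (Z : Finset ℝ) : (∏ z ∈ Z, (X - C z) : ℝ[X]).natDegree = Z.card := by
  rw [natDegree_prod_of_monic _ _ fun z _ ↦ monic_X_sub_C z]; simp

theorem monic_prod_X_sub_C_finset (Z : Finset ℝ) : (∏ z ∈ Z, (X - C z) : ℝ[X]).Monic :=
  monic_prod_of_monic _ _ fun z _ ↦ monic_X_sub_C z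

/-- `f` has degree `d`, and `d` distinct roots, all in `I`. -/
def SplitsIn (I : Set ℝ) (d : ℕ) (f : ℝ[X]) : Prop :=
  ∃ (c : ℝ) (Z : Finset ℝ), c ≠ 0 ∧ Z.card = d ∧ (∀ z ∈ Z, z ∈ I) ∧ f = C c * ∏ z ∈ Z, (X - C z)

/-- At the roots of `f`, the sign of `g / f'` is constant. -/
def Alternates (f g : ℝ[X]) : Prop :=
  ∃ s : ℝ, ∀ η, f.IsRoot η → 0 < s * (g.eval η * (derivative f).eval η)

theorem SplitsIn.natDegree_eq {I : Set ℝ} {d : ℕ} {f : ℝ[X]} (h : SplitsIn I d f) :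
    f.natDegree = d := by
  obtain ⟨c, Z, hc, rfl, -, rfl⟩ := h
  rw [natDegree_C_mul hc, natDegree_prod_X_sub_C]

theorem isRoot_C_mul_prod_iff {c : ℝ} (hc : c ≠ 0) {Z : Finset ℝ} {x : ℝ} :
    (C c * ∏ z ∈ Z, (X - C z)).IsRoot x ↔ x ∈ Z := by
  simp only [IsRoot.def, eval_mul, eval_C, mul_eq_zero, hc, false_or, eval_prod,
    Finset.prod_eq_zero_iff, eval_sub, eval_X, sub_eq_zero]
  exact ⟨fun ⟨a, ha, h⟩ ↦ h ▸ ha, fun h ↦ ⟨x, h, rfl⟩⟩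

theorem SplitsIn.mem_of_isRoot {I : Set ℝ} {d : ℕ} {f : ℝ[X]} (h : SplitsIn I d f) {x : ℝ}
    (hx : f.IsRoot x) : x ∈ I := by
  obtain ⟨c, Z, hc, -, hZ, rfl⟩ := h
  exact hZ x ((isRoot_C_mul_prod_iff hc).1 hx)

theorem SplitsIn.exists_sign {I J : Set ℝ} {d : ℕ} {f : ℝ[X]} (h : SplitsIn I d f)
    (hJ : J.OrdConnected) (hIJ : Disjoint I J) : ∃ s : ℝ, s ≠ 0 ∧ ∀ x ∈ J, 0 < s * f.eval x :=
  exists_sign_of_forall_eval_ne_zero hJ fun _ hx h0 ↦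
    Set.disjoint_left.1 hIJ (h.mem_of_isRoot h0) hx

theorem eval_derivative_C_mul_prod {c : ℝ} {Z : Finset ℝ} {x : ℝ} (hx : x ∈ Z) :
    (derivative (C c * ∏ z ∈ Z, (X - C z))).eval x = c * ∏ z ∈ Z.erase x, (x - z) := by
  rw [← Finset.mul_prod_erase _ _ hx]
  simp [eval_prod]

/-- The sum is the coefficient of degree `Z.card - 1` in the Lagrange interpolant of `h`, which is
`h` itself. -/
theorem sum_eval_div_prod_eq_zero {Z : Finset ℝ} {h : ℝ[X]} (hd : h.natDegree + 1 < Z.card) :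
    ∑ η ∈ Z, h.eval η / ∏ z ∈ Z.erase η, (η - z) = 0 := by
  have := Lagrange.coeff_eq_sum (s := Z) (v := id) Function.injective_id.injOn (P := h)
    (by
      refine lt_of_le_of_lt degree_le_natDegree ?_
      exact_mod_cast (by omega : h.natDegree < Z.card))
  simp only [id] at this
  rw [← this]
  exact coeff_eq_zero_of_natDegree_lt (by omega)

/-- If `g` had fewer than `d` roots of odd order in `I`, the product `h` of the corresponding
factors would satisfy `deg h ≤ d - 1`, while all terms `h(η) / f'(η)` would have one strict sign,
against the vanishing Lagrange sum. Hence `g` has `d` roots there, and its degree allows no more.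
The converse alternation comes from the Wronskian. -/
theorem SplitsIn.of_alternates {I : Set ℝ} (hI : I.OrdConnected) {d : ℕ} {f g : ℝ[X]}
    (hf : SplitsIn I (d + 1) f) (hg : g.natDegree ≤ d) (hfg : Alternates f g) :
    SplitsIn I d g ∧ Alternates g f := by
  obtain ⟨c, Z, hc, hcard, hZ, rfl⟩ := hf
  obtain ⟨s, hs⟩ := hfg
  have hs' : ∀ η ∈ Z, 0 < s * (g.eval η * (c * ∏ z ∈ Z.erase η, (η - z))) := fun η hη ↦ by
    have := hs η ((isRoot_C_mul_prod_iff hc).2 hη)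
    rwa [eval_derivative_C_mul_prod hη] at this
  have hprod : ∀ η ∈ Z, ∏ z ∈ Z.erase η, (η - z) ≠ 0 := fun η hη h0 ↦ by
    have := hs' η hη; simp [h0] at this
  have hgη : ∀ η ∈ Z, g.eval η ≠ 0 := fun η hη h0 ↦ by
    have := hs' η hη; simp [h0] at this
  have hne : Z.Nonempty := Finset.card_pos.1 (by omega)
  have hg0 : g ≠ 0 := by
    rintro rfl
    obtain ⟨η, hη⟩ := hne
    exact hgη η hη (by simp)
  constructor
  · obtain ⟨W, t, ht, hW, hpos⟩ := exists_finset_roots_mul_nonneg hI hg0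
    have hWcard : d ≤ W.card := by
      by_contra! hlt
      have hsum := sum_eval_div_prod_eq_zero (Z := Z) (h := ∏ z ∈ W, (X - C z))
        (by rw [natDegree_prod_X_sub_C]; omega)
      have : 0 < ∑ η ∈ Z, (s * t * c) *
          ((∏ z ∈ W, (X - C z)).eval η / ∏ z ∈ Z.erase η, (η - z)) := by
        refine Finset.sum_pos (fun η hη ↦ ?_) hne
        have hq : (∏ z ∈ W, (X - C z)).eval η = ∏ z ∈ W, (η - z) := by simp [eval_prod]
        have hq0 : ∏ z ∈ W, (η - z) ≠ 0 := by
          refine Finset.prod_ne_zero_iff.2 fun z hz h0 ↦ hgη η hη ?_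
          rw [sub_eq_zero.1 h0]; exact (hW z hz).2
        have h1 := hs' η hη
        have h2 : 0 < t * (g.eval η * ∏ z ∈ W, (η - z)) :=
          lt_of_le_of_ne (hpos η (hZ η hη)) (mul_ne_zero ht (mul_ne_zero (hgη η hη) hq0)).symm
        rw [hq]
        have h3 : 0 < ((s * (g.eval η * (c * ∏ z ∈ Z.erase η, (η - z)))) *
            (t * (g.eval η * ∏ z ∈ W, (η - z)))) /
            (g.eval η ^ 2 * (∏ z ∈ Z.erase η, (η - z)) ^ 2) := by
          have := hgη η hη
          have := hprod η hη
          positivity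
        refine h3.trans_eq ?_
        have := hgη η hη
        have := hprod η hη
        field_simp
      rw [← Finset.mul_sum, hsum, mul_zero] at this
      exact lt_irrefl _ this
    obtain ⟨r, hr⟩ := prod_X_sub_C_dvd (Z := W) (g := g) fun z hz ↦ (hW z hz).2
    have hr0 : r ≠ 0 := by rintro rfl; simp at hr; exact hg0 hr
    have hdeg : g.natDegree = W.card + r.natDegree := by
      rw [hr, (monic_prod_X_sub_C_finset W).natDegree_mul' hr0, natDegree_prod_X_sub_C]
    have hrC := eq_C_of_natDegree_eq_zero (p := r) (by omega)
    refine ⟨r.coeff 0, W, fun h0 ↦ hr0 (by rw [hrC, h0, C_0]), by omega,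
      fun z hz ↦ (hW z hz).1, ?_⟩
    rw [← hrC, hr]; ring
  · refine ⟨-s, fun ζ hζ ↦ ?_⟩
    have hζZ : ζ ∉ Z := fun h ↦ hgη ζ h hζ
    have hinterp : g = ∑ η ∈ Z, C (g.eval η / ∏ z ∈ Z.erase η, (η - z)) *
        ∏ z ∈ Z.erase η, (X - C z) := by
      have h1 := Lagrange.eq_interpolate (s := Z) (v := id) (f := g)
        Function.injective_id.injOn (by
          refine lt_of_le_of_lt degree_le_natDegree ?_
          exact_mod_cast (by omega : g.natDegree < Z.card))
      rw [Lagrange.interpolate_apply] at h1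
      conv_lhs => rw [h1]
      refine Finset.sum_congr rfl fun η _ ↦ ?_
      rw [Lagrange.basis]
      simp only [Lagrange.basisDivisor, id]
      rw [Finset.prod_mul_distrib, ← map_prod C, Finset.prod_inv_distrib, ← mul_assoc, ← C_mul,
        div_eq_mul_inv]
    -- The partial fractions of `g / f` have residues of one sign, so `(g / f)' f²`, which is `f g'`
    -- at a root of `g`, has a fixed sign.
    have key : (C c * ∏ z ∈ Z, (X - C z)).eval ζ * (derivative g).eval ζ =
        - ∑ η ∈ Z, c * (g.eval η / ∏ z ∈ Z.erase η, (η - z)) *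
          (∏ z ∈ Z.erase η, (ζ - z)) ^ 2 := by
      have hW : (C c * ∏ z ∈ Z, (X - C z)) * derivative g -
          g * derivative (C c * ∏ z ∈ Z, (X - C z)) =
          - ∑ η ∈ Z, C c * C (g.eval η / ∏ z ∈ Z.erase η, (η - z)) *
            (∏ z ∈ Z.erase η, (X - C z)) ^ 2 := by
        conv_lhs => rw [hinterp]
        rw [derivative_sum, Finset.mul_sum, Finset.sum_mul, ← Finset.sum_sub_distrib,
          ← Finset.sum_neg_distrib]
        refine Finset.sum_congr rfl fun η hη ↦ ?_
        rw [← Finset.mul_prod_erase Z (fun z ↦ (X - C z)) hη]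
        simp only [derivative_mul, derivative_C, derivative_sub, derivative_X]
        ring
      have := congrArg (eval ζ) hW
      simp only [eval_sub, eval_mul, eval_neg, eval_finsetSum, eval_pow, eval_prod, eval_C,
        eval_X, show g.eval ζ = 0 from hζ, zero_mul, sub_zero] at this
      simpa [eval_prod] using this
    rw [key, neg_mul_neg, Finset.mul_sum]
    refine Finset.sum_pos (fun η hη ↦ ?_) hne
    have h1 := hs' η hη
    have h4 : ∏ z ∈ Z.erase η, (ζ - z) ≠ 0 :=
      Finset.prod_ne_zero_iff.2 fun z hz h0 ↦ hζZ (by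
        rw [sub_eq_zero.1 h0]; exact Finset.mem_of_mem_erase hz)
    have h5 := hprod η hη
    have h3 : 0 < (s * (g.eval η * (c * ∏ z ∈ Z.erase η, (η - z)))) *
      ((∏ z ∈ Z.erase η, (ζ - z)) / (∏ z ∈ Z.erase η, (η - z))) ^ 2 := by positivity
    refine h3.trans_eq ?_
    field_simp

/-! ### Families of polynomials indexed by sets of columns -/

/-- The number of elements of `A` that are at least `A.card`. -/
def excess (A : Finset ℕ) : ℕ := (A.filter (A.card ≤ ·)).card

/-- A family of polynomials that satisfies the three-term relations between initial minors of a
matrix, and whose initial members split in prescribed intervals. -/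
structure MinorFamily (m : ℕ) (I : ℕ → Set ℝ) (K : ℕ → ℕ) (N : Finset ℕ → ℝ[X]) : Prop where
  ordConnected : ∀ i, (I i).OrdConnected
  disjoint : ∀ i, Disjoint (I i) (I (i + 1))
  three_term : ∀ (R : Finset ℕ) (a b c : ℕ), insert a (insert b (insert c R)) ⊆ Finset.range (m + 1) →
    a ∉ R → b ∉ R → c ∉ R → a ≠ b → a ≠ c → b ≠ c →
    ∃ s₁ s₂ s₃ : ℝ, s₁ ≠ 0 ∧ s₂ ≠ 0 ∧ s₃ ≠ 0 ∧
      C s₁ * (N (insert a R) * N (insert b (insert c R))) +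
      C s₂ * (N (insert b R) * N (insert a (insert c R))) +
      C s₃ * (N (insert c R) * N (insert a (insert b R))) = 0
  natDegree_le : ∀ A ⊆ Finset.range (m + 1), (N A).natDegree ≤ K A.card - excess A
  -- This makes `K A.card - excess A` a genuine subtraction for `1 ≤ A.card ≤ m`.
  le_K : ∀ i, 1 ≤ i → i ≤ m → m + 2 ≤ K i
  splits_range : ∀ i ≤ m + 1, SplitsIn (I i) (K i) (N (Finset.range i))
  alternates : ∀ i, 1 ≤ i → i ≤ m →
    Alternates (N (Finset.range i)) (N (insert i (Finset.range (i - 1))))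

theorem excess_le (A : Finset ℕ) : excess A ≤ A.card := Finset.card_filter_le _ _

theorem excess_range (i : ℕ) : excess (Finset.range i) = 0 := by
  rw [excess, Finset.card_eq_zero, Finset.filter_eq_empty_iff]
  intro x hx
  simpa using hx

theorem eq_range_of_excess_eq_zero {A : Finset ℕ} (h : excess A = 0) :
    A = Finset.range A.card := by
  rw [excess, Finset.card_eq_zero, Finset.filter_eq_empty_iff] at h
  exact Finset.eq_of_subset_of_card_le (fun x hx ↦ by simpa using h hx) (by simp)

theorem exists_of_excess_ne_zero {A : Finset ℕ} (h : excess A ≠ 0) :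
    ∃ b ∈ A, A.card ≤ b ∧ ∃ j < A.card, j ∉ A := by
  obtain ⟨b, hb⟩ := Finset.card_pos.1 (Nat.pos_of_ne_zero h)
  rw [Finset.mem_filter] at hb
  refine ⟨b, hb.1, hb.2, ?_⟩
  by_contra! hall
  have hsub : insert b (Finset.range A.card) ⊆ A := by
    intro x hx
    rcases Finset.mem_insert.1 hx with rfl | hx
    · exact hb.1
    · exact hall x (by simpa using hx)
  have := Finset.card_le_card hsub
  rw [Finset.card_insert_of_notMem (by simpa using hb.2), Finset.card_range] at this
  omega

theorem excess_exchange {A : Finset ℕ} {b j : ℕ} (hb : b ∈ A) (hbA : A.card ≤ b)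
    (hj : j < A.card) (hjA : j ∉ A) :
    (insert j (A.erase b)).card = A.card ∧ excess (insert j (A.erase b)) + 1 = excess A := by
  have hcard : (insert j (A.erase b)).card = A.card := by
    rw [Finset.card_insert_of_notMem (fun h ↦ hjA (Finset.mem_of_mem_erase h)),
      Finset.card_erase_of_mem hb]
    have := Finset.card_pos.2 ⟨b, hb⟩
    omega
  refine ⟨hcard, ?_⟩
  rw [excess, excess, hcard, Finset.filter_insert, if_neg (by omega), Finset.filter_erase,
    Finset.card_erase_add_one]
  simp [hb, hbA]

/-- Sign bookkeeping at a root of `N A`. A three-term relation has two terms left there, and since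
the cofactors `D` and `E` have known signs, the sign of `x f` determines that of `y f`. -/
theorem mul_pos_of_relation {s s₂ s₃ d c x y f D E : ℝ} (hs₂ : s₂ ≠ 0)
    (h : s₂ * (x * D) + s₃ * (y * E) = 0) (hx : 0 < s * (x * f)) (hD : 0 < d * D)
    (hE : 0 < c * E) : 0 < (-s * s₂ * s₃ * d * c) * (y * f) := by
  have hE2 : 0 < E ^ 2 := by
    have : E ≠ 0 := by rintro rfl; simp at hE
    positivity
  refine (mul_pos_iff_of_pos_right hE2).1 ?_
  have h1 : s₃ * y * E = -(s₂ * (x * D)) := by linarith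
  have h2 : (-s * s₂ * s₃ * d * c) * (y * f) * E ^ 2 =
      (s * (x * f)) * (d * D) * (c * E) * s₂ ^ 2 := by
    calc _ = -s * s₂ * d * c * f * E * (s₃ * y * E) := by ring
      _ = _ := by rw [h1]; ring
  rw [h2]; positivity

/-! ### Roots and interlacing of the members of a minor family -/

namespace MinorFamily

variable {m : ℕ} {I : ℕ → Set ℝ} {K : ℕ → ℕ} {N : Finset ℕ → ℝ[X]}

/-- In the relation for the columns `r, c, d` over `A.erase r`, the term containing `N A` drops out
at the roots of `N A`. The rest links the two exchanged minors through `N (insert c A)` and `N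
(insert d A)`, which keep their signs on `J`. -/
theorem alternates_change_added (hN : MinorFamily m I K N) {A : Finset ℕ}
    (hA : A ⊆ Finset.range (m + 1)) {J : Set ℝ} (hJ : ∀ x, (N A).IsRoot x → x ∈ J) {r c d : ℕ}
    (hr : r ∈ A) (hc : c ∉ A) (hd : d ∉ A) (hcm : c ≤ m) (hdm : d ≤ m)
    (hsc : ∃ s : ℝ, s ≠ 0 ∧ ∀ x ∈ J, 0 < s * (N (insert c A)).eval x)
    (hsd : ∃ s : ℝ, s ≠ 0 ∧ ∀ x ∈ J, 0 < s * (N (insert d A)).eval x)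
    (h : Alternates (N A) (N (insert c (A.erase r)))) :
    Alternates (N A) (N (insert d (A.erase r))) := by
  rcases eq_or_ne c d with rfl | hcd
  · exact h
  obtain ⟨s₁, s₂, s₃, -, hs₂, -, hrel⟩ := hN.three_term (A.erase r) r c d
    (by
      intro x hx
      simp only [Finset.mem_insert, Finset.mem_erase] at hx
      rcases hx with rfl | rfl | rfl | hx
      · exact hA hr
      · simpa using Nat.lt_succ_of_le hcm
      · simpa using Nat.lt_succ_of_le hdm
      · exact hA hx.2)
    (by simp) (by simp [hc]) (by simp [hd]) (by rintro rfl; exact hc hr)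
    (by rintro rfl; exact hd hr) hcd
  rw [Finset.insert_erase hr, Finset.insert_comm r d, Finset.insert_comm r c,
    Finset.insert_erase hr] at hrel
  obtain ⟨sc, -, hsc⟩ := hsc
  obtain ⟨sd, -, hsd⟩ := hsd
  obtain ⟨s, hs⟩ := h
  refine ⟨-s * s₂ * s₃ * sd * sc, fun η hη ↦ ?_⟩
  have he := congrArg (eval η) hrel
  simp only [eval_add, eval_mul, eval_C, show (N A).eval η = 0 from hη, zero_mul, mul_zero,
    zero_add, eval_zero] at he
  exact mul_pos_of_relation hs₂ he (hs η hη) (hsd η (hJ η hη)) (hsc η (hJ η hη))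

/-- The same with the columns `d, r, r'` over `A` without `r` and `r'`. The cofactors of known sign
are now `N (A.erase r)` and `N (A.erase r')`. -/
theorem alternates_change_removed (hN : MinorFamily m I K N) {A : Finset ℕ}
    (hA : A ⊆ Finset.range (m + 1)) {J : Set ℝ} (hJ : ∀ x, (N A).IsRoot x → x ∈ J) {r r' d : ℕ}
    (hr : r ∈ A) (hr' : r' ∈ A) (hd : d ∉ A) (hdm : d ≤ m)
    (hsr : ∃ s : ℝ, s ≠ 0 ∧ ∀ x ∈ J, 0 < s * (N (A.erase r)).eval x)
    (hsr' : ∃ s : ℝ, s ≠ 0 ∧ ∀ x ∈ J, 0 < s * (N (A.erase r')).eval x)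
    (h : Alternates (N A) (N (insert d (A.erase r)))) :
    Alternates (N A) (N (insert d (A.erase r'))) := by
  rcases eq_or_ne r r' with rfl | hrr
  · exact h
  have e1 : insert r ((A.erase r).erase r') = A.erase r' := by
    rw [Finset.erase_right_comm, Finset.insert_erase (by simp [hr, hrr])]
  have e2 : insert r' ((A.erase r).erase r') = A.erase r := by
    rw [Finset.insert_erase (by simp [hr', hrr.symm])]
  obtain ⟨s₁, s₂, s₃, -, hs₂, -, hrel⟩ := hN.three_term ((A.erase r).erase r') d r r'
    (by
      intro x hx
      simp only [Finset.mem_insert, Finset.mem_erase] at hx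
      rcases hx with rfl | rfl | rfl | hx
      · simpa using Nat.lt_succ_of_le hdm
      · exact hA hr
      · exact hA hr'
      · exact hA hx.2.2)
    (by simp [hd]) (by simp) (by simp) (by rintro rfl; exact hd hr)
    (by rintro rfl; exact hd hr') hrr
  rw [e1, e2, Finset.insert_erase hr] at hrel
  obtain ⟨sr, -, hsr⟩ := hsr
  obtain ⟨sr', -, hsr'⟩ := hsr'
  obtain ⟨s, hs⟩ := h
  refine ⟨-s * s₂ * s₃ * sr' * sr, fun η hη ↦ ?_⟩
  have he := congrArg (eval η) hrel
  simp only [eval_add, eval_mul, eval_C, show (N A).eval η = 0 from hη, mul_zero,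
    zero_add, eval_zero] at he
  refine mul_pos_of_relation hs₂ ?_ (hs η hη) (hsr' η (hJ η hη)) (hsr η (hJ η hη))
  linarith

theorem alternates_change (hN : MinorFamily m I K N) {A : Finset ℕ}
    (hA : A ⊆ Finset.range (m + 1)) {J : Set ℝ} (hJ : ∀ x, (N A).IsRoot x → x ∈ J) {r r' c d : ℕ}
    (hr : r ∈ A) (hr' : r' ∈ A) (hc : c ∉ A) (hd : d ∉ A) (hcm : c ≤ m) (hdm : d ≤ m)
    (hsc : ∃ s : ℝ, s ≠ 0 ∧ ∀ x ∈ J, 0 < s * (N (insert c A)).eval x)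
    (hsd : ∃ s : ℝ, s ≠ 0 ∧ ∀ x ∈ J, 0 < s * (N (insert d A)).eval x)
    (hsr : ∃ s : ℝ, s ≠ 0 ∧ ∀ x ∈ J, 0 < s * (N (A.erase r)).eval x)
    (hsr' : ∃ s : ℝ, s ≠ 0 ∧ ∀ x ∈ J, 0 < s * (N (A.erase r')).eval x)
    (h : Alternates (N A) (N (insert c (A.erase r)))) :
    Alternates (N A) (N (insert d (A.erase r'))) :=
  hN.alternates_change_removed hA hJ hr hr' hd hdm hsr hsr'
    (hN.alternates_change_added hA hJ hr hc hd hcm hdm hsc hsd h)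

theorem card_le_of_excess_ne_zero {A : Finset ℕ} (hA : A ⊆ Finset.range (m + 1))
    (h : excess A ≠ 0) : 1 ≤ A.card ∧ A.card ≤ m := by
  obtain ⟨b, hb, hbA, j, hj, -⟩ := exists_of_excess_ne_zero h
  have := hA hb
  rw [Finset.mem_range] at this
  omega

/-- The conclusion of the induction: `N A` splits, and it alternates with the members of the family
of smaller weight obtained by exchanging one element. -/
def Regular (I : ℕ → Set ℝ) (K : ℕ → ℕ) (N : Finset ℕ → ℝ[X]) (A : Finset ℕ) : Prop :=
  SplitsIn (I A.card) (K A.card - excess A) (N A) ∧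
    ∀ b ∈ A, A.card ≤ b → ∀ j < A.card, j ∉ A → Alternates (N A) (N (insert j (A.erase b)))

theorem sum_exchange {A : Finset ℕ} {b j : ℕ} (hb : b ∈ A) (hj : j ∉ A) :
    ∑ x ∈ insert j (A.erase b), x + b = ∑ x ∈ A, x + j := by
  rw [Finset.sum_insert (fun h ↦ hj (Finset.mem_of_mem_erase h)), ← Finset.add_sum_erase A _ hb]
  ring

/-- Induction on the defect of a set, the amount by which its sum exceeds the least sum for its
cardinality. If `A'` is not initial, trading some `b ≥ A'.card` in it for a missing `j < A'.card`
gives a set `A` of smaller defect and excess one less. The neighbours of `A` that occur also have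
smaller defect and split in adjacent intervals, so they keep their sign on the interval of `A`. A
known alternation at `A` is thus carried over to the exchange that leads back to `A'`, and
`SplitsIn.of_alternates` applies. -/
theorem regular_of_sum_lt (hN : MinorFamily m I K N) (n : ℕ) : ∀ A ⊆ Finset.range (m + 1),
    ∑ x ∈ A, x < n + ∑ x ∈ Finset.range A.card, x → Regular I K N A := by
  induction n with
  | zero =>
    intro A _ h
    exfalso
    have : ∑ x ∈ Finset.range A.card, x ≤ ∑ x ∈ A, x := by
      clear h
      induction A using Finset.induction_on_max with
      | empty => simp
      | insert a s has ih =>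
        have hna : a ∉ s := fun h ↦ lt_irrefl _ (has a h)
        have hs : s.card ≤ a := by
          simpa using Finset.card_le_card (fun x hx ↦ Finset.mem_range.2 (has x hx) : s ⊆ Finset.range a)
        rw [Finset.card_insert_of_notMem hna, Finset.sum_range_succ, Finset.sum_insert hna]
        have := ih ((Finset.subset_insert _ _).trans ‹_›)
        omega
    omega
  | succ n ih =>
  intro A' hA' hlt
  have hzero : ∀ i ≤ m + 1, Regular I K N (Finset.range i) := fun i hi ↦ by
    refine ⟨by simpa [excess_range] using hN.splits_range i hi, fun b hb hbi ↦ ?_⟩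
    simp at hb hbi; omega
  by_cases he : excess A' = 0
  · rw [eq_range_of_excess_eq_zero he]
    exact hzero _ (by simpa using Finset.card_le_card hA')
  obtain ⟨hi1, him⟩ := card_le_of_excess_ne_zero hA' he
  have key : ∀ b ∈ A', A'.card ≤ b → ∀ j < A'.card, j ∉ A' →
      SplitsIn (I A'.card) (K A'.card - excess A') (N A') ∧
        Alternates (N A') (N (insert j (A'.erase b))) := by
    intro b hb hbi j hj hjA
    obtain ⟨hcard, hex⟩ := excess_exchange hb hbi hj hjA
    have hsum := sum_exchange hb hjA
    set A := insert j (A'.erase b) with hAdef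
    have hbm : b ≤ m := by have := hA' hb; rw [Finset.mem_range] at this; omega
    have hA : A ⊆ Finset.range (m + 1) := by
      intro x hx
      rcases Finset.mem_insert.1 hx with rfl | hx
      · simp; omega
      · exact hA' (Finset.mem_of_mem_erase hx)
    have hjA' : j ∈ A := Finset.mem_insert_self _ _
    have hbA : b ∉ A := by
      simp only [hAdef, Finset.mem_insert, Finset.mem_erase, not_or]
      exact ⟨by omega, by simp⟩
    have hback : insert b (A.erase j) = A' := by
      rw [hAdef, Finset.erase_insert (fun h ↦ hjA (Finset.mem_of_mem_erase h)),
        Finset.insert_erase hb]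
    have hregA : Regular I K N A := ih A hA (by rw [hcard]; omega)
    have hJ : ∀ x, (N A).IsRoot x → x ∈ I A.card := fun x hx ↦ hregA.1.mem_of_isRoot hx
    -- Compared with `A'`, the defect changes by `j - b + c - A.card`, which is negative because `c
    -- ≤ b` and `j < A.card`.
    have hup : ∀ c, c ∉ A → c ≤ b → Regular I K N (insert c A) := fun c hc hcb ↦ by
      refine ih _ ?_ ?_
      · intro x hx
        rcases Finset.mem_insert.1 hx with rfl | hx
        · simp; omega
        · exact hA hx
      · rw [Finset.card_insert_of_notMem hc, Finset.sum_range_succ, Finset.sum_insert hc, hcard]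
        omega
    -- The defect changes by `j - b - r + A.card - 1`, negative if `r = j` because `A.card ≤ b`, and
    -- if `A.card - 1 ≤ r` because `j < b`.
    have hdown : ∀ r ∈ A, (r = j ∨ A.card ≤ r + 1) → Regular I K N (A.erase r) := fun r hr hrj ↦ by
      refine ih _ ((Finset.erase_subset _ _).trans hA) ?_
      have h1 := Finset.add_sum_erase A (fun x ↦ x) hr
      have h2 : ∑ x ∈ Finset.range A.card, x =
          ∑ x ∈ Finset.range (A.card - 1), x + (A.card - 1) := by
        rw [← Finset.sum_range_succ]; congr 2; omega
      rw [Finset.card_erase_of_mem hr]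
      rw [← hcard] at hlt
      omega
    have hsup : ∀ c, c ∉ A → c ≤ b →
        ∃ s : ℝ, s ≠ 0 ∧ ∀ x ∈ I A.card, 0 < s * (N (insert c A)).eval x := fun c hc hcb ↦
      (hup c hc hcb).1.exists_sign (hN.ordConnected _) (by
        rw [Finset.card_insert_of_notMem hc]; exact (hN.disjoint _).symm)
    have hsdown : ∀ r ∈ A, (r = j ∨ A.card ≤ r + 1) →
        ∃ s : ℝ, s ≠ 0 ∧ ∀ x ∈ I A.card, 0 < s * (N (A.erase r)).eval x := fun r hr hrj ↦
      (hdown r hr hrj).1.exists_sign (hN.ordConnected _) (by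
        have := hN.disjoint (A.card - 1)
        rwa [Nat.sub_add_cancel (by omega), ← Finset.card_erase_of_mem hr] at this)
    have halt : Alternates (N A) (N A') := by
      rw [← hback]
      -- The alternation to start from is an axiom of the family if `A` is initial, and otherwise
      -- part of the induction hypothesis for `A`.
      by_cases heA : excess A = 0
      · have hAr := eq_range_of_excess_eq_zero heA
        have h0 := hN.alternates A.card (by omega) (by omega)
        have hl : A.card - 1 ∈ A := by
          have h := Finset.mem_range.2 (show A.card - 1 < A.card by omega)
          rwa [← hAr] at h
        have hni : A.card ∉ A := by
          intro h; rw [hAr] at h; simp at h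
        have herase : Finset.range (A.card - 1) = A.erase (A.card - 1) := by
          conv_rhs => rw [hAr]
          ext x; simp; omega
        rw [← hAr, herase] at h0
        exact hN.alternates_change hA hJ hl hjA' hni hbA (by omega) hbm
          (hsup _ hni (by omega)) (hsup _ hbA le_rfl) (hsdown _ hl (Or.inr (by omega)))
          (hsdown _ hjA' (Or.inl rfl)) h0
      · obtain ⟨b₀, hb₀, hb₀A, j₀, hj₀, hj₀A⟩ := exists_of_excess_ne_zero heA
        exact hN.alternates_change hA hJ hb₀ hjA' hj₀A hbA (by omega) hbm
          (hsup _ hj₀A (by omega)) (hsup _ hbA le_rfl) (hsdown _ hb₀ (Or.inr (by omega)))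
          (hsdown _ hjA' (Or.inl rfl)) (hregA.2 b₀ hb₀ hb₀A j₀ hj₀ hj₀A)
    have hK := hN.le_K A'.card hi1 him
    have hexle := excess_le A'
    have hsp := hregA.1
    rw [hcard, show K A'.card - excess A = (K A'.card - excess A') + 1 by omega] at hsp
    exact hsp.of_alternates (hN.ordConnected _) (hN.natDegree_le A' hA') halt
  obtain ⟨b, hb, hbi, j, hj, hjA⟩ := exists_of_excess_ne_zero he
  exact ⟨(key b hb hbi j hj hjA).1, fun b hb hbi j hj hjA ↦ (key b hb hbi j hj hjA).2⟩

theorem regular (hN : MinorFamily m I K N) {A : Finset ℕ} (hA : A ⊆ Finset.range (m + 1)) :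
    Regular I K N A :=
  hN.regular_of_sum_lt (∑ x ∈ A, x + 1) A hA (by omega)

theorem splitsIn (hN : MinorFamily m I K N) {A : Finset ℕ} (hA : A ⊆ Finset.range (m + 1)) :
    SplitsIn (I A.card) (K A.card - excess A) (N A) := (hN.regular hA).1

theorem exists_sign_insert (hN : MinorFamily m I K N) {A : Finset ℕ}
    (hA : A ⊆ Finset.range (m + 1)) {c : ℕ} (hc : c ∉ A) (hcm : c ≤ m) :
    ∃ s : ℝ, s ≠ 0 ∧ ∀ x ∈ I A.card, 0 < s * (N (insert c A)).eval x :=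
  (hN.splitsIn (A := insert c A) (by
    intro x hx
    rcases Finset.mem_insert.1 hx with rfl | hx
    · simp; omega
    · exact hA hx)).exists_sign (hN.ordConnected _) (by
        rw [Finset.card_insert_of_notMem hc]; exact (hN.disjoint _).symm)

theorem exists_sign_erase (hN : MinorFamily m I K N) {A : Finset ℕ}
    (hA : A ⊆ Finset.range (m + 1)) {r : ℕ} (hr : r ∈ A) :
    ∃ s : ℝ, s ≠ 0 ∧ ∀ x ∈ I A.card, 0 < s * (N (A.erase r)).eval x :=
  (hN.splitsIn ((Finset.erase_subset r A).trans hA)).exists_sign (hN.ordConnected _) (by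
    have := hN.disjoint (A.card - 1)
    have h1 := Finset.card_pos.2 ⟨r, hr⟩
    rwa [Nat.sub_add_cancel (by omega), ← Finset.card_erase_of_mem hr] at this)

/-- Once every member is known to split, all neighbours of `A` have constant sign on its interval,
so one known alternation spreads to all exchanges. -/
theorem alternates_exchange (hN : MinorFamily m I K N) {A : Finset ℕ}
    (hA : A ⊆ Finset.range (m + 1)) {r d : ℕ} (hr : r ∈ A) (hd : d ∉ A) (hdm : d ≤ m) :
    Alternates (N A) (N (insert d (A.erase r))) := by
  have hJ : ∀ x, (N A).IsRoot x → x ∈ I A.card := fun x hx ↦ (hN.splitsIn hA).mem_of_isRoot hx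
  have hcA : A.card < m + 1 := by
    have := Finset.card_lt_card (Finset.ssubset_iff_subset_ne.2 ⟨hA, fun h ↦ hd (by
      rw [h]; simp; omega)⟩)
    simpa using this
  have hpos := Finset.card_pos.2 ⟨r, hr⟩
  by_cases heA : excess A = 0
  · have hAr := eq_range_of_excess_eq_zero heA
    have h0 := hN.alternates A.card (by omega) (by omega)
    have hl : A.card - 1 ∈ A := by
      have h := Finset.mem_range.2 (show A.card - 1 < A.card by omega)
      rwa [← hAr] at h
    have hni : A.card ∉ A := by
      intro h; rw [hAr] at h; simp at h
    have herase : Finset.range (A.card - 1) = A.erase (A.card - 1) := by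
      conv_rhs => rw [hAr]
      ext x; simp; omega
    rw [← hAr, herase] at h0
    exact hN.alternates_change hA hJ hl hr hni hd (by omega) hdm
      (hN.exists_sign_insert hA hni (by omega)) (hN.exists_sign_insert hA hd hdm)
      (hN.exists_sign_erase hA hl) (hN.exists_sign_erase hA hr) h0
  · obtain ⟨b₀, hb₀, hb₀A, j₀, hj₀, hj₀A⟩ := exists_of_excess_ne_zero heA
    exact hN.alternates_change hA hJ hb₀ hr hj₀A hd (by omega) hdm
      (hN.exists_sign_insert hA hj₀A (by omega)) (hN.exists_sign_insert hA hd hdm)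
      (hN.exists_sign_erase hA hb₀) (hN.exists_sign_erase hA hr)
      ((hN.regular hA).2 b₀ hb₀ hb₀A j₀ hj₀ hj₀A)

end MinorFamily

/-! ### Counting zeros of linear forms -/

namespace MinorFamily

variable {m : ℕ} {I : ℕ → Set ℝ} {K : ℕ → ℕ} {N : Finset ℕ → ℝ[X]}

theorem isCoprime_of_splitsIn {J : Set ℝ} {d : ℕ} {f w : ℝ[X]} (hf : SplitsIn J d f)
    (hw : ∀ x ∈ J, w.eval x ≠ 0) : IsCoprime w f := by
  obtain ⟨c, Z, hc, -, hZ, rfl⟩ := hf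
  refine IsCoprime.mul_right ?_ (IsCoprime.prod_right fun z hz ↦ ?_)
  · exact ⟨0, C c⁻¹, by rw [zero_mul, zero_add, ← C_mul, inv_mul_cancel₀ hc, C_1]⟩
  · refine ((irreducible_X_sub_C z).coprime_iff_not_dvd.2 fun h ↦ hw z (hZ z hz) ?_).symm
    exact dvd_iff_isRoot.1 h

/-- At the roots of `N A`, exchanging an element of `A` is adding it, up to a common factor. -/
theorem exists_exchange_eq_insert (hN : MinorFamily m I K N) {R : Finset ℕ}
    (hR : R ⊆ Finset.range (m + 1)) {j b : ℕ} (hj : j ∉ R) (hjm : j ≤ m) (hb : b ∉ R)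
    (hbj : b ≠ j) (hbm : b ≤ m) {k : ℕ} (hk : k ∉ R) (hkj : k ≠ j) (hkm : k ≤ m) :
    ∃ τ : ℝ, τ ≠ 0 ∧ ∀ η, (N (insert j R)).IsRoot η →
      (N (insert k R)).eval η * (N (insert b (insert j R))).eval η =
        τ * ((N (insert b R)).eval η * (N (insert k (insert j R))).eval η) := by
  rcases eq_or_ne k b with rfl | hkb
  · exact ⟨1, one_ne_zero, fun η _ ↦ by ring⟩
  obtain ⟨s₁, s₂, s₃, -, hs₂, hs₃, hrel⟩ := hN.three_term R j k b
    (by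
      intro x hx
      simp only [Finset.mem_insert] at hx
      rcases hx with rfl | rfl | rfl | hx
      · simp; omega
      · simp; omega
      · simp; omega
      · exact hR hx) hj hk hb hkj.symm hbj.symm hkb
  refine ⟨-(s₃ / s₂), by simp [hs₂, hs₃], fun η hη ↦ ?_⟩
  have he := congrArg (eval η) hrel
  rw [Finset.insert_comm j b, Finset.insert_comm j k] at he
  simp only [eval_add, eval_mul, eval_C, show (N (insert j R)).eval η = 0 from hη, zero_mul,
    mul_zero, zero_add, eval_zero] at he
  field_simp
  linarith

/-- The induction step of the zero count, by elimination of the column `j`. At the roots `η` of `f =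
N (insert j R)` the form reduces to `v ∑ p_k N (insert k R)`. By `exists_exchange_eq_insert` this
is, up to factors of constant sign, a form `L'` over `insert j R`, to which `ih` applies. If `w` had
too large a degree, the quotient `G` of the form by `w`, multiplied by the factors `q` for the sign
changes of `L'`, would have degree at most `deg f - 2`, so `∑ (q G)(η) / f'(η) = 0`. Alternation
gives all terms one sign, hence `L'` vanishes at every root of `f`, which is too often. The factor
`v` serves the modified forms in which all columns but `j` are multiplied by `X - ξ`. -/
theorem natDegree_add_lt_of_dvd (hN : MinorFamily m I K N) {R : Finset ℕ}
    (hR : R ⊆ Finset.range (m + 1)) {j : ℕ} (hj : j ∈ Finset.range (m + 1) \ R) {n : ℕ → ℕ}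
    (hK : ∀ i, 1 ≤ i → i ≤ m → ∑ k ∈ Finset.range (m + 1) \ R, n k + m + 2 ≤ K i)
    {p : ℕ → ℝ[X]} {v w : ℝ[X]}
    (hpj : (p j).degree < ((n j + v.natDegree : ℕ) : WithBot ℕ))
    (hp : ∀ k ∈ Finset.range (m + 1) \ insert j R, (p k).degree < (n k : WithBot ℕ))
    (hne : p j ≠ 0 ∨ ∃ k ∈ Finset.range (m + 1) \ insert j R, p k ≠ 0)
    (hmax : ∀ k ∈ Finset.range (m + 1) \ insert j R, p k ≠ 0 →
      n k + (N (insert k R)).natDegree ≤ n j + (N (insert j R)).natDegree)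
    (hv : ∀ x ∈ I (R.card + 1), v.eval x ≠ 0)
    (hw : ∀ x ∈ I (R.card + 1), w.eval x ≠ 0)
    (hdvd : w ∣ p j * N (insert j R) +
      v * ∑ k ∈ Finset.range (m + 1) \ insert j R, p k * N (insert k R))
    (ih : ∀ (p' : ℕ → ℝ[X]) (w' : ℝ[X]),
      (∀ k ∈ Finset.range (m + 1) \ insert j R, (p' k).degree < (n k : WithBot ℕ)) →
      (∃ k ∈ Finset.range (m + 1) \ insert j R, p' k ≠ 0) →
      (∀ x ∈ I (R.card + 2), w'.eval x ≠ 0) →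
      w' ∣ ∑ k ∈ Finset.range (m + 1) \ insert j R, p' k * N (insert k (insert j R)) →
      w'.natDegree < ∑ k ∈ Finset.range (m + 1) \ insert j R, n k) :
    w.natDegree < ∑ k ∈ Finset.range (m + 1) \ R, n k + v.natDegree := by
  obtain ⟨hjm, hjR⟩ := Finset.mem_sdiff.1 hj
  rw [Finset.mem_range] at hjm
  set S := Finset.range (m + 1) \ insert j R with hS
  have hSsum : ∑ k ∈ Finset.range (m + 1) \ R, n k = n j + ∑ k ∈ S, n k := by
    rw [hS, Finset.sdiff_insert, Finset.add_sum_erase _ _ hj]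
  have hmemS : ∀ k ∈ S, k ≤ m ∧ k ≠ j ∧ k ∉ R := fun k hk ↦ by
    simp only [hS, Finset.mem_sdiff, Finset.mem_range, Finset.mem_insert, not_or] at hk
    exact ⟨by omega, hk.2.1, hk.2.2⟩
  have hA : insert j R ⊆ Finset.range (m + 1) := by
    intro x hx
    rcases Finset.mem_insert.1 hx with rfl | hx
    · simpa using hjm
    · exact hR hx
  have hcard : (insert j R).card = R.card + 1 := Finset.card_insert_of_notMem hjR
  have hsplit := hN.splitsIn hA
  rw [hcard] at hsplit
  by_cases hall : ∀ k ∈ S, p k = 0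
  · have hpj0 : p j ≠ 0 := hne.resolve_right (by push Not; exact hall)
    rw [Finset.sum_eq_zero (fun k hk ↦ by rw [hall k hk, zero_mul]), mul_zero, add_zero] at hdvd
    have h1 := (isCoprime_of_splitsIn hsplit hw).dvd_of_dvd_mul_right hdvd
    have h2 := natDegree_le_of_dvd h1 hpj0
    have h3 := (natDegree_lt_iff_degree_lt hpj0).2 hpj
    omega
  push Not at hall
  obtain ⟨b, hbS, hpb⟩ := hall
  obtain ⟨hbm, hbj, hbR⟩ := hmemS b hbS
  have hbA : b ∉ insert j R := by simp [hbj, hbR]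
  by_contra! hcon
  have hnb : 1 ≤ n b := by
    have := (natDegree_lt_iff_degree_lt hpb).2 (hp b hbS)
    omega
  have hnS : n b ≤ ∑ k ∈ S, n k := Finset.single_le_sum (fun _ _ ↦ Nat.zero_le _) hbS
  have hcardm : R.card + 1 ≤ m := by
    have := Finset.card_lt_card (Finset.ssubset_iff_subset_ne.2 ⟨hA, fun h ↦ hbA (by
      rw [h]; simp; omega)⟩)
    rw [hcard, Finset.card_range] at this
    omega
  have hKi := hK (R.card + 1) (by omega) hcardm
  have hex := excess_le (insert j R)
  rw [hcard] at hex
  have hsd : ∃ s : ℝ, s ≠ 0 ∧ ∀ x ∈ I (R.card + 1), 0 < s * (N (insert b (insert j R))).eval x := by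
    have := hN.exists_sign_insert hA hbA hbm
    rwa [hcard] at this
  obtain ⟨sa, hsa⟩ : Alternates (N (insert j R)) (N (insert b R)) := by
    have := hN.alternates_exchange hA (Finset.mem_insert_self j R) hbA hbm
    rwa [Finset.erase_insert hjR] at this
  choose! τ hτ0 hτ using fun k (hk : k ∈ S) ↦ hN.exists_exchange_eq_insert hR hjR (by omega) hbR
    hbj hbm (hmemS k hk).2.2 (hmemS k hk).2.1 (hmemS k hk).1
  set L' := ∑ k ∈ S, (C (τ k) * p k) * N (insert k (insert j R)) with hL'
  have hih : ∀ w' : ℝ[X], (∀ x ∈ I (R.card + 2), w'.eval x ≠ 0) → w' ∣ L' →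
      w'.natDegree < ∑ k ∈ S, n k := fun w' h1 h2 ↦
    ih _ w' (fun k hk ↦ by rw [degree_C_mul (hτ0 k hk)]; exact hp k hk)
      ⟨b, hbS, mul_ne_zero (C_ne_zero.2 (hτ0 b hbS)) hpb⟩ h1 h2
  -- Powers of `X ^ 2 + 1` have no real root, so if `L'` were zero they would be admissible divisors
  -- of too large a degree.
  have hL'0 : L' ≠ 0 := by
    intro h0
    have hdeg : ((X : ℝ[X]) ^ 2 + 1).natDegree = 2 := by compute_degree!
    have := hih (((X : ℝ[X]) ^ 2 + 1) ^ (∑ k ∈ S, n k))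
      (fun x _ ↦ by
        have h : (0 : ℝ) < x ^ 2 + 1 := by positivity
        rw [eval_pow]
        exact pow_ne_zero _ (by simpa using h.ne'))
      (by rw [h0]; exact dvd_zero _)
    rw [natDegree_pow, hdeg] at this
    omega
  have hdisj : ∀ x ∈ I (R.card + 1), x ∉ I (R.card + 2) := fun x hx hx' ↦
    Set.disjoint_left.1 (hN.disjoint (R.card + 1)) hx hx'
  have hprodI : ∀ W : Finset ℝ, (∀ z ∈ W, z ∈ I (R.card + 1)) →
      ∀ x ∈ I (R.card + 2), (∏ z ∈ W, (X - C z)).eval x ≠ 0 := fun W hW x hx ↦ by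
    rw [eval_prod]
    refine Finset.prod_ne_zero_iff.2 fun z hz h0 ↦ hdisj z (hW z hz) ?_
    simp only [eval_sub, eval_X, eval_C, sub_eq_zero] at h0
    rwa [← h0]
  obtain ⟨W, s', hs'0, hW, hpos⟩ := exists_finset_roots_mul_nonneg (hN.ordConnected (R.card + 1)) hL'0
  have hWcard := hih _ (hprodI W fun z hz ↦ (hW z hz).1) (prod_X_sub_C_dvd fun z hz ↦ (hW z hz).2)
  rw [natDegree_prod_X_sub_C] at hWcard
  have hfdeg := hsplit.natDegree_eq
  have hroot : ∀ η, (N (insert j R)).IsRoot η → η ∈ I (R.card + 1) := fun η h ↦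
    hsplit.mem_of_isRoot h
  obtain ⟨c, Z, hc, hZcard, hZ, hf⟩ := hsplit
  obtain ⟨G, hG⟩ := hdvd
  set q : ℝ[X] := ∏ z ∈ W, (X - C z) with hq
  have hqcard : q.natDegree = W.card := natDegree_prod_X_sub_C W
  -- By `hmax` the form has degree below `n j + deg v + deg f`, by `hcon` at least `∑ n + deg v` of
  -- it goes into `w`, and `q` gives back less than the sum of `n` over `S`.
  have hGdeg : (q * G).natDegree + 1 < Z.card := by
    rcases eq_or_ne G 0 with rfl | hG0
    · simp; omega
    rcases eq_or_ne w 0 with rfl | hw0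
    · rw [natDegree_zero] at hcon; omega
    have h1 : (p j * N (insert j R) + v * ∑ k ∈ S, p k * N (insert k R)).natDegree + 1 ≤
        n j + v.natDegree + (N (insert j R)).natDegree := by
      have hD : 1 ≤ (N (insert j R)).natDegree := by omega
      have h2 : (p j * N (insert j R)).natDegree ≤
          n j + v.natDegree + (N (insert j R)).natDegree - 1 := by
        rcases eq_or_ne (p j) 0 with h0 | h0
        · simp [h0]
        · have := (natDegree_lt_iff_degree_lt h0).2 hpj
          have := natDegree_mul_le (p := p j) (q := N (insert j R))
          omega
      have h3 : (v * ∑ k ∈ S, p k * N (insert k R)).natDegree ≤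
          n j + v.natDegree + (N (insert j R)).natDegree - 1 := by
        have h4 : (∑ k ∈ S, p k * N (insert k R)).natDegree ≤
            n j + (N (insert j R)).natDegree - 1 := by
          refine natDegree_sum_le_of_forall_le _ _ fun k hk ↦ ?_
          rcases eq_or_ne (p k) 0 with h0 | h0
          · simp [h0]
          · have := (natDegree_lt_iff_degree_lt h0).2 (hp k hk)
            have := natDegree_mul_le (p := p k) (q := N (insert k R))
            have := hmax k hk h0
            omega
        have := natDegree_mul_le (p := v) (q := ∑ k ∈ S, p k * N (insert k R))
        omega
      have := natDegree_add_le_of_degree_le h2 h3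
      omega
    rw [hG, natDegree_mul hw0 hG0] at h1
    have := natDegree_mul_le (p := q) (q := G)
    omega
  have hsum := sum_eval_div_prod_eq_zero hGdeg
  obtain ⟨sv, hsv0, hsv⟩ := exists_sign_of_forall_eval_ne_zero (hN.ordConnected _) hv
  obtain ⟨sw, hsw0, hsw⟩ := exists_sign_of_forall_eval_ne_zero (hN.ordConnected _) hw
  obtain ⟨sy, hsy0, hsy⟩ := hsd
  have hmemroot : ∀ η ∈ Z, (N (insert j R)).IsRoot η := fun η hη ↦ by
    rw [hf]; exact (isRoot_C_mul_prod_iff hc).2 hη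
  have hrel : ∀ η ∈ Z, w.eval η * G.eval η * (N (insert b (insert j R))).eval η =
      v.eval η * ((N (insert b R)).eval η * L'.eval η) := fun η hη ↦ by
    have h1 := congrArg (eval η) hG
    simp only [eval_add, eval_mul, show (N (insert j R)).eval η = 0 from hmemroot η hη, mul_zero,
      zero_add] at h1
    rw [← h1, mul_assoc]
    congr 1
    rw [eval_finsetSum, hL', eval_finsetSum, Finset.sum_mul, Finset.mul_sum]
    refine Finset.sum_congr rfl fun k hk ↦ ?_
    simp only [eval_mul, eval_C]
    rw [mul_assoc, hτ k hk η (hmemroot η hη)]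
    ring
  -- Up to a positive square, each term is a product of quantities whose signs are fixed by `sa`,
  -- `sv`, `sw`, `sy` and `s'`; it vanishes only where `L'` does.
  have hterm : ∀ η ∈ Z, 0 ≤ (sa * c * sv * sw * sy * s') *
      ((q * G).eval η / ∏ z ∈ Z.erase η, (η - z)) ∧
      ((q * G).eval η / ∏ z ∈ Z.erase η, (η - z) = 0 → L'.eval η = 0) := fun η hη ↦ by
    have h1 := hsa η (hmemroot η hη)
    rw [hf, eval_derivative_C_mul_prod hη] at h1
    have hηI := hZ η hη
    have h2 := hsv η hηI
    have h3 := hsw η hηI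
    have h4 := hsy η hηI
    have h5 := hpos η hηI
    have h6 := hrel η hη
    have hqe : q.eval η = ∏ z ∈ W, (η - z) := by simp [hq, eval_prod]
    rw [← hqe] at h5
    have he0 : ∏ z ∈ Z.erase η, (η - z) ≠ 0 := fun h0 ↦ by simp [h0] at h1
    have hx0 : (N (insert b R)).eval η ≠ 0 := fun h0 ↦ by simp [h0] at h1
    set x := (N (insert b R)).eval η
    set y := (N (insert b (insert j R))).eval η
    set e := ∏ z ∈ Z.erase η, (η - z)
    have hy0 : y ≠ 0 := fun h0 ↦ by simp [h0] at h4
    have hw0 : w.eval η ≠ 0 := hw η hηI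
    have hv0 : v.eval η ≠ 0 := hv η hηI
    rw [eval_mul]
    constructor
    · have hsq : 0 < (w.eval η * y * e) ^ 2 := by positivity
      refine nonneg_of_mul_nonneg_left ?_ hsq
      have : sa * c * sv * sw * sy * s' * (q.eval η * G.eval η / e) * (w.eval η * y * e) ^ 2 =
          (sa * (x * (c * e))) * (sv * v.eval η) * (sw * w.eval η) * (sy * y) *
            (s' * (L'.eval η * q.eval η)) := by
        calc _ = sa * c * sv * sw * sy * s' * q.eval η * e * w.eval η * y *
              (w.eval η * G.eval η * y) := by field_simp
          _ = _ := by rw [h6]; ring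
      rw [this]
      positivity
    · intro h0
      have h7 : q.eval η * G.eval η = 0 := by
        simpa [he0] using h0
      have h8 : q.eval η * L'.eval η = 0 := by
        have : q.eval η * (v.eval η * (x * L'.eval η)) = 0 := by
          rw [← h6]
          linear_combination (w.eval η * y) * h7
        simpa [hv0, hx0] using this
      rcases mul_eq_zero.1 h8 with h8 | h8
      · rw [hqe, Finset.prod_eq_zero_iff] at h8
        obtain ⟨z, hz, hz0⟩ := h8
        rw [sub_eq_zero.1 hz0]
        exact (hW z hz).2
      · exact h8
  have hκ : sa * c * sv * sw * sy * s' ≠ 0 := by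
    have hsa0 : sa ≠ 0 := by
      rintro rfl
      obtain ⟨η, hη⟩ := Finset.card_pos.1 (show 0 < Z.card by omega)
      simpa using hsa η (hmemroot η hη)
    positivity
  have hzero : ∀ η ∈ Z, L'.IsRoot η := fun η hη ↦ by
    have h1 : ∑ η ∈ Z, (sa * c * sv * sw * sy * s') *
        ((q * G).eval η / ∏ z ∈ Z.erase η, (η - z)) = 0 := by
      rw [← Finset.mul_sum, hsum, mul_zero]
    have h2 := (Finset.sum_eq_zero_iff_of_nonneg fun η hη ↦ (hterm η hη).1).1 h1 η hη
    exact (hterm η hη).2 ((mul_eq_zero.1 h2).resolve_left hκ)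
  -- By `hK` the number of roots of `f` exceeds the bound that `ih` sets for `L'`.
  have := hih _ (hprodI Z hZ) (prod_X_sub_C_dvd hzero)
  rw [natDegree_prod_X_sub_C] at this
  omega

/-- A non-trivial linear form `∑ p_k N_{R ∪ k}` with `deg p_k < n_k` has fewer than `∑ n_k` zeros
outside the interval that contains the roots of its members. -/
theorem natDegree_lt_of_dvd (hN : MinorFamily m I K N) {R : Finset ℕ}
    (hR : R ⊆ Finset.range (m + 1)) {n : ℕ → ℕ}
    (hK : ∀ i, 1 ≤ i → i ≤ m → ∑ k ∈ Finset.range (m + 1) \ R, n k + m + 2 ≤ K i)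
    {p : ℕ → ℝ[X]} {w : ℝ[X]}
    (hp : ∀ k ∈ Finset.range (m + 1) \ R, (p k).degree < (n k : WithBot ℕ))
    (hne : ∃ k ∈ Finset.range (m + 1) \ R, p k ≠ 0)
    (hw : ∀ x ∈ I (R.card + 1), w.eval x ≠ 0)
    (hdvd : w ∣ ∑ k ∈ Finset.range (m + 1) \ R, p k * N (insert k R)) :
    w.natDegree < ∑ k ∈ Finset.range (m + 1) \ R, n k := by
  induction hd : (Finset.range (m + 1) \ R).card generalizing R p w with
  | zero =>
    obtain ⟨k, hk, -⟩ := hne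
    rw [Finset.card_eq_zero.1 hd] at hk
    simp at hk
  | succ d ih =>
  -- Eliminating the column whose term has the largest admissible degree is what the degree
  -- condition of the induction step asks for.
  obtain ⟨j, hj, hjmax⟩ := Finset.exists_max_image
    ((Finset.range (m + 1) \ R).filter (p · ≠ 0)) (fun k ↦ n k + (N (insert k R)).natDegree)
    (by obtain ⟨k, hk, h0⟩ := hne; exact ⟨k, Finset.mem_filter.2 ⟨hk, h0⟩⟩)
  obtain ⟨hjS, hj0⟩ := Finset.mem_filter.1 hj
  have hjR := (Finset.mem_sdiff.1 hjS).2
  have hsub : ∀ k ∈ Finset.range (m + 1) \ insert j R, k ∈ Finset.range (m + 1) \ R := fun k hk ↦ by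
    rw [Finset.sdiff_insert] at hk
    exact Finset.mem_of_mem_erase hk
  have hle : ∑ k ∈ Finset.range (m + 1) \ insert j R, n k ≤ ∑ k ∈ Finset.range (m + 1) \ R, n k :=
    Finset.sum_le_sum_of_subset hsub
  have := hN.natDegree_add_lt_of_dvd hR hjS hK (v := 1) (w := w) (p := p)
    (by simpa using hp j hjS) (fun k hk ↦ hp k (hsub k hk)) (Or.inl hj0)
    (fun k hk h0 ↦ hjmax k (Finset.mem_filter.2 ⟨hsub k hk, h0⟩)) (by simp) hw
    (by
      rw [one_mul, Finset.sdiff_insert,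
        Finset.add_sum_erase _ (fun k ↦ p k * N (insert k R)) hjS]
      exact hdvd)
    (fun p' w' hp' hne' hw' hdvd' ↦ ih (R := insert j R)
      (by
        intro x hx
        rcases Finset.mem_insert.1 hx with rfl | hx
        · exact (Finset.mem_sdiff.1 hjS).1
        · exact hR hx)
      (fun i h1 h2 ↦ by have := hK i h1 h2; omega) hp' hne'
      (by rwa [Finset.card_insert_of_notMem hjR]) hdvd'
      (by rw [Finset.sdiff_insert, Finset.card_erase_of_mem hjS]; omega))
  simpa using this

end MinorFamily

/-! ### Initial minors of a matrix -/

section Minors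

variable {R : Type*} [CommRing R]

/-- The minor of the matrix `T` on its first `i` rows and the columns `c`. -/
def minor (T : ℕ → ℕ → R) {i : ℕ} (c : Fin i → ℕ) : R := (Matrix.of fun a b : Fin i ↦ T a (c b)).det

theorem minor_eq_zero_of_not_injective (T : ℕ → ℕ → R) {i : ℕ} {c : Fin i → ℕ} {j k : Fin i}
    (hjk : j ≠ k) (h : c j = c k) : minor T c = 0 :=
  Matrix.det_zero_of_column_eq hjk fun a ↦ by simp [h]

/-- Laplace expansion along the first column, whose cofactors do not involve `x`. -/
theorem minor_cons (T : ℕ → ℕ → R) {k : ℕ} (r : Fin k → ℕ) :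
    ∃ α : Fin (k + 1) → R, ∀ x, minor T (Fin.cons x r : Fin (k + 1) → ℕ) = ∑ i, α i * T i x := by
  refine ⟨fun i ↦ (-1) ^ (i : ℕ) *
    (Matrix.of fun a b : Fin k ↦ T (i.succAbove a) (r b)).det, fun x ↦ ?_⟩
  rw [minor, Matrix.det_succ_column_zero]
  refine Finset.sum_congr rfl fun i _ ↦ ?_
  simp only [Matrix.of_apply, Fin.cons_zero]
  rw [mul_right_comm]
  congr 2

/-- Put the row of minors `minor T (x, r)` on top of the first `k + 2` rows of `T`, for the columns
`a, b, c, r`. By `minor_cons` the top row depends on the others, so the determinant vanishes.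
Expanding along the top row leaves three terms, because the minors with a repeated column of `r` are
zero. -/
theorem minor_three_term [IsDomain R] (T : ℕ → ℕ → R) {k : ℕ} (r : Fin k → ℕ) (a b c : ℕ) :
    minor T (Fin.cons a r : Fin (k + 1) → ℕ) *
        minor T (Fin.cons b (Fin.cons c r : Fin (k + 1) → ℕ) : Fin (k + 2) → ℕ) -
      minor T (Fin.cons b r : Fin (k + 1) → ℕ) *
        minor T (Fin.cons a (Fin.cons c r : Fin (k + 1) → ℕ) : Fin (k + 2) → ℕ) +
      minor T (Fin.cons c r : Fin (k + 1) → ℕ) *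
        minor T (Fin.cons a (Fin.cons b r : Fin (k + 1) → ℕ) : Fin (k + 2) → ℕ) = 0 := by
  obtain ⟨α, hα⟩ := minor_cons T r
  let col : Fin (k + 3) → ℕ := Fin.cons a (Fin.cons b (Fin.cons c r : Fin (k + 1) → ℕ) : Fin (k + 2) → ℕ)
  let B : Matrix (Fin (k + 3)) (Fin (k + 3)) R := Matrix.of fun i j ↦
    (Fin.cons (minor T (Fin.cons (col j) r : Fin (k + 1) → ℕ)) (fun i' : Fin (k + 2) ↦ T i' (col j)) :
      Fin (k + 3) → R) i
  have hdet : B.det = 0 := by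
    -- The top row minus its expansion in rows `0, …, k` of `T`; the last row takes no part.
    refine Matrix.exists_vecMul_eq_zero_iff.1
      ⟨(Fin.cons 1 (Fin.snoc (fun i ↦ - α i) 0 : Fin (k + 2) → R) : Fin (k + 3) → R), ?_, ?_⟩
    · intro h
      have := congrFun h 0
      simp at this
    · ext j
      simp only [Matrix.vecMul, dotProduct, B, Matrix.of_apply, Pi.zero_apply]
      rw [Fin.sum_univ_succ]
      simp only [Fin.cons_zero, Fin.cons_succ, one_mul]
      rw [Fin.sum_univ_castSucc]
      simp only [Fin.snoc_castSucc, Fin.snoc_last, zero_mul, add_zero, hα, neg_mul,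
        Finset.sum_neg_distrib, Fin.val_castSucc]
      ring
  have hr : ∀ j : Fin k, minor T (Fin.cons (r j) r : Fin (k + 1) → ℕ) = 0 := fun j ↦
    minor_eq_zero_of_not_injective T (j := 0) (k := j.succ) (Fin.succ_ne_zero j).symm (by simp)
  rw [Matrix.det_succ_row_zero, Fin.sum_univ_succ, Fin.sum_univ_succ, Fin.sum_univ_succ] at hdet
  rw [Finset.sum_eq_zero (fun j _ ↦ by
    simp [B, col, hr])] at hdet
  have e0 : (B.submatrix Fin.succ (Fin.succAbove 0)).det =
      minor T (Fin.cons b (Fin.cons c r : Fin (k + 1) → ℕ) : Fin (k + 2) → ℕ) := by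
    rw [minor]; congr 1
  have e1 : (B.submatrix Fin.succ (Fin.succAbove (Fin.succ 0))).det =
      minor T (Fin.cons a (Fin.cons c r : Fin (k + 1) → ℕ) : Fin (k + 2) → ℕ) := by
    rw [minor]; congr 1
    ext i j
    refine Fin.cases ?_ (fun j ↦ ?_) j <;> simp [B, col]
  have e2 : (B.submatrix Fin.succ (Fin.succAbove (Fin.succ (Fin.succ 0)))).det =
      minor T (Fin.cons a (Fin.cons b r : Fin (k + 1) → ℕ) : Fin (k + 2) → ℕ) := by
    rw [minor]; congr 1
    ext i j
    refine Fin.cases ?_ (fun j ↦ Fin.cases ?_ (fun j ↦ ?_) j) j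
    all_goals
      simp only [Matrix.submatrix_apply, Fin.succ_succAbove_zero, Fin.succ_succAbove_succ,
        Fin.zero_succAbove]
      rfl
  rw [e0, e1, e2] at hdet
  simp only [B, col, Matrix.of_apply, Fin.cons_zero, Fin.cons_succ] at hdet
  simp only [Fin.val_zero, pow_zero, one_mul, Fin.val_succ, zero_add, pow_one, neg_mul] at hdet
  linear_combination hdet

theorem minor_comp_perm (T : ℕ → ℕ → R) {i : ℕ} (c : Fin i → ℕ) (σ : Equiv.Perm (Fin i)) :
    minor T (c ∘ σ) = ((Equiv.Perm.sign σ : ℤ) : R) * minor T c := by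
  rw [minor, minor, ← Matrix.det_permute']
  rfl

/-- The minor on the first rows and the columns in `A`, in increasing order. -/
def setMinor (T : ℕ → ℕ → R) (A : Finset ℕ) : R := minor T (A.orderEmbOfFin rfl)

theorem exists_minor_eq_setMinor (T : ℕ → ℕ → R) {i : ℕ} {c : Fin i → ℕ} (hc : Function.Injective c)
    {A : Finset ℕ} (hA : Finset.univ.image c = A) :
    ∃ s : ℤˣ, minor T c = ((s : ℤ) : R) * setMinor T A := by
  have hcard : A.card = i := by
    rw [← hA, Finset.card_image_of_injective _ hc]; simp
  subst hcard
  have hmem : ∀ b, c b ∈ Set.range (A.orderEmbOfFin rfl) := fun b ↦ by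
    rw [Finset.range_orderEmbOfFin, ← hA]; simp
  choose f hf using hmem
  have hfi : Function.Injective f := fun x y hxy ↦ hc (by rw [← hf x, ← hf y, hxy])
  let σ : Equiv.Perm (Fin A.card) := Equiv.ofBijective f (Finite.injective_iff_bijective.1 hfi)
  refine ⟨Equiv.Perm.sign σ, ?_⟩
  rw [setMinor, ← minor_comp_perm]
  congr 1
  ext b
  exact (hf b).symm

end Minors

/-! ### The minors of a discrete Nikishin system -/

/-- The iterated Cauchy transform of `d` consecutive discrete measures, starting at level `a`. -/
def discreteChain (X : ℕ → Finset ℝ) (w : ℕ → ℝ → ℝ) : ℕ → ℕ → ℝ → ℝ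
  | 0, _, _ => 1
  | d + 1, a, x => ∑ y ∈ X a, w a y * discreteChain X w d (a + 1) y / (x - y)

/-- The monic polynomial with simple roots at the points of level `a`. -/
def nodePoly (X : ℕ → Finset ℝ) (a : ℕ) : ℝ[X] := ∏ x ∈ X a, (Polynomial.X - C x)

/-- The numerator of `discreteChain X w d a` over the common denominator `nodePoly X a`. -/
def chainPoly (X : ℕ → Finset ℝ) (w : ℕ → ℝ → ℝ) : ℕ → ℕ → ℝ[X]
  | 0, a => nodePoly X a
  | d + 1, a => ∑ x ∈ X a, C (w a x * discreteChain X w d (a + 1) x) *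
      ∏ y ∈ (X a).erase x, (Polynomial.X - C y)

/-- The triangular matrix of numerators. -/
def entry (X : ℕ → Finset ℝ) (w : ℕ → ℝ → ℝ) (i c : ℕ) : ℝ[X] :=
  if c < i then 0 else chainPoly X w (c - i) (i + 1)

/-- Measures with finite support on intervals, consecutive ones disjoint, at levels `1, …, m`. -/
structure DiscreteSystem (m : ℕ) (I : ℕ → Set ℝ) (X : ℕ → Finset ℝ) (w : ℕ → ℝ → ℝ) : Prop where
  ordConnected : ∀ i, (I i).OrdConnected
  disjoint : ∀ i, Disjoint (I i) (I (i + 1))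
  mem : ∀ a, ∀ x ∈ X a, x ∈ I a
  weight_pos : ∀ a, ∀ x ∈ X a, 0 < w a x
  empty_zero : X 0 = ∅
  empty_of_lt : ∀ a, m < a → X a = ∅
  -- Intervals of non-consecutive levels may overlap, yet the node polynomials of different levels
  -- have to be coprime.
  pairwise : ∀ a b, a ≠ b → Disjoint (X a) (X b)
  le_card : ∀ a, 1 ≤ a → a ≤ m → m + 2 ≤ (X a).card

section nodePoly

variable {X : ℕ → Finset ℝ} {w : ℕ → ℝ → ℝ}

theorem monic_nodePoly (a : ℕ) : (nodePoly X a).Monic := monic_prod_X_sub_C_finset _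

theorem natDegree_nodePoly (a : ℕ) : (nodePoly X a).natDegree = (X a).card :=
  natDegree_prod_X_sub_C _

theorem eval_nodePoly (a : ℕ) (x : ℝ) : (nodePoly X a).eval x = ∏ y ∈ X a, (x - y) := by
  simp [nodePoly, eval_prod]

theorem eval_nodePoly_ne_zero {a : ℕ} {x : ℝ} (hx : x ∉ X a) : (nodePoly X a).eval x ≠ 0 := by
  rw [eval_nodePoly]
  exact Finset.prod_ne_zero_iff.2 fun y hy h0 ↦ hx (by rwa [sub_eq_zero.1 h0])

theorem eval_chainPoly (d a : ℕ) {x : ℝ} (hx : x ∉ X a) :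
    (chainPoly X w d a).eval x = (nodePoly X a).eval x * discreteChain X w d a x := by
  cases d with
  | zero => simp [chainPoly, discreteChain]
  | succ d =>
    rw [chainPoly, discreteChain, eval_finsetSum, Finset.mul_sum]
    refine Finset.sum_congr rfl fun y hy ↦ ?_
    rw [eval_nodePoly, ← Finset.mul_prod_erase _ _ hy]
    have : x - y ≠ 0 := sub_ne_zero.2 fun h ↦ hx (h ▸ hy)
    simp only [eval_mul, eval_C, eval_prod, eval_sub, eval_X]
    field_simp

theorem eval_chainPoly_succ_node (d a : ℕ) {x : ℝ} (hx : x ∈ X a) :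
    (chainPoly X w (d + 1) a).eval x =
      w a x * discreteChain X w d (a + 1) x * ∏ y ∈ (X a).erase x, (x - y) := by
  rw [chainPoly, eval_finsetSum, Finset.sum_eq_single_of_mem x hx]
  · simp [eval_prod]
  · intro y _ hyx
    simp only [eval_mul, eval_C, eval_prod, eval_sub, eval_X]
    rw [Finset.prod_eq_zero (i := x) (by simp [hx, hyx.symm]) (by simp), mul_zero]

/-- At a node of level `i + 1` only the residue of the Cauchy transform survives, so rows `i` and `i
+ 1` are proportional there. For `c = i` both sides vanish, the left one through the node
polynomial. -/
theorem eval_entry_node (i c : ℕ) {x : ℝ} (hx : x ∈ X (i + 1)) (hx' : x ∉ X (i + 2)) :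
    (nodePoly X (i + 2)).eval x * (entry X w i c).eval x =
      (w (i + 1) x * ∏ y ∈ (X (i + 1)).erase x, (x - y)) * (entry X w (i + 1) c).eval x := by
  rcases lt_trichotomy c i with h | rfl | h
  · simp [entry, h, h.trans (Nat.lt_succ_self i)]
  · simp only [entry, lt_irrefl, if_false, Nat.sub_self, chainPoly, Nat.lt_succ_self, if_true,
      eval_zero, mul_zero]
    rw [eval_nodePoly, eval_nodePoly, Finset.prod_eq_zero hx (by simp), mul_zero]
  · obtain ⟨d, rfl⟩ := Nat.exists_eq_add_of_lt h
    rw [entry, if_neg (by omega), entry, if_neg (by omega), show i + d + 1 - i = d + 1 by omega,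
      show i + d + 1 - (i + 1) = d by omega, eval_chainPoly_succ_node d _ hx, eval_chainPoly d _ hx']
    ring

theorem natDegree_chainPoly_le (d a : ℕ) : (chainPoly X w d a).natDegree ≤ (X a).card := by
  cases d with
  | zero => exact (natDegree_nodePoly a).le
  | succ d =>
    refine natDegree_sum_le_of_forall_le _ _ fun x hx ↦ (natDegree_C_mul_le _ _).trans ?_
    rw [natDegree_prod_X_sub_C]
    exact Finset.card_le_card (Finset.erase_subset _ _)

theorem natDegree_chainPoly_succ_le (d a : ℕ) :
    (chainPoly X w (d + 1) a).natDegree ≤ (X a).card - 1 := by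
  refine natDegree_sum_le_of_forall_le _ _ fun x hx ↦ (natDegree_C_mul_le _ _).trans ?_
  rw [natDegree_prod_X_sub_C, Finset.card_erase_of_mem hx]

/-- The product of the first `i` node polynomials. -/
def nodeProd (X : ℕ → Finset ℝ) (i : ℕ) : ℝ[X] := ∏ a ∈ Finset.range i, nodePoly X (a + 1)

theorem monic_nodeProd (i : ℕ) : (nodeProd X i).Monic :=
  monic_prod_of_monic _ _ fun _ _ ↦ monic_nodePoly _

theorem natDegree_nodeProd (i : ℕ) :
    (nodeProd X i).natDegree = ∑ a ∈ Finset.range i, (X (a + 1)).card := by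
  rw [nodeProd, natDegree_prod_of_monic _ _ fun _ _ ↦ monic_nodePoly _]
  simp [natDegree_nodePoly]

/-- The minor on the columns `A`, freed from its trivial denominators. -/
def reducedMinor (X : ℕ → Finset ℝ) (w : ℕ → ℝ → ℝ) (A : Finset ℕ) : ℝ[X] :=
  setMinor (entry X w) A /ₘ nodeProd X (A.card - 1)

end nodePoly

/-! ### Trivial factors, degrees and relations of the minors -/

namespace DiscreteSystem

variable {X : ℕ → Finset ℝ} {w : ℕ → ℝ → ℝ} {m : ℕ} {I : ℕ → Set ℝ}

/-- At a node of level `a + 1` two consecutive rows are proportional by `eval_entry_node`. Both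
belong to the minor exactly for `a < i - 1`, whence `i - 1` pairwise coprime factors. -/
theorem nodeProd_dvd_minor (h : DiscreteSystem m I X w) {i : ℕ} (c : Fin i → ℕ) :
    nodeProd X (i - 1) ∣ minor (entry X w) c := by
  refine Finset.prod_dvd_of_coprime (fun a _ b _ hab ↦ ?_) fun a ha ↦ prod_X_sub_C_dvd fun x hx ↦ ?_
  · refine IsCoprime.prod_left fun x hx ↦ IsCoprime.prod_right fun y hy ↦ ?_
    refine pairwise_coprime_X_sub_C Function.injective_id fun hxy ↦ ?_
    change x = y at hxy
    subst hxy
    exact Finset.disjoint_left.1 (h.pairwise (a + 1) (b + 1) (by simpa using hab)) hx hy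
  · rw [Finset.mem_range] at ha
    have hx' : x ∉ X (a + 2) := fun hx' ↦
      Finset.disjoint_left.1 (h.pairwise (a + 1) (a + 2) (by omega)) hx hx'
    rw [IsRoot.def, minor, ← coe_evalRingHom, RingHom.map_det]
    refine Matrix.exists_vecMul_eq_zero_iff.1
      ⟨Pi.single ⟨a, by omega⟩ ((nodePoly X (a + 2)).eval x) -
        Pi.single ⟨a + 1, by omega⟩ (w (a + 1) x * ∏ y ∈ (X (a + 1)).erase x, (x - y)), ?_, ?_⟩
    · intro h0
      have := congrFun h0 ⟨a, by omega⟩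
      rw [Pi.sub_apply, Pi.single_eq_same, Pi.single_eq_of_ne (by simp), sub_zero] at this
      exact eval_nodePoly_ne_zero hx' this
    · ext b
      rw [Matrix.sub_vecMul, Pi.sub_apply, Matrix.single_vecMul, Matrix.single_vecMul]
      simp only [Pi.smul_apply, Matrix.row_apply, RingHom.mapMatrix_apply, Matrix.map_apply,
        Matrix.of_apply, coe_evalRingHom, smul_eq_mul, Pi.zero_apply]
      rw [eval_entry_node a (c b) hx hx', sub_self]

theorem nodeProd_mul_reducedMinor (h : DiscreteSystem m I X w) (A : Finset ℕ) :
    nodeProd X (A.card - 1) * reducedMinor X w A = setMinor (entry X w) A := by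
  obtain ⟨q, hq⟩ := h.nodeProd_dvd_minor (A.orderEmbOfFin rfl)
  rw [reducedMinor, setMinor, hq, mul_divByMonic_cancel_left _ (monic_nodeProd _)]

theorem exists_minor_eq (h : DiscreteSystem m I X w) {i : ℕ} {c : Fin i → ℕ}
    (hc : Function.Injective c) {A : Finset ℕ} (hA : Finset.univ.image c = A) :
    ∃ s : ℝ, s ≠ 0 ∧ minor (entry X w) c = C s * (nodeProd X (i - 1) * reducedMinor X w A) := by
  obtain ⟨s, hs⟩ := exists_minor_eq_setMinor (entry X w) hc hA
  have hcard : A.card = i := by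
    rw [← hA, Finset.card_image_of_injective _ hc]; simp
  refine ⟨((s : ℤ) : ℝ), by exact_mod_cast s.ne_zero, ?_⟩
  rw [hs, ← hcard, h.nodeProd_mul_reducedMinor]
  simp

theorem exists_minor_cons_eq (h : DiscreteSystem m I X w) {R : Finset ℕ} {a : ℕ} (ha : a ∉ R) :
    ∃ s : ℝ, s ≠ 0 ∧ minor (entry X w) (Fin.cons a (R.orderEmbOfFin rfl) : Fin (R.card + 1) → ℕ) =
      C s * (nodeProd X R.card * reducedMinor X w (insert a R)) := by
  refine h.exists_minor_eq (Fin.cons_injective_iff.2 ⟨?_, (R.orderEmbOfFin rfl).injective⟩) ?_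
  · rw [Finset.range_orderEmbOfFin]; exact ha
  · ext x
    simp only [Finset.mem_image, Finset.mem_univ, true_and, Fin.exists_fin_succ, Fin.cons_zero,
      Fin.cons_succ, Finset.mem_insert]
    have : (∃ b, R.orderEmbOfFin rfl b = x) ↔ x ∈ R := by
      rw [← Set.mem_range, Finset.range_orderEmbOfFin]; rfl
    rw [this, eq_comm]

theorem exists_minor_cons_cons_eq (h : DiscreteSystem m I X w) {R : Finset ℕ} {a b : ℕ}
    (ha : a ∉ R) (hb : b ∉ R) (hab : a ≠ b) :
    ∃ s : ℝ, s ≠ 0 ∧ minor (entry X w) (Fin.cons a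
      (Fin.cons b (R.orderEmbOfFin rfl) : Fin (R.card + 1) → ℕ) : Fin (R.card + 2) → ℕ) =
      C s * (nodeProd X (R.card + 1) * reducedMinor X w (insert a (insert b R))) := by
  have : ∀ x, (∃ b, R.orderEmbOfFin rfl b = x) ↔ x ∈ R := fun x ↦ by
    rw [← Set.mem_range, Finset.range_orderEmbOfFin]; rfl
  refine h.exists_minor_eq (Fin.cons_injective_iff.2
    ⟨?_, Fin.cons_injective_iff.2 ⟨?_, (R.orderEmbOfFin rfl).injective⟩⟩) ?_
  · simp only [Set.mem_range, Fin.exists_fin_succ, Fin.cons_zero, Fin.cons_succ, this, not_or]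
    exact ⟨hab.symm, ha⟩
  · rw [Finset.range_orderEmbOfFin]; exact hb
  · ext x
    simp only [Finset.mem_image, Finset.mem_univ, true_and, Fin.exists_fin_succ, Fin.cons_zero,
      Fin.cons_succ, Finset.mem_insert, this]
    rw [eq_comm (a := a), eq_comm (a := b)]

/-- All three products of minors carry the common factor `nodeProd X R.card * nodeProd X (R.card +
1)`, which cancels; the constants absorb the signs from reordering columns. -/
theorem reducedMinor_three_term (h : DiscreteSystem m I X w) {R : Finset ℕ} {a b c : ℕ}
    (ha : a ∉ R) (hb : b ∉ R) (hc : c ∉ R) (hab : a ≠ b) (hac : a ≠ c) (hbc : b ≠ c) :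
    ∃ s₁ s₂ s₃ : ℝ, s₁ ≠ 0 ∧ s₂ ≠ 0 ∧ s₃ ≠ 0 ∧
      C s₁ * (reducedMinor X w (insert a R) * reducedMinor X w (insert b (insert c R))) +
      C s₂ * (reducedMinor X w (insert b R) * reducedMinor X w (insert a (insert c R))) +
      C s₃ * (reducedMinor X w (insert c R) * reducedMinor X w (insert a (insert b R))) = 0 := by
  have key := minor_three_term (entry X w) (R.orderEmbOfFin rfl) a b c
  obtain ⟨ta, hta, ea⟩ := h.exists_minor_cons_eq ha
  obtain ⟨tb, htb, eb⟩ := h.exists_minor_cons_eq hb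
  obtain ⟨tc, htc, ec⟩ := h.exists_minor_cons_eq hc
  obtain ⟨tbc, htbc, ebc⟩ := h.exists_minor_cons_cons_eq hb hc hbc
  obtain ⟨tac, htac, eac⟩ := h.exists_minor_cons_cons_eq ha hc hac
  obtain ⟨tab, htab, eab⟩ := h.exists_minor_cons_cons_eq ha hb hab
  rw [ea, eb, ec, ebc, eac, eab] at key
  refine ⟨ta * tbc, -(tb * tac), tc * tab, mul_ne_zero hta htbc,
    neg_ne_zero.2 (mul_ne_zero htb htac), mul_ne_zero htc htab, ?_⟩
  have hE : nodeProd X R.card * nodeProd X (R.card + 1) ≠ 0 :=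
    ((monic_nodeProd _).mul (monic_nodeProd _)).ne_zero
  refine (mul_eq_zero.1 (?_ : (nodeProd X R.card * nodeProd X (R.card + 1)) * _ = 0)).resolve_left hE
  rw [← key]
  simp only [C_mul, C_neg]
  ring

/-- A column `c ≥ A.card` meets only rows strictly above its diagonal position, and such entries
have degree one less than the number of nodes. Each column counted by `excess` thus lowers every
term of the determinant by one degree. -/
theorem natDegree_setMinor_add_excess_le (h : DiscreteSystem m I X w) {A : Finset ℕ}
    (hA : A ⊆ Finset.range (m + 1)) :
    (setMinor (entry X w) A).natDegree ≤
      ∑ a ∈ Finset.range A.card, (X (a + 1)).card - excess A := by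
  have hmem : ∀ b, A.orderEmbOfFin rfl b ∈ A := fun b ↦ Finset.orderEmbOfFin_mem _ _ _
  have hex : excess A = ∑ b : Fin A.card, if A.card ≤ A.orderEmbOfFin rfl b then 1 else 0 := by
    rw [excess, Finset.card_filter,
      ← Finset.sum_image (s := Finset.univ) (g := A.orderEmbOfFin rfl)
        (f := fun x ↦ if A.card ≤ x then 1 else 0)
        fun x _ y _ hxy ↦ (A.orderEmbOfFin rfl).injective hxy, Finset.image_orderEmbOfFin_univ]
  rw [setMinor, minor, Matrix.det_apply]
  refine natDegree_sum_le_of_forall_le _ _ fun σ _ ↦ (natDegree_smul_le _ _).trans ?_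
  refine (natDegree_prod_le _ _).trans ?_
  refine Nat.le_sub_of_add_le ?_
  rw [hex, ← Finset.sum_add_distrib, ← Fin.sum_univ_eq_sum_range (fun a ↦ (X (a + 1)).card),
    ← Equiv.sum_comp σ (fun a : Fin A.card ↦ (X (a + 1)).card)]
  refine Finset.sum_le_sum fun b _ ↦ ?_
  simp only [Matrix.of_apply]
  set c := A.orderEmbOfFin rfl b
  have hcm : c ≤ m := by have := hA (hmem b); rw [Finset.mem_range] at this; omega
  have hσ := (σ b).2
  split_ifs with hc
  · have hK := h.le_card ((σ b : ℕ) + 1) (by omega) (by omega)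
    rw [entry, if_neg (by omega)]
    obtain ⟨d, hd⟩ := Nat.exists_eq_add_of_lt (show (σ b : ℕ) < c by omega)
    rw [hd, show (σ b : ℕ) + d + 1 - σ b = d + 1 by omega]
    have := natDegree_chainPoly_succ_le (X := X) (w := w) d ((σ b : ℕ) + 1)
    omega
  · rw [add_zero, entry]
    split_ifs
    · simp
    · exact natDegree_chainPoly_le _ _

theorem natDegree_reducedMinor_le (h : DiscreteSystem m I X w) {A : Finset ℕ}
    (hA : A ⊆ Finset.range (m + 1)) :
    (reducedMinor X w A).natDegree ≤ (X A.card).card - excess A := by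
  rcases eq_or_ne (reducedMinor X w A) 0 with h0 | h0
  · simp [h0]
  have h1 := h.natDegree_setMinor_add_excess_le hA
  rw [← h.nodeProd_mul_reducedMinor, (monic_nodeProd _).natDegree_mul' h0, natDegree_nodeProd] at h1
  rcases Nat.eq_zero_or_pos A.card with hc | hc
  · rw [hc] at h1 ⊢
    simp at h1 ⊢
    omega
  · have h2 : ∑ a ∈ Finset.range A.card, (X (a + 1)).card =
        ∑ a ∈ Finset.range (A.card - 1), (X (a + 1)).card + (X A.card).card := by
      conv_lhs => rw [← Nat.sub_add_cancel hc]
      rw [Finset.sum_range_succ, Nat.sub_add_cancel hc]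
    omega

/-- The minor is upper triangular with node polynomials on the diagonal; all but the last are
trivial factors. -/
theorem exists_reducedMinor_range (h : DiscreteSystem m I X w) (i : ℕ) :
    ∃ s : ℝ, s ≠ 0 ∧ reducedMinor X w (Finset.range i) = C s * nodePoly X i := by
  obtain ⟨s, hs, he⟩ := h.exists_minor_eq (c := fun b : Fin i ↦ (b : ℕ)) Fin.val_injective
    (A := Finset.range i) (by ext x; simp [Fin.exists_iff])
  have htri : minor (entry X w) (fun b : Fin i ↦ (b : ℕ)) = nodeProd X i := by
    rw [minor, Matrix.det_of_isUpperTriangular]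
    · rw [nodeProd, ← Fin.prod_univ_eq_prod_range (fun a ↦ nodePoly X (a + 1))]
      exact Finset.prod_congr rfl fun a _ ↦ by simp [entry, chainPoly]
    · intro a b hab
      simp only [Matrix.of_apply, entry]
      rw [if_pos (by simpa using hab)]
  rw [htri] at he
  refine ⟨s⁻¹, inv_ne_zero hs, ?_⟩
  have hE : nodeProd X (i - 1) ≠ 0 := (monic_nodeProd _).ne_zero
  have hi : nodeProd X i = nodeProd X (i - 1) * nodePoly X i := by
    cases i with
    | zero => simp [nodeProd, nodePoly, h.empty_zero]
    | succ i => rw [nodeProd, Finset.prod_range_succ, Nat.add_sub_cancel]; rfl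
  refine mul_left_cancel₀ hE (mul_left_cancel₀ (C_ne_zero.2 hs) ?_)
  rw [← he, hi, mul_left_comm (nodeProd X (i - 1)), ← mul_assoc (C s), ← C_mul, mul_inv_cancel₀ hs, C_1,
    one_mul]

theorem exists_reducedMinor_insert_range (h : DiscreteSystem m I X w) (i : ℕ) :
    ∃ s : ℝ, s ≠ 0 ∧ reducedMinor X w (insert (i + 1) (Finset.range i)) =
      C s * chainPoly X w 1 (i + 1) := by
  obtain ⟨s, hs, he⟩ := h.exists_minor_eq
    (c := (Fin.snoc (fun b : Fin i ↦ (b : ℕ)) (i + 1) : Fin (i + 1) → ℕ))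
    (Fin.snoc_injective_iff.2 ⟨Fin.val_injective, by simp⟩)
    (A := insert (i + 1) (Finset.range i)) (by
      ext x
      simp only [Finset.mem_image, Finset.mem_univ, true_and, Fin.exists_fin_succ', Fin.snoc_castSucc,
        Fin.snoc_last, Fin.exists_iff, exists_prop, exists_eq_right, Finset.mem_insert,
        Finset.mem_range]
      omega)
  have htri : minor (entry X w) (Fin.snoc (fun b : Fin i ↦ (b : ℕ)) (i + 1) : Fin (i + 1) → ℕ) =
      nodeProd X i * chainPoly X w 1 (i + 1) := by
    rw [minor, Matrix.det_of_isUpperTriangular]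
    · rw [nodeProd, ← Fin.prod_univ_eq_prod_range (fun a ↦ nodePoly X (a + 1)),
        Fin.prod_univ_castSucc]
      congr 1
      · exact Finset.prod_congr rfl fun a _ ↦ by simp [entry, chainPoly]
      · simp [entry]
    · intro a b hab
      simp only [Matrix.of_apply, entry]
      rw [if_pos]
      change b < a at hab
      have hb : b ≠ Fin.last i := (hab.trans_le (Fin.le_last a)).ne
      obtain ⟨b, rfl⟩ := Fin.exists_castSucc_eq.2 hb
      simpa [Fin.snoc_castSucc] using Fin.lt_def.1 hab
  rw [htri, Nat.add_sub_cancel] at he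
  refine ⟨s⁻¹, inv_ne_zero hs, ?_⟩
  have hE : nodeProd X i ≠ 0 := (monic_nodeProd _).ne_zero
  refine mul_left_cancel₀ hE (mul_left_cancel₀ (C_ne_zero.2 hs) ?_)
  rw [← he, mul_left_comm (nodeProd X i), ← mul_assoc (C s), ← C_mul, mul_inv_cancel₀ hs, C_1,
    one_mul]

theorem exists_reducedMinor_singleton (h : DiscreteSystem m I X w) (k : ℕ) :
    ∃ s : ℝ, s ≠ 0 ∧ reducedMinor X w {k} = C s * chainPoly X w k 1 := by
  obtain ⟨s, hs, he⟩ := h.exists_minor_eq (c := fun _ : Fin 1 ↦ k)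
    (Function.injective_of_subsingleton _) (A := {k}) (by simp)
  refine ⟨s⁻¹, inv_ne_zero hs, mul_left_cancel₀ (C_ne_zero.2 hs) ?_⟩
  rw [← mul_assoc, ← C_mul, mul_inv_cancel₀ hs, C_1, one_mul]
  simpa [minor, entry, nodeProd] using he.symm

theorem minorFamily (h : DiscreteSystem m I X w) :
    MinorFamily m I (fun i ↦ (X i).card) (reducedMinor X w) where
  ordConnected := h.ordConnected
  disjoint := h.disjoint
  three_term R a b c _ ha hb hc hab hac hbc := h.reducedMinor_three_term ha hb hc hab hac hbc
  natDegree_le A hA := h.natDegree_reducedMinor_le hA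
  le_K := h.le_card
  splits_range i _ := by
    obtain ⟨s, hs, he⟩ := h.exists_reducedMinor_range i
    exact ⟨s, X i, hs, rfl, h.mem i, he⟩
  -- At a node the numerator is the positive mass times the derivative of the node polynomial.
  alternates i hi _ := by
    obtain ⟨i, rfl⟩ := Nat.exists_eq_add_of_le' hi
    obtain ⟨s, hs, he⟩ := h.exists_reducedMinor_range (i + 1)
    obtain ⟨t, ht, he'⟩ := h.exists_reducedMinor_insert_range i
    rw [Nat.add_sub_cancel, he, he']
    refine ⟨s * t, fun η hη ↦ ?_⟩
    have hηX : η ∈ X (i + 1) := (isRoot_C_mul_prod_iff hs).1 hη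
    have hw := h.weight_pos _ _ hηX
    rw [nodePoly, eval_derivative_C_mul_prod hηX, eval_mul, eval_C,
      eval_chainPoly_succ_node 0 _ hηX, discreteChain]
    have h0 : ∏ y ∈ (X (i + 1)).erase η, (η - y) ≠ 0 := Finset.prod_ne_zero_iff.2 fun y hy h0 ↦
      (Finset.mem_erase.1 hy).1 (sub_eq_zero.1 h0).symm
    have : 0 < (s * t * ∏ y ∈ (X (i + 1)).erase η, (η - y)) ^ 2 * w (i + 1) η := by positivity
    refine this.trans_eq ?_
    ring

end DiscreteSystem

/-! ### Sign patterns of linear forms in a discrete Nikishin system -/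

theorem excess_singleton (k : ℕ) : excess {k} = if k = 0 then 0 else 1 := by
  rw [excess, Finset.card_singleton, Finset.filter_singleton]
  split_ifs <;> simp <;> omega

namespace DiscreteSystem

variable {X : ℕ → Finset ℝ} {w : ℕ → ℝ → ℝ} {m : ℕ} {I : ℕ → Set ℝ}

theorem natDegree_lt_of_dvd (h : DiscreteSystem m I X w) {n : ℕ → ℕ}
    (hK : ∀ i, 1 ≤ i → i ≤ m → ∑ k ∈ Finset.range (m + 1), n k + m + 2 ≤ (X i).card)
    {p : ℕ → ℝ[X]} (hp : ∀ k ≤ m, (p k).degree < (n k : WithBot ℕ)) (hne : ∃ k ≤ m, p k ≠ 0)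
    {q : ℝ[X]} (hq : ∀ x ∈ I 1, q.eval x ≠ 0)
    (hdvd : q ∣ ∑ k ∈ Finset.range (m + 1), p k * chainPoly X w k 1) :
    q.natDegree < ∑ k ∈ Finset.range (m + 1), n k := by
  choose s hs hsk using h.exists_reducedMinor_singleton
  have := h.minorFamily.natDegree_lt_of_dvd (R := ∅) (by simp) (n := n)
    (p := fun k ↦ C (s k)⁻¹ * p k) (w := q) (by simpa using hK)
    (fun k hk ↦ by
      rw [degree_C_mul (inv_ne_zero (hs k))]
      exact hp k (by simp at hk; omega))
    (by
      obtain ⟨k, hk, h0⟩ := hne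
      exact ⟨k, by simp; omega, mul_ne_zero (C_ne_zero.2 (inv_ne_zero (hs k))) h0⟩)
    (by simpa using hq)
    (by
      rw [Finset.sdiff_empty]
      convert hdvd using 1
      refine Finset.sum_congr rfl fun k _ ↦ ?_
      rw [insert_empty_eq, hsk k, mul_mul_mul_comm, mul_comm (p k), mul_assoc, ← mul_assoc (C _),
        ← C_mul, inv_mul_cancel₀ (hs k), C_1, one_mul, mul_comm])
  simpa using this

/-- The minor of column `0` has degree `(X 1).card`, those of the other columns one less. For the
step index `n k + deg` is therefore the same for all `k`, so any column `j` may be eliminated first,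
whatever the zero pattern of the `p k`. -/
theorem natDegree_lt_of_dvd_stepIndex (h : DiscreteSystem m I X w) {n : ℕ → ℕ} {M : ℕ}
    (hn0 : n 0 = M) (hn : ∀ k, k ≠ 0 → n k = M + 1)
    (hK : ∀ i, 1 ≤ i → i ≤ m → ∑ k ∈ Finset.range (m + 1), n k + m + 2 ≤ (X i).card)
    {p : ℕ → ℝ[X]} {j : ℕ} (hj : j ≤ m) {ξ : ℝ} (hξ : ξ ∉ I 1)
    (hpj : (p j).degree < ((n j + 1 : ℕ) : WithBot ℕ))
    (hp : ∀ k ≤ m, k ≠ j → (p k).degree < (n k : WithBot ℕ)) (hne : ∃ k ≤ m, p k ≠ 0)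
    {q : ℝ[X]} (hq : ∀ x ∈ I 1, q.eval x ≠ 0)
    (hdvd : q ∣ p j * chainPoly X w j 1 + (Polynomial.X - C ξ) *
      ∑ k ∈ (Finset.range (m + 1)).erase j, p k * chainPoly X w k 1) :
    q.natDegree < ∑ k ∈ Finset.range (m + 1), n k + 1 := by
  choose s hs hsk using h.exists_reducedMinor_singleton
  have hcancel : ∀ k, (C (s k)⁻¹ * p k) * reducedMinor X w {k} = p k * chainPoly X w k 1 := fun k ↦ by
    rw [hsk k, mul_mul_mul_comm, ← C_mul, inv_mul_cancel₀ (hs k), C_1, one_mul]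
  have hmem : ∀ k, k ∈ Finset.range (m + 1) \ insert j ∅ ↔ k ≤ m ∧ k ≠ j := fun k ↦ by
    simp [Finset.mem_sdiff]
  have := h.minorFamily.natDegree_add_lt_of_dvd (R := ∅) (by simp) (n := n) (j := j)
    (p := fun k ↦ C (s k)⁻¹ * p k) (v := Polynomial.X - C ξ) (w := q) (by simp; omega)
    (by simpa using hK)
    (by rw [degree_C_mul (inv_ne_zero (hs j)), natDegree_X_sub_C]; exact hpj)
    (fun k hk ↦ by
      rw [degree_C_mul (inv_ne_zero (hs k))]
      exact hp k ((hmem k).1 hk).1 ((hmem k).1 hk).2)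
    (by
      obtain ⟨k, hk, h0⟩ := hne
      have h1 : C (s k)⁻¹ * p k ≠ 0 := mul_ne_zero (C_ne_zero.2 (inv_ne_zero (hs k))) h0
      rcases eq_or_ne k j with rfl | hkj
      · exact Or.inl h1
      · exact Or.inr ⟨k, (hmem k).2 ⟨hk, hkj⟩, h1⟩)
    (fun k hk _ ↦ by
      obtain ⟨hkm, hkj⟩ := (hmem k).1 hk
      have hcard := h.le_card 1 le_rfl (by omega)
      have e : ∀ l, l ≤ m → (reducedMinor X w (insert l ∅)).natDegree =
          (X 1).card - if l = 0 then 0 else 1 := fun l hl ↦ by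
        have := (h.minorFamily.splitsIn (A := {l}) (by simp; omega)).natDegree_eq
        rwa [excess_singleton, Finset.card_singleton] at this
      rw [e k hkm, e j hj]
      rcases eq_or_ne k 0 with rfl | hk0 <;> rcases eq_or_ne j 0 with rfl | hj0
      · rfl
      · simp [hj0, hn0, hn j hj0]; omega
      · simp [hk0, hn0, hn k hk0]; omega
      · simp [hk0, hj0, hn k hk0, hn j hj0])
    (fun x hx h0 ↦ hξ (by
      simp only [eval_sub, eval_X, eval_C, sub_eq_zero] at h0
      rw [← h0]; simpa using hx))
    (by simpa using hq)
    (by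
      rw [insert_empty_eq, hcancel j, Finset.sdiff_singleton_eq_erase]
      simp only [insert_empty_eq, hcancel]
      exact hdvd)
    (fun p' w' hp' hne' hw' hdvd' ↦ h.minorFamily.natDegree_lt_of_dvd (R := insert j ∅)
      (by simp; omega)
      (fun i h1 h2 ↦ by
        have := hK i h1 h2
        have h3 : ∑ k ∈ Finset.range (m + 1) \ insert j ∅, n k ≤ ∑ k ∈ Finset.range (m + 1), n k :=
          Finset.sum_le_sum_of_subset Finset.sdiff_subset
        omega) hp' hne' (by simpa using hw') hdvd')
  simpa using this

/-- The points of `W` exhaust the zeros permitted outside `I 1`. After division by `∏ (X - z)`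
nothing is left that could vanish on `J`, since one more zero, even at a point of `W`, would give a
divisor of degree `B`. -/
theorem exists_sign_of_forall_natDegree_lt (h : DiscreteSystem m I X w) {B : ℕ} {p : ℕ → ℝ[X]}
    (hB : ∀ q : ℝ[X], (∀ x ∈ I 1, q.eval x ≠ 0) →
      (q ∣ ∑ k ∈ Finset.range (m + 1), p k * chainPoly X w k 1) → q.natDegree < B)
    {J : Set ℝ} (hJ : J.OrdConnected) (hJI : Disjoint J (I 1)) {W : Finset ℝ} (hWJ : ∀ z ∈ W, z ∈ J)
    (hW : W.card + 1 = B)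
    (h0 : ∀ z ∈ W, ∑ k ∈ Finset.range (m + 1), (p k).eval z * discreteChain X w k 1 z = 0) :
    ∃ s : ℝ, s ≠ 0 ∧ ∀ x ∈ J, 0 ≤ s * ((∑ k ∈ Finset.range (m + 1),
      (p k).eval x * discreteChain X w k 1 x) * ∏ z ∈ W, (x - z)) := by
  have hnot : ∀ x ∈ J, x ∉ X 1 := fun x hx hx' ↦ Set.disjoint_left.1 hJI hx (h.mem 1 x hx')
  set P := ∑ k ∈ Finset.range (m + 1), p k * chainPoly X w k 1 with hP
  have hPe : ∀ x ∈ J, P.eval x = (nodePoly X 1).eval x *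
      ∑ k ∈ Finset.range (m + 1), (p k).eval x * discreteChain X w k 1 x := fun x hx ↦ by
    rw [hP, eval_finsetSum, Finset.mul_sum]
    refine Finset.sum_congr rfl fun k _ ↦ ?_
    rw [eval_mul, eval_chainPoly _ _ (hnot x hx)]
    ring
  obtain ⟨G, hG⟩ := prod_X_sub_C_dvd (Z := W) (g := P) fun z hz ↦ by
    rw [IsRoot.def, hPe z (hWJ z hz), h0 z hz, mul_zero]
  have hGJ : ∀ x ∈ J, G.eval x ≠ 0 := fun z hz hz0 ↦ by
    obtain ⟨G', hG'⟩ := dvd_iff_isRoot.2 (show G.IsRoot z from hz0)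
    have := hB ((∏ z ∈ W, (Polynomial.X - C z)) * (Polynomial.X - C z))
      (fun x hx ↦ by
        have hne : ∀ y ∈ J, x - y ≠ 0 := fun y hy h0 ↦ by
          rw [← sub_eq_zero.1 h0] at hy
          exact Set.disjoint_left.1 hJI hy hx
        rw [eval_mul, eval_prod]
        refine mul_ne_zero (Finset.prod_ne_zero_iff.2 fun y hy ↦ ?_) ?_
        · simpa using hne y (hWJ y hy)
        · simpa using hne z hz)
      ⟨G', by rw [hG, hG']; ring⟩
    rw [(monic_prod_X_sub_C_finset W).natDegree_mul (monic_X_sub_C z), natDegree_prod_X_sub_C,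
      natDegree_X_sub_C] at this
    omega
  obtain ⟨s, hs, hsG⟩ := exists_sign_of_forall_eval_ne_zero hJ hGJ
  obtain ⟨t, ht, htD⟩ := exists_sign_of_forall_eval_ne_zero hJ
    (fun x hx ↦ eval_nodePoly_ne_zero (hnot x hx))
  refine ⟨s * t, mul_ne_zero hs ht, fun x hx ↦ ?_⟩
  have h1 := hPe x hx
  rw [hG, eval_mul, eval_prod] at h1
  simp only [eval_sub, eval_X, eval_C] at h1
  have hD := eval_nodePoly_ne_zero (hnot x hx)
  have h2 := hsG x hx
  have h3 := htD x hx
  set F := ∑ k ∈ Finset.range (m + 1), (p k).eval x * discreteChain X w k 1 x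
  refine nonneg_of_mul_nonneg_left (b := ((nodePoly X 1).eval x) ^ 2) ?_ (by positivity)
  have : s * t * (F * ∏ z ∈ W, (x - z)) * ((nodePoly X 1).eval x) ^ 2 =
      (s * G.eval x) * (t * (nodePoly X 1).eval x) * (∏ z ∈ W, (x - z)) ^ 2 := by
    calc _ = s * t * ((nodePoly X 1).eval x * F) * (∏ z ∈ W, (x - z)) * (nodePoly X 1).eval x := by
          ring
      _ = _ := by rw [← h1]; ring
  rw [this]
  positivity

end DiscreteSystem

/-! ### Approximation of measures on an interval by discrete ones -/

/-- The discrete measure with masses `w` on `X` integrates functions on `[l, r]` as `μ` does, up to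
an error controlled by their oscillation at scale `δ`. -/
structure IsApproximation (μ : Measure ℝ) (l r δ : ℝ) (X : Finset ℝ) (w : ℝ → ℝ) : Prop where
  mem : ∀ x ∈ X, x ∈ Set.Icc l r
  pos : ∀ x ∈ X, 0 < w x
  abs_sub_le : ∀ (f : ℝ → ℝ) (ε M : ℝ), ContinuousOn f (Set.Icc l r) →
    (∀ y ∈ Set.Icc l r, ∀ y' ∈ Set.Icc l r, |y - y'| ≤ δ → |f y - f y'| ≤ ε) →
    (∀ y ∈ Set.Icc l r, |f y| ≤ M) →
    |∑ x ∈ X, w x * f x - ∫ y, f y ∂μ| ≤ ε * μ.real Set.univ + δ * M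

theorem integrable_of_continuousOn_Icc {μ : Measure ℝ} [IsFiniteMeasure μ] {l r : ℝ}
    (hμ : μ (Set.Icc l r)ᶜ = 0) {E : Type*} [NormedAddCommGroup E] {f : ℝ → E}
    (hf : ContinuousOn f (Set.Icc l r)) : Integrable f μ := by
  have h := hf.integrableOn_compact isCompact_Icc (μ := μ)
  rwa [IntegrableOn, Measure.restrict_eq_self_of_ae_mem] at h
  exact mem_ae_iff.2 hμ

/-- Cut `[l, r]` into `n` equal cells of length at most `δ` and collect the mass of each cell at a
point of `D` inside it. The surplus `δ / n` at each point makes all masses positive and accounts for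
the term `δ * M`. -/
theorem exists_isApproximation (μ : Measure ℝ) [IsFiniteMeasure μ] {l r : ℝ} (hlr : l < r)
    (hμ : μ (Set.Icc l r)ᶜ = 0) {D : Set ℝ} (hD : Dense D) {δ : ℝ} (hδ : 0 < δ) (K : ℕ) :
    ∃ (X : Finset ℝ) (w : ℝ → ℝ), IsApproximation μ l r δ X w ∧ (∀ x ∈ X, x ∈ D) ∧ K ≤ X.card := by
  obtain ⟨n₀, hn₀⟩ := exists_nat_gt ((r - l) / δ)
  set n := max n₀ K + 1 with hn
  have hn0 : (0 : ℝ) < n := by positivity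
  set h := (r - l) / n with hh
  have hh0 : 0 < h := div_pos (by linarith) hn0
  have hhδ : h ≤ δ := by
    rw [hh, div_le_iff₀ hn0]
    rw [div_lt_iff₀ hδ] at hn₀
    have : (n₀ : ℝ) ≤ n := by rw [hn]; push_cast; linarith [le_max_left (n₀ : ℝ) K]
    nlinarith
  have hnh : n * h = r - l := by rw [hh]; field_simp
  have hpt : ∀ i : ℕ, ∃ x ∈ D, x ∈ Set.Ioo (l + i * h) (l + (i + 1) * h) := fun i ↦ by
    obtain ⟨x, hx, hxD⟩ := hD.exists_mem_open (isOpen_Ioo (a := l + i * h) (b := l + (i + 1) * h))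
      (Set.nonempty_Ioo.2 (by nlinarith))
    exact ⟨x, hx, hxD⟩
  choose x hxD hx using hpt
  have hxlt : ∀ i j : ℕ, i < j → x i < x j := fun i j hij ↦ by
    have h1 := (hx i).2
    have h2 := (hx j).1
    have h3 : (i : ℝ) + 1 ≤ j := by exact_mod_cast hij
    nlinarith
  have hxinj : Function.Injective x := fun i j hij ↦ by
    rcases lt_trichotomy i j with h' | h' | h'
    · exact absurd hij (hxlt i j h').ne
    · exact h'
    · exact absurd hij (hxlt j i h').ne'
  -- The cap `n - 1` puts the end point `r` into the last cell.
  set idx : ℝ → ℕ := fun t ↦ min ⌊(t - l) / h⌋₊ (n - 1) with hidx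
  have hidxm : Measurable idx := by
    refine Measurable.min ?_ measurable_const
    exact Nat.measurable_floor.comp (by fun_prop)
  set φ : ℝ → ℝ := fun t ↦ x (idx t) with hφ
  have hφm : Measurable φ := (measurable_from_nat (f := x)).comp hidxm
  set X := (Finset.range n).image x with hX
  have hφX : ∀ t, φ t ∈ X := fun t ↦ Finset.mem_image.2 ⟨idx t, by
    rw [Finset.mem_range]
    have : idx t ≤ n - 1 := min_le_right _ _
    omega, rfl⟩
  have hXcard : X.card = n := by rw [hX, Finset.card_image_of_injective _ hxinj, Finset.card_range]
  have hXI : ∀ y ∈ X, y ∈ Set.Icc l r := fun y hy ↦ by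
    obtain ⟨i, hi, rfl⟩ := Finset.mem_image.1 hy
    have h1 := hx i
    have h3 : (i : ℝ) + 1 ≤ n := by exact_mod_cast Finset.mem_range.1 hi
    have h4 : (0 : ℝ) ≤ i := i.cast_nonneg
    exact ⟨by nlinarith [h1.1], by nlinarith [h1.2]⟩
  have hφt : ∀ t ∈ Set.Icc l r, |φ t - t| ≤ δ := fun t ht ↦ by
    have h1 := hx (idx t)
    have h0 : 0 ≤ (t - l) / h := div_nonneg (by linarith [ht.1]) hh0.le
    have h2 : l + idx t * h ≤ t := by
      have : (idx t : ℝ) ≤ (t - l) / h :=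
        (Nat.cast_le.2 (min_le_left _ _)).trans (Nat.floor_le h0)
      rw [le_div_iff₀ hh0] at this
      linarith
    have h3 : t ≤ l + (idx t + 1) * h := by
      rcases le_total ⌊(t - l) / h⌋₊ (n - 1) with hle | hle
      · have : (t - l) / h < idx t + 1 := by
          simp only [hidx, min_eq_left hle]; exact Nat.lt_floor_add_one _
        rw [div_lt_iff₀ hh0] at this
        linarith
      · have : ((idx t : ℝ) + 1) = n := by
          simp only [hidx, min_eq_right hle]
          rw [Nat.cast_sub (by omega)]; simp
        rw [this]
        linarith [ht.2]
    rw [abs_le]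
    constructor <;> nlinarith [h1.1, h1.2]
  refine ⟨X, fun y ↦ μ.real (φ ⁻¹' {y}) + δ / n, ⟨hXI, fun y _ ↦ by positivity, ?_⟩, ?_, ?_⟩
  · intro f ε M hf hosc hM
    have hInt : ∫ t, f (φ t) ∂μ = ∑ y ∈ X, μ.real (φ ⁻¹' {y}) * f y := by
      have : ∀ t, f (φ t) = ∑ y ∈ X, (φ ⁻¹' {y}).indicator (fun _ ↦ f y) t := fun t ↦ by
        rw [Finset.sum_eq_single_of_mem (φ t) (hφX t)]
        · simp
        · intro y _ hy
          rw [Set.indicator_of_notMem]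
          exact fun h ↦ hy (by simpa using h.symm)
      simp_rw [this]
      rw [integral_finsetSum]
      · refine Finset.sum_congr rfl fun y _ ↦ ?_
        rw [integral_indicator_const _ (hφm (measurableSet_singleton y)), smul_eq_mul]
      · intro y _
        exact (integrable_const _).indicator (hφm (measurableSet_singleton y))
    have hfi : Integrable f μ := integrable_of_continuousOn_Icc hμ hf
    have hae : ∀ᵐ t ∂μ, t ∈ Set.Icc l r := mem_ae_iff.2 hμ
    have hφi : Integrable (fun t ↦ f (φ t)) μ := by
      have : (fun t ↦ f (φ t)) = fun t ↦ ∑ y ∈ X, (φ ⁻¹' {y}).indicator (fun _ ↦ f y) t := by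
        ext t
        rw [Finset.sum_eq_single_of_mem (φ t) (hφX t)]
        · simp
        · intro y _ hy
          rw [Set.indicator_of_notMem]
          exact fun h ↦ hy (by simpa using h.symm)
      rw [this]
      exact integrable_finsetSum _ fun y _ ↦
        (integrable_const _).indicator (hφm (measurableSet_singleton y))
    have e1 : ∑ y ∈ X, (μ.real (φ ⁻¹' {y}) + δ / n) * f y - ∫ y, f y ∂μ =
        ∫ t, (f (φ t) - f t) ∂μ + δ / n * ∑ y ∈ X, f y := by
      rw [integral_sub hφi hfi, hInt, Finset.mul_sum]
      simp only [add_mul, Finset.sum_add_distrib]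
      ring
    rw [e1]
    refine (abs_add_le _ _).trans (add_le_add ?_ ?_)
    · have := norm_integral_le_of_norm_le_const (μ := μ) (f := fun t ↦ f (φ t) - f t) (C := ε)
        (hae.mono fun t ht ↦ by
          rw [Real.norm_eq_abs]
          exact hosc _ (hXI _ (hφX t)) _ ht (hφt t ht))
      rwa [Real.norm_eq_abs] at this
    · rw [abs_mul, abs_of_pos (by positivity)]
      have : |∑ y ∈ X, f y| ≤ n * M := by
        refine (Finset.abs_sum_le_sum_abs _ _).trans ?_
        refine (Finset.sum_le_card_nsmul _ _ M fun y hy ↦ hM y (hXI y hy)).trans ?_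
        rw [hXcard, nsmul_eq_mul]
      calc δ / n * |∑ y ∈ X, f y| ≤ δ / n * (n * M) := by gcongr
        _ = δ * M := by field_simp
  · intro y hy
    obtain ⟨i, -, rfl⟩ := Finset.mem_image.1 hy
    exact hxD i
  · rw [hXcard, hn]
    omega

theorem IsApproximation.sum_le {μ : Measure ℝ} {l r δ : ℝ} {X : Finset ℝ} {w : ℝ → ℝ}
    (h : IsApproximation μ l r δ X w) : ∑ x ∈ X, w x ≤ μ.real Set.univ + δ := by
  have := h.abs_sub_le (fun _ ↦ 1) 0 1 continuousOn_const (by simp) (by simp)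
  simp only [mul_one, integral_const, smul_eq_mul, zero_mul, zero_add] at this
  linarith [(abs_le.1 this).2]

/-- Dense sets, pairwise disjoint. -/
def shiftedRat (a : ℕ) : Set ℝ := Set.range fun q : ℚ ↦ (q : ℝ) + a * √2

theorem dense_shiftedRat (a : ℕ) : Dense (shiftedRat a) := by
  have := (Homeomorph.addRight ((a : ℝ) * √2)).surjective.denseRange.comp Rat.denseRange_cast
    (Homeomorph.addRight ((a : ℝ) * √2)).continuous
  exact this

/-- A common point would make `√2` rational. -/
theorem disjoint_shiftedRat {a b : ℕ} (hab : a ≠ b) : Disjoint (shiftedRat a) (shiftedRat b) := by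
  rw [Set.disjoint_left]
  rintro _ ⟨q, rfl⟩ ⟨q', hq'⟩
  simp only at hq'
  have hba : ((b : ℝ) - a) ≠ 0 := sub_ne_zero.2 (by exact_mod_cast hab.symm)
  refine irrational_sqrt_two ⟨(q - q') / (b - a), ?_⟩
  push_cast
  rw [div_eq_iff hba]
  linarith

/-! ### Iterated Cauchy transforms of positive measures -/

/-- Positive measures on intervals `[l a, r a]`, `a = 0, …, m`, consecutive ones disjoint. -/
structure PositiveSystem (m : ℕ) (l r : ℕ → ℝ) (μ : ℕ → Measure ℝ) : Prop where
  finite : ∀ a, IsFiniteMeasure (μ a)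
  lt : ∀ a ≤ m, l a < r a
  null_compl : ∀ a ≤ m, μ a (Set.Icc (l a) (r a))ᶜ = 0
  disjoint : ∀ a < m, Disjoint (Set.Icc (l a) (r a)) (Set.Icc (l (a + 1)) (r (a + 1)))
  infinite : ∀ a ≤ m, (μ a).support.Infinite

/-- The iterated Cauchy transform of `d` consecutive measures, starting at level `a`. -/
def chain (μ : ℕ → Measure ℝ) : ℕ → ℕ → ℝ → ℝ
  | 0, _, _ => 1
  | d + 1, a, x => ∫ y, chain μ d (a + 1) y / (x - y) ∂μ a

theorem exists_le_norm_sub {K : Set ℝ} (hK : IsCompact K) {z : ℂ} (hz : z ∉ Complex.ofReal '' K) :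
    ∃ ρ > 0, ∀ y ∈ K, ρ ≤ ‖z - y‖ := by
  have hc : IsClosed (Complex.ofReal '' K) := (hK.image Complex.continuous_ofReal).isClosed
  obtain ⟨ρ, hρ, hb⟩ := Metric.isOpen_iff.1 hc.isOpen_compl z hz
  refine ⟨ρ, hρ, fun y hy ↦ ?_⟩
  by_contra! hlt
  refine hb (Metric.mem_ball.2 ?_) ⟨y, hy, rfl⟩
  rwa [dist_comm, dist_eq_norm]

theorem differentiableOn_integral_div {μ : Measure ℝ} [IsFiniteMeasure μ] {l r : ℝ}
    (hμ : μ (Set.Icc l r)ᶜ = 0) {g : ℝ → ℂ} (hg : ContinuousOn g (Set.Icc l r)) :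
    DifferentiableOn ℂ (fun z : ℂ ↦ ∫ y, g y / (z - y) ∂μ) (Complex.ofReal '' Set.Icc l r)ᶜ := by
  intro z hz
  obtain ⟨ρ, hρ, hd⟩ := exists_le_norm_sub isCompact_Icc hz
  obtain ⟨G, hG⟩ := isCompact_Icc.exists_bound_of_continuousOn hg
  have hae : ∀ᵐ y ∂μ, y ∈ Set.Icc l r := mem_ae_iff.2 hμ
  have hball : ∀ x ∈ Metric.ball z (ρ / 2), ∀ y ∈ Set.Icc l r, ρ / 2 ≤ ‖x - y‖ := fun x hx y hy ↦ by
    have h1 := hd y hy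
    have h2 : ‖z - x‖ < ρ / 2 := by rw [← dist_eq_norm, dist_comm]; exact hx
    have h3 := norm_add_le (z - x) (x - y)
    rw [sub_add_sub_cancel] at h3
    linarith
  have hne : ∀ x ∈ Metric.ball z (ρ / 2), ∀ y ∈ Set.Icc l r, x - (y : ℂ) ≠ 0 := fun x hx y hy h0 ↦ by
    have := hball x hx y hy
    rw [h0, norm_zero] at this
    linarith
  have hInt : ∀ x ∈ Metric.ball z (ρ / 2), Integrable (fun y : ℝ ↦ g y / (x - y)) μ := fun x hx ↦
    integrable_of_continuousOn_Icc hμ (hg.div (by fun_prop) fun y hy ↦ hne x hx y hy)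
  have key := hasDerivAt_integral_of_dominated_loc_of_deriv_le (μ := μ) (𝕜 := ℂ)
    (F := fun (x : ℂ) (y : ℝ) ↦ g y / (x - y)) (F' := fun x y ↦ -(g y / (x - y) ^ 2)) (x₀ := z)
    (s := Metric.ball z (ρ / 2)) (bound := fun _ ↦ G / (ρ / 2) ^ 2)
    (Metric.ball_mem_nhds z (by positivity))
    (Filter.eventually_of_mem (Metric.ball_mem_nhds z (by positivity))
      fun x hx ↦ (hInt x hx).aestronglyMeasurable)
    (hInt z (Metric.mem_ball_self (by positivity)))
    (integrable_of_continuousOn_Icc hμ ((hg.div (by fun_prop) fun y hy ↦ pow_ne_zero 2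
      (hne z (Metric.mem_ball_self (by positivity)) y hy)).neg)).aestronglyMeasurable
    (hae.mono fun y hy x hx ↦ by
      rw [norm_neg, norm_div, norm_pow]
      have h1 := hball x hx y hy
      have h2 := hG y hy
      gcongr
      exact (norm_nonneg _).trans h2)
    (integrable_const _)
    (hae.mono fun y hy x hx ↦ by
      have h := ((hasDerivAt_id x).sub_const (y : ℂ)).inv (hne x hx y hy)
      have h' := h.const_mul (g y)
      simp only [id, div_eq_mul_inv] at h' ⊢
      exact h'.congr_deriv (by field_simp))
  exact key.2.differentiableAt.differentiableWithinAt

theorem ofReal_integral_div {μ : Measure ℝ} (g : ℝ → ℝ) (x : ℝ) :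
    ((∫ y, g y / (x - y) ∂μ : ℝ) : ℂ) = ∫ y, (g y : ℂ) / ((x : ℂ) - y) ∂μ := by
  rw [← integral_complex_ofReal]
  refine integral_congr_ae (Filter.Eventually.of_forall fun y ↦ ?_)
  push_cast
  rfl

theorem continuousOn_integral_div {μ : Measure ℝ} [IsFiniteMeasure μ] {l r : ℝ}
    (hμ : μ (Set.Icc l r)ᶜ = 0) {g : ℝ → ℝ} (hg : ContinuousOn g (Set.Icc l r)) :
    ContinuousOn (fun x : ℝ ↦ ∫ y, g y / (x - y) ∂μ) (Set.Icc l r)ᶜ := by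
  have h1 := (differentiableOn_integral_div hμ (g := fun y ↦ (g y : ℂ))
    (Complex.continuous_ofReal.comp_continuousOn hg)).continuousOn
  have h2 := h1.comp (f := Complex.ofReal) (s := (Set.Icc l r)ᶜ) Complex.continuous_ofReal.continuousOn
    (fun x hx ↦ by
      rintro ⟨y, hy, hyx⟩
      exact hx (Complex.ofReal_injective hyx ▸ hy))
  have h3 := Complex.continuous_re.comp_continuousOn h2
  refine h3.congr fun x _ ↦ ?_
  simp only [Function.comp]
  rw [← ofReal_integral_div, Complex.ofReal_re]

theorem exists_sign_of_continuousOn {J : Set ℝ} (hJ : J.OrdConnected) {f : ℝ → ℝ}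
    (hf : ContinuousOn f J) (h0 : ∀ x ∈ J, f x ≠ 0) : (∀ x ∈ J, 0 < f x) ∨ ∀ x ∈ J, f x < 0 := by
  rcases J.eq_empty_or_nonempty with rfl | ⟨x₀, hx₀⟩
  · simp
  have key : ∀ x ∈ J, 0 < f x₀ * f x := fun x hx ↦ by
    by_contra! h
    have hivt := intermediate_value_uIcc (f := f) (a := x₀) (b := x)
      (hf.mono (hJ.uIcc_subset hx₀ hx))
    have h0' : (0 : ℝ) ∈ Set.uIcc (f x₀) (f x) := by
      rw [Set.mem_uIcc]
      rcases mul_nonpos_iff.1 h with h | h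
      · exact Or.inr ⟨h.2, h.1⟩
      · exact Or.inl h
    obtain ⟨y, hy, hy0⟩ := hivt h0'
    exact h0 y (hJ.uIcc_subset hx₀ hx hy) hy0
  rcases lt_or_gt_of_ne (h0 x₀ hx₀) with h | h
  · exact Or.inr fun x hx ↦ by nlinarith [key x hx]
  · exact Or.inl fun x hx ↦ (mul_pos_iff_of_pos_left h).1 (key x hx)

theorem integral_pos_of_continuousOn {μ : Measure ℝ} [IsFiniteMeasure μ] (hμ0 : μ ≠ 0) {l r : ℝ}
    (hμ : μ (Set.Icc l r)ᶜ = 0) {f : ℝ → ℝ} (hf : ContinuousOn f (Set.Icc l r))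
    (h0 : ∀ x ∈ Set.Icc l r, 0 < f x) : 0 < ∫ x, f x ∂μ := by
  have hae : ∀ᵐ t ∂μ, t ∈ Set.Icc l r := mem_ae_iff.2 hμ
  rw [integral_pos_iff_support_of_nonneg_ae (hae.mono fun t ht ↦ (h0 t ht).le)
    (integrable_of_continuousOn_Icc hμ hf)]
  rw [pos_iff_ne_zero]
  intro hs
  refine hμ0 (Measure.measure_univ_eq_zero.1 (le_antisymm ?_ zero_le))
  calc μ Set.univ ≤ μ (Function.support f ∪ (Set.Icc l r)ᶜ) := measure_mono fun x _ ↦ by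
        by_cases hx : x ∈ Set.Icc l r
        · exact Or.inl (h0 x hx).ne'
        · exact Or.inr hx
    _ ≤ μ (Function.support f) + μ (Set.Icc l r)ᶜ := measure_union_le _ _
    _ = 0 := by rw [hs, hμ, add_zero]

theorem integral_ne_zero_of_continuousOn {μ : Measure ℝ} [IsFiniteMeasure μ] (hμ0 : μ ≠ 0)
    {l r : ℝ} (hμ : μ (Set.Icc l r)ᶜ = 0) {f : ℝ → ℝ} (hf : ContinuousOn f (Set.Icc l r))
    (h0 : ∀ x ∈ Set.Icc l r, f x ≠ 0) : ∫ x, f x ∂μ ≠ 0 := by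
  rcases exists_sign_of_continuousOn Set.ordConnected_Icc hf h0 with h | h
  · exact (integral_pos_of_continuousOn hμ0 hμ hf h).ne'
  · have := integral_pos_of_continuousOn hμ0 hμ hf.neg (fun x hx ↦ by simpa using h x hx)
    simp only [Pi.neg_apply, integral_neg] at this
    exact (by linarith : ∫ x, f x ∂μ < 0).ne

namespace PositiveSystem

variable {m : ℕ} {l r : ℕ → ℝ} {μ : ℕ → Measure ℝ}

theorem ne_zero (h : PositiveSystem m l r μ) {a : ℕ} (ha : a ≤ m) : μ a ≠ 0 := by
  intro h0
  have := h.infinite a ha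
  rw [h0] at this
  simp at this

theorem continuousOn_chain (h : PositiveSystem m l r μ) (d : ℕ) : ∀ a, a + d ≤ m + 1 →
    ContinuousOn (chain μ d a) (Set.Icc (l a) (r a))ᶜ := by
  induction d with
  | zero => exact fun a _ ↦ continuousOn_const
  | succ d ih =>
    intro a ha
    have := h.finite a
    refine continuousOn_integral_div (h.null_compl a (by omega)) ?_
    cases d with
    | zero => exact continuousOn_const
    | succ d =>
      exact (ih (a + 1) (by omega)).mono fun x hx hx' ↦
        Set.disjoint_left.1 (h.disjoint a (by omega)) hx hx'

theorem continuousOn_chain_Icc (h : PositiveSystem m l r μ) {d a : ℕ} (ha : a + 1 + d ≤ m + 1) :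
    ContinuousOn (chain μ d (a + 1)) (Set.Icc (l a) (r a)) := by
  cases d with
  | zero => exact continuousOn_const
  | succ d =>
    exact (h.continuousOn_chain (d + 1) (a + 1) (by omega)).mono fun x hx hx' ↦
      Set.disjoint_left.1 (h.disjoint a (by omega)) hx hx'

/-- The inner chain is continuous and zero-free on `[l a, r a]`, hence of constant sign there, and
so is `1 / (x - y)` for `x` outside. The integral of a function of strict constant sign against a
nonzero measure is not zero. -/
theorem chain_ne_zero (h : PositiveSystem m l r μ) (d : ℕ) : ∀ a, a + d ≤ m + 1 →
    ∀ x ∉ Set.Icc (l a) (r a), chain μ d a x ≠ 0 := by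
  induction d with
  | zero => exact fun a _ x _ ↦ one_ne_zero
  | succ d ih =>
    intro a ha x hx
    have := h.finite a
    have hne : ∀ y ∈ Set.Icc (l a) (r a), x - y ≠ 0 := fun y hy h0 ↦ hx (by rwa [sub_eq_zero.1 h0])
    refine integral_ne_zero_of_continuousOn (h.ne_zero (by omega)) (h.null_compl a (by omega))
      ((h.continuousOn_chain_Icc (by omega)).div (by fun_prop) hne) fun y hy ↦ div_ne_zero ?_ (hne y hy)
    cases d with
    | zero => exact one_ne_zero
    | succ d =>
      exact ih (a + 1) (by omega) y fun hy' ↦ Set.disjoint_left.1 (h.disjoint a (by omega)) hy hy'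

theorem chain_ne_zero_of_mem (h : PositiveSystem m l r μ) {d a : ℕ} (ha : a + 1 + d ≤ m + 1) {x : ℝ}
    (hx : x ∈ Set.Icc (l a) (r a)) : chain μ d (a + 1) x ≠ 0 := by
  cases d with
  | zero => exact one_ne_zero
  | succ d =>
    exact h.chain_ne_zero (d + 1) (a + 1) (by omega) x fun hy' ↦
      Set.disjoint_left.1 (h.disjoint a (by omega)) hx hy'

end PositiveSystem

theorem exists_le_abs_sub {J K : Set ℝ} (hJ : IsCompact J) (hK : IsCompact K) (hJK : Disjoint J K) :
    ∃ ρ > 0, ∀ x ∈ J, ∀ y ∈ K, ρ ≤ |x - y| := by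
  obtain ⟨ρ, hρ, h⟩ := Metric.exists_pos_forall_lt_edist hJ hK.isClosed hJK
  refine ⟨ρ, hρ, fun x hx y hy ↦ ?_⟩
  have := h x hx y hy
  rw [edist_dist, ENNReal.ofReal_eq_coe_nnreal dist_nonneg, ENNReal.coe_lt_coe] at this
  exact (NNReal.coe_lt_coe.2 this).le

/-! ### Discrete approximation of a Nikishin system -/

/-- Replacing `G K` by `g` costs at most the total mass times `sup |G K - g| / ρ`, where `ρ`
separates `J` from `[l, r]`. The remaining quadrature error is uniform in `x`, because `g y / (x -
y)` is bounded and uniformly continuous on the compact product. -/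
theorem tendstoUniformlyOn_sum_div {μ : Measure ℝ} [IsFiniteMeasure μ] {l r : ℝ}
    {X : ℕ → Finset ℝ} {w : ℕ → ℝ → ℝ} {δ : ℕ → ℝ}
    (happ : ∀ K, IsApproximation μ l r (δ K) (X K) (w K))
    (hδ : Filter.Tendsto δ Filter.atTop (nhds 0)) {G : ℕ → ℝ → ℝ} {g : ℝ → ℝ}
    (hg : ContinuousOn g (Set.Icc l r)) (hG : TendstoUniformlyOn G g Filter.atTop (Set.Icc l r))
    {J : Set ℝ} (hJ : IsCompact J) (hJI : Disjoint J (Set.Icc l r)) :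
    TendstoUniformlyOn (fun K x ↦ ∑ y ∈ X K, w K y * G K y / (x - y))
      (fun x ↦ ∫ y, g y / (x - y) ∂μ) Filter.atTop J := by
  obtain ⟨ρ, hρ, hsep⟩ := exists_le_abs_sub hJ isCompact_Icc hJI
  have hne : ∀ x ∈ J, ∀ y ∈ Set.Icc l r, x - y ≠ 0 := fun x hx y hy h0 ↦ by
    have := hsep x hx y hy
    rw [h0, abs_zero] at this
    linarith
  have hFc : ContinuousOn (fun z : ℝ × ℝ ↦ g z.2 / (z.1 - z.2)) (J ×ˢ Set.Icc l r) :=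
    (hg.comp continuousOn_snd fun z hz ↦ hz.2).div (by fun_prop) fun z hz ↦ hne _ hz.1 _ hz.2
  have hcomp := hJ.prod (isCompact_Icc (a := l) (b := r))
  obtain ⟨M, hM⟩ := hcomp.exists_bound_of_continuousOn hFc
  have huc := hcomp.uniformContinuousOn_of_continuous hFc
  rw [Metric.uniformContinuousOn_iff] at huc
  rw [Metric.tendstoUniformlyOn_iff] at hG ⊢
  intro ε hε
  set A := μ.real Set.univ with hA
  have hA0 : 0 ≤ A := measureReal_nonneg
  obtain ⟨δ₁, hδ₁, hosc⟩ := huc (ε / (4 * (A + 1))) (by positivity)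
  have e1 := hG (ε * ρ / (4 * (A + 1))) (by positivity)
  have e2 : ∀ᶠ K in Filter.atTop, δ K < min (min δ₁ 1) (ε / (4 * (|M| + 1))) :=
    hδ.eventually_lt_const (by positivity)
  filter_upwards [e1, e2] with K h1 h2 x hx
  rw [lt_min_iff, lt_min_iff] at h2
  have happK := happ K
  have hsum : ∑ y ∈ X K, w K y ≤ A + 1 := happK.sum_le.trans (by linarith [h2.1.2])
  have b1 : |∑ y ∈ X K, w K y * (g y / (x - y)) - ∫ y, g y / (x - y) ∂μ| ≤
      ε / (4 * (A + 1)) * A + δ K * |M| := by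
    refine happK.abs_sub_le (fun y ↦ g y / (x - y)) _ _ ?_ ?_ ?_
    · exact hg.div (by fun_prop) fun y hy ↦ hne x hx y hy
    · intro y hy y' hy' hyy
      have := hosc (x, y) ⟨hx, hy⟩ (x, y') ⟨hx, hy'⟩ (by
        rw [Prod.dist_eq, dist_self, max_eq_right dist_nonneg, Real.dist_eq]
        linarith [h2.1.1])
      rw [Real.dist_eq] at this
      exact this.le
    · intro y hy
      exact (hM (x, y) ⟨hx, hy⟩).trans (le_abs_self M)
  have b2 : |∑ y ∈ X K, w K y * G K y / (x - y) - ∑ y ∈ X K, w K y * (g y / (x - y))| ≤ ε / 4 := by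
    rw [← Finset.sum_sub_distrib]
    refine (Finset.abs_sum_le_sum_abs _ _).trans ?_
    calc ∑ y ∈ X K, |w K y * G K y / (x - y) - w K y * (g y / (x - y))|
        ≤ ∑ y ∈ X K, w K y * (ε / (4 * (A + 1))) := Finset.sum_le_sum fun y hy ↦ by
          have hw := happK.pos y hy
          have hyI := happK.mem y hy
          have hd := h1 y hyI
          rw [Real.dist_eq, abs_sub_comm] at hd
          have hs := hsep x hx y hyI
          have : w K y * G K y / (x - y) - w K y * (g y / (x - y)) =
              w K y * ((G K y - g y) / (x - y)) := by ring
          rw [this, abs_mul, abs_of_pos hw, abs_div]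
          refine mul_le_mul_of_nonneg_left ?_ hw.le
          rw [div_le_iff₀ (hρ.trans_le hs)]
          have h3 : ε / (4 * (A + 1)) * ρ ≤ ε / (4 * (A + 1)) * |x - y| :=
            mul_le_mul_of_nonneg_left hs (by positivity)
          calc |G K y - g y| ≤ ε * ρ / (4 * (A + 1)) := hd.le
            _ = ε / (4 * (A + 1)) * ρ := by ring
            _ ≤ _ := h3
      _ = (∑ y ∈ X K, w K y) * (ε / (4 * (A + 1))) := by rw [Finset.sum_mul]
      _ ≤ (A + 1) * (ε / (4 * (A + 1))) := mul_le_mul_of_nonneg_right hsum (by positivity)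
      _ = ε / 4 := by field_simp
  have b3 : ε / (4 * (A + 1)) * A ≤ ε / 4 := by
    calc ε / (4 * (A + 1)) * A ≤ ε / (4 * (A + 1)) * (A + 1) :=
          mul_le_mul_of_nonneg_left (by linarith) (by positivity)
      _ = ε / 4 := by field_simp
  have b4 : δ K * |M| ≤ ε / 4 := by
    calc δ K * |M| ≤ ε / (4 * (|M| + 1)) * (|M| + 1) :=
          mul_le_mul h2.2.le (by linarith) (abs_nonneg M) (by positivity)
      _ = ε / 4 := by field_simp
  rw [dist_comm, Real.dist_eq]
  have := abs_sub_le (∑ y ∈ X K, w K y * G K y / (x - y)) (∑ y ∈ X K, w K y * (g y / (x - y)))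
    (∫ y, g y / (x - y) ∂μ)
  linarith

/-- The interval `[l a, r a]` for `a = 1, …, m`, and the empty set otherwise. -/
def levelInterval (m : ℕ) (l r : ℕ → ℝ) (a : ℕ) : Set ℝ :=
  if 1 ≤ a ∧ a ≤ m then Set.Icc (l a) (r a) else ∅

theorem isClosed_levelInterval (m : ℕ) (l r : ℕ → ℝ) (a : ℕ) : IsClosed (levelInterval m l r a) := by
  rw [levelInterval]
  split_ifs
  exacts [isClosed_Icc, isClosed_empty]

theorem PositiveSystem.disjoint_levelInterval {m : ℕ} {l r : ℕ → ℝ} {μ : ℕ → Measure ℝ}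
    (h : PositiveSystem m l r μ) : Disjoint (Set.Icc (l 0) (r 0)) (levelInterval m l r 1) := by
  rw [levelInterval]
  split_ifs with h'
  · exact h.disjoint 0 (by omega)
  · exact Set.disjoint_empty _

/-- Convergence goes by induction on the length of the chain and has to be uniform on compact sets,
since the inner chain is evaluated at the moving nodes of the preceding level. -/
theorem PositiveSystem.exists_discreteSystem {m : ℕ} {l r : ℕ → ℝ} {μ : ℕ → Measure ℝ}
    (h : PositiveSystem m l r μ) (B : ℕ) :
    ∃ (X : ℕ → ℕ → Finset ℝ) (w : ℕ → ℕ → ℝ → ℝ),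
      (∀ K, DiscreteSystem m (levelInterval m l r) (X K) (w K)) ∧
      (∀ K a, 1 ≤ a → a ≤ m → B ≤ (X K a).card) ∧
      ∀ k ≤ m, ∀ x ∉ levelInterval m l r 1, Filter.Tendsto
        (fun K ↦ discreteChain (X K) (w K) k 1 x) Filter.atTop (nhds (chain μ k 1 x)) := by
  have hex : ∀ K a : ℕ, ∃ (X : Finset ℝ) (w : ℝ → ℝ), (1 ≤ a ∧ a ≤ m →
      IsApproximation (μ a) (l a) (r a) (1 / ((K : ℝ) + 1)) X w ∧ B + m + 2 ≤ X.card) ∧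
      (¬ (1 ≤ a ∧ a ≤ m) → X = ∅) ∧ ∀ x ∈ X, x ∈ shiftedRat a := fun K a ↦ by
    by_cases ha : 1 ≤ a ∧ a ≤ m
    · have := h.finite a
      obtain ⟨X, w, h1, h2, h3⟩ := exists_isApproximation (μ a) (h.lt a ha.2) (h.null_compl a ha.2)
        (dense_shiftedRat a) (δ := 1 / ((K : ℝ) + 1)) (by positivity) (B + m + 2)
      exact ⟨X, w, fun _ ↦ ⟨h1, h3⟩, fun h ↦ absurd ha h, h2⟩
    · exact ⟨∅, 0, fun h ↦ absurd h ha, fun _ ↦ rfl, by simp⟩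
  choose X w happ hemp hrat using hex
  refine ⟨X, w, fun K ↦ ?_, fun K a h1 h2 ↦ by have := (happ K a ⟨h1, h2⟩).2; omega, ?_⟩
  · refine ⟨fun i ↦ ?_, fun i ↦ ?_, fun a x hx ↦ ?_, fun a x hx ↦ ?_, hemp K 0 (by simp),
      fun a ha ↦ hemp K a (by omega), fun a b hab ↦ ?_, fun a h1 h2 ↦ ?_⟩
    · rw [levelInterval]
      split_ifs
      exacts [Set.ordConnected_Icc, Set.ordConnected_empty]
    · rw [levelInterval, levelInterval]
      split_ifs
      · exact h.disjoint i (by omega)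
      all_goals simp
    · by_cases ha : 1 ≤ a ∧ a ≤ m
      · rw [levelInterval, if_pos ha]
        exact (happ K a ha).1.mem x hx
      · simp [hemp K a ha] at hx
    · by_cases ha : 1 ≤ a ∧ a ≤ m
      · exact (happ K a ha).1.pos x hx
      · simp [hemp K a ha] at hx
    · rw [Finset.disjoint_left]
      exact fun x hx hx' ↦ Set.disjoint_left.1 (disjoint_shiftedRat hab) (hrat K a x hx) (hrat K b x hx')
    · have := (happ K a ⟨h1, h2⟩).2
      omega
  · have key : ∀ d a, 1 ≤ a → a + d ≤ m + 1 → ∀ J : Set ℝ, IsCompact J →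
        (d = 0 ∨ Disjoint J (Set.Icc (l a) (r a))) →
        TendstoUniformlyOn (fun K ↦ discreteChain (X K) (w K) d a) (chain μ d a) Filter.atTop J := by
      intro d
      induction d with
      | zero =>
        intro a _ _ J _ _
        rw [Metric.tendstoUniformlyOn_iff]
        intro ε hε
        exact Filter.Eventually.of_forall fun K x _ ↦ by simpa [discreteChain, chain] using hε
      | succ d ih =>
        intro a h1 h2 J hJ hd
        have := h.finite a
        refine tendstoUniformlyOn_sum_div (fun K ↦ (happ K a ⟨h1, by omega⟩).1)
          tendsto_one_div_add_atTop_nhds_zero_nat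
          (h.continuousOn_chain_Icc (by omega)) (ih (a + 1) (by omega) (by omega) _ isCompact_Icc ?_)
          hJ (hd.resolve_left (by omega))
        cases d with
        | zero => exact Or.inl rfl
        | succ d => exact Or.inr (h.disjoint a (by omega))
    intro k hk x hx
    refine (key k 1 le_rfl (by omega) {x} isCompact_singleton ?_).tendsto_at rfl
    cases k with
    | zero => exact Or.inl rfl
    | succ k =>
      rw [levelInterval, if_pos (by omega)] at hx
      exact Or.inr (by simpa using hx)

/-! ### Linear forms with prescribed sign changes -/

theorem exists_ne_zero_forall_sum_eq_zero {ι : Type*} [Fintype ι] (φ : ι → ℝ → ℝ) (W : Finset ℝ)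
    (hW : W.card < Fintype.card ι) : ∃ c : ι → ℝ, c ≠ 0 ∧ ∀ z ∈ W, ∑ i, c i * φ i z = 0 := by
  let L : (ι → ℝ) →ₗ[ℝ] (W → ℝ) :=
    { toFun := fun c z ↦ ∑ i, c i * φ i z
      map_add' := fun c c' ↦ by ext z; simp [add_mul, Finset.sum_add_distrib]
      map_smul' := fun t c ↦ by ext z; simp [mul_assoc, Finset.mul_sum] }
  have hker : LinearMap.ker L ≠ ⊥ := LinearMap.ker_ne_bot_of_finrank_lt (by simpa using hW)
  obtain ⟨c, hc, hc0⟩ := (Submodule.ne_bot_iff _).1 hker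
  exact ⟨c, hc0, fun z hz ↦ congrFun (LinearMap.mem_ker.1 hc) ⟨z, hz⟩⟩

/-- The prescribed zeros are completed by points to the left of `a` to the maximal number
`Fintype.card ι - 1`, so that the approximating form has a definite sign pattern; the added factors
are positive on `[a, b]`. Coefficient vectors scaled to norm one have a convergent subsequence with
nonzero limit. -/
theorem exists_sum_mul_prod_nonneg_of_tendsto {ι : Type*} [Fintype ι] {φ : ℕ → ι → ℝ → ℝ}
    {ψ : ι → ℝ → ℝ} {a b ε : ℝ} (hε : 0 < ε)
    (hlim : ∀ i, ∀ x ∈ Set.Icc a b, Filter.Tendsto (fun K ↦ φ K i x) Filter.atTop (nhds (ψ i x)))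
    (hsign : ∀ K, ∀ c : ι → ℝ, c ≠ 0 → ∀ W : Finset ℝ, (∀ z ∈ W, z ∈ Set.Icc (a - ε) b) →
      W.card + 1 = Fintype.card ι → (∀ z ∈ W, ∑ i, c i * φ K i z = 0) →
      ∃ s : ℝ, s ≠ 0 ∧ ∀ x ∈ Set.Icc (a - ε) b, 0 ≤ s * ((∑ i, c i * φ K i x) * ∏ z ∈ W, (x - z)))
    {E : Finset ℝ} (hE : ∀ z ∈ E, z ∈ Set.Icc a b) (hEc : E.card < Fintype.card ι) :
    ∃ c : ι → ℝ, c ≠ 0 ∧ ∀ x ∈ Set.Icc a b, 0 ≤ (∑ i, c i * ψ i x) * ∏ z ∈ E, (x - z) := by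
  rcases lt_or_ge b a with hba | hab
  · obtain ⟨c, hc, -⟩ := exists_ne_zero_forall_sum_eq_zero ψ ∅ (by simp; omega)
    exact ⟨c, hc, fun x hx ↦ absurd (hx.1.trans hx.2) (not_le.2 hba)⟩
  obtain ⟨F, hF, hFc⟩ := (Set.Ico_infinite (sub_lt_self a hε)).exists_subset_card_eq
    (Fintype.card ι - 1 - E.card)
  have hdisj : Disjoint E F := Finset.disjoint_left.2 fun z hz hz' ↦
    absurd (hE z hz).1 (not_le.2 (hF hz').2)
  have hW : ∀ z ∈ E ∪ F, z ∈ Set.Icc (a - ε) b := fun z hz ↦ by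
    rcases Finset.mem_union.1 hz with hz | hz
    · exact ⟨by linarith [(hE z hz).1], (hE z hz).2⟩
    · exact ⟨(hF hz).1, (hF hz).2.le.trans hab⟩
  have hWc : (E ∪ F).card + 1 = Fintype.card ι := by
    rw [Finset.card_union_of_disjoint hdisj, hFc]
    omega
  have step : ∀ K, ∃ c : ι → ℝ, ‖c‖ = 1 ∧
      ∀ x ∈ Set.Icc a b, 0 ≤ (∑ i, c i * φ K i x) * ∏ z ∈ E, (x - z) := fun K ↦ by
    obtain ⟨c, hc, hc0⟩ := exists_ne_zero_forall_sum_eq_zero (φ K) (E ∪ F) (by omega)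
    obtain ⟨s, hs, hsx⟩ := hsign K c hc (E ∪ F) hW hWc hc0
    have hsc : 0 < ‖s • c‖ := norm_pos_iff.2 (smul_ne_zero hs hc)
    refine ⟨‖s • c‖⁻¹ • (s • c), by rw [norm_smul, norm_inv, norm_norm, inv_mul_cancel₀ hsc.ne'],
      fun x hx ↦ ?_⟩
    have h1 := hsx x ⟨by linarith [hx.1], hx.2⟩
    rw [Finset.prod_union hdisj] at h1
    have hFpos : 0 < ∏ z ∈ F, (x - z) := Finset.prod_pos fun z hz ↦ by linarith [(hF hz).2, hx.1]
    have h2 : 0 ≤ s * (∑ i, c i * φ K i x) * ∏ z ∈ E, (x - z) := by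
      refine nonneg_of_mul_nonneg_left (b := ∏ z ∈ F, (x - z)) (h1.trans_eq ?_) hFpos
      ring
    have h3 : ∑ i, (‖s • c‖⁻¹ • (s • c)) i * φ K i x = ‖s • c‖⁻¹ * (s * ∑ i, c i * φ K i x) := by
      simp only [Pi.smul_apply, smul_eq_mul, Finset.mul_sum, mul_assoc]
    rw [h3, mul_assoc]
    exact mul_nonneg (inv_nonneg.2 hsc.le) h2
  choose c hc1 hc using step
  obtain ⟨c₀, hc₀, τ, hτ, hlimc⟩ := (isCompact_sphere (0 : ι → ℝ) 1).tendsto_subseq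
    (x := c) fun K ↦ by simp [hc1 K]
  refine ⟨c₀, fun h0 ↦ by simp [h0] at hc₀, fun x hx ↦ ?_⟩
  have ht : Filter.Tendsto (fun K ↦ (∑ i, c (τ K) i * φ (τ K) i x) * ∏ z ∈ E, (x - z)) Filter.atTop
      (nhds ((∑ i, c₀ i * ψ i x) * ∏ z ∈ E, (x - z))) := by
    refine Filter.Tendsto.mul_const _ (tendsto_finsetSum _ fun i _ ↦ Filter.Tendsto.mul ?_ ?_)
    · exact (tendsto_pi_nhds.1 hlimc) i
    · exact (hlim i x hx).comp hτ.tendsto_atTop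
  exact ge_of_tendsto' ht fun K ↦ hc (τ K) x hx

/-- The polynomials with coefficients `c`, grouped by level. -/
def coeffPoly {m : ℕ} {ν : ℕ → ℕ} (c : (Σ k : Fin (m + 1), Fin (ν k)) → ℝ) (k : ℕ) : ℝ[X] :=
  if h : k < m + 1 then ∑ i : Fin (ν k), C (c ⟨⟨k, h⟩, i⟩) * Polynomial.X ^ (i : ℕ) else 0

theorem degree_coeffPoly_lt {m : ℕ} {ν : ℕ → ℕ} (c : (Σ k : Fin (m + 1), Fin (ν k)) → ℝ) (k : ℕ) :
    (coeffPoly c k).degree < (ν k : WithBot ℕ) := by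
  rw [coeffPoly]
  split_ifs with h
  · exact degree_sum_fin_lt _
  · rw [degree_zero]
    exact WithBot.bot_lt_coe _

theorem exists_coeffPoly_ne_zero {m : ℕ} {ν : ℕ → ℕ} {c : (Σ k : Fin (m + 1), Fin (ν k)) → ℝ}
    (hc : c ≠ 0) : ∃ k ≤ m, coeffPoly c k ≠ 0 := by
  by_contra! h0
  refine hc (funext fun ⟨k, i⟩ ↦ ?_)
  have h1 := congrArg (fun p ↦ coeff p (i : ℕ)) (h0 k (by omega))
  simp only [coeffPoly, k.isLt, dif_pos, finsetSum_coeff, coeff_C_mul, coeff_X_pow, coeff_zero] at h1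
  rw [Finset.sum_eq_single i (fun j _ hj ↦ by simp [Fin.val_inj, hj.symm]) (by simp)] at h1
  simpa using h1

theorem sum_eval_coeffPoly {m : ℕ} {ν : ℕ → ℕ} (c : (Σ k : Fin (m + 1), Fin (ν k)) → ℝ)
    (u : ℕ → ℝ) (x : ℝ) : ∑ k ∈ Finset.range (m + 1), (coeffPoly c k).eval x * u k =
      ∑ j : Σ k : Fin (m + 1), Fin (ν k), c j * (x ^ (j.2 : ℕ) * u j.1) := by
  rw [← Fin.sum_univ_eq_sum_range (fun k ↦ (coeffPoly c k).eval x * u k), Fintype.sum_sigma]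
  refine Finset.sum_congr rfl fun k _ ↦ ?_
  simp only [coeffPoly, k.isLt, dif_pos, eval_finsetSum, eval_mul, eval_C, eval_pow, eval_X,
    Finset.sum_mul, mul_assoc]

/-- The multipliers `v k` allow one limit argument for both kinds of forms: `v k = 1` gives the
plain ones, and `v k = X - ξ` for `k ≠ j` the modified ones. -/
theorem PositiveSystem.exists_sum_mul_prod_nonneg {m : ℕ} {l r : ℕ → ℝ} {μ : ℕ → Measure ℝ}
    (h : PositiveSystem m l r μ) {ν : ℕ → ℕ} {v : ℕ → ℝ[X]} (B : ℕ)
    (hB : ∀ X w, DiscreteSystem m (levelInterval m l r) X w →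
      (∀ a, 1 ≤ a → a ≤ m → B ≤ (X a).card) → ∀ p : ℕ → ℝ[X],
      (∀ k, (p k).degree < (ν k : WithBot ℕ)) → (∃ k ≤ m, p k ≠ 0) → ∀ q : ℝ[X],
      (∀ x ∈ levelInterval m l r 1, q.eval x ≠ 0) →
      q ∣ ∑ k ∈ Finset.range (m + 1), p k * v k * chainPoly X w k 1 →
      q.natDegree < ∑ k ∈ Finset.range (m + 1), ν k)
    {E : Finset ℝ} (hE : ∀ z ∈ E, z ∈ Set.Icc (l 0) (r 0))
    (hEc : E.card < ∑ k ∈ Finset.range (m + 1), ν k) :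
    ∃ p : ℕ → ℝ[X], (∀ k, (p k).degree < (ν k : WithBot ℕ)) ∧ (∃ k ≤ m, p k ≠ 0) ∧
      ∀ x ∈ Set.Icc (l 0) (r 0), 0 ≤ (∑ k ∈ Finset.range (m + 1),
        (p k).eval x * ((v k).eval x * chain μ k 1 x)) * ∏ z ∈ E, (x - z) := by
  obtain ⟨X, w, hsys, hcard, hlim⟩ := h.exists_discreteSystem B
  have hlr := (h.lt 0 (Nat.zero_le m)).le
  have hl0 : l 0 ∉ levelInterval m l r 1 :=
    Set.disjoint_left.1 h.disjoint_levelInterval (Set.left_mem_Icc.2 hlr)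
  -- Room to the left of `l 0`, still off the first level, for the auxiliary zeros.
  obtain ⟨ε, hε, hball⟩ := Metric.isOpen_iff.1 (isClosed_levelInterval m l r 1).isOpen_compl _ hl0
  have hJ : Disjoint (Set.Icc (l 0 - ε / 2) (r 0)) (levelInterval m l r 1) := by
    rw [Set.disjoint_left]
    intro x hx
    rcases le_total (l 0) x with hx' | hx'
    · exact Set.disjoint_left.1 h.disjoint_levelInterval ⟨hx', hx.2⟩
    · exact hball (by rw [Metric.mem_ball, Real.dist_eq, abs_lt]; constructor <;> linarith [hx.1])
  have hcardι : Fintype.card (Σ k : Fin (m + 1), Fin (ν k)) = ∑ k ∈ Finset.range (m + 1), ν k := by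
    rw [Fintype.card_sigma, ← Fin.sum_univ_eq_sum_range]
    simp
  have hsum : ∀ (c : (Σ k : Fin (m + 1), Fin (ν k)) → ℝ) (u : ℕ → ℝ → ℝ) (x : ℝ),
      ∑ k ∈ Finset.range (m + 1), (coeffPoly c k).eval x * ((v k).eval x * u k x) =
      ∑ j, c j * (x ^ (j.2 : ℕ) * ((v j.1).eval x * u j.1 x)) := fun c u x ↦
    sum_eval_coeffPoly c (fun k ↦ (v k).eval x * u k x) x
  obtain ⟨c, hc, hcx⟩ := exists_sum_mul_prod_nonneg_of_tendsto
    (φ := fun K j x ↦ x ^ (j.2 : ℕ) * ((v j.1).eval x * discreteChain (X K) (w K) j.1 1 x))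
    (ψ := fun (j : Σ k : Fin (m + 1), Fin (ν k)) x ↦
      x ^ (j.2 : ℕ) * ((v j.1).eval x * chain μ j.1 1 x)) (half_pos hε)
    (fun j x hx ↦ Filter.Tendsto.const_mul _ (Filter.Tendsto.const_mul _
      (hlim j.1 (by omega) x (Set.disjoint_left.1 h.disjoint_levelInterval hx))))
    (fun K c hc W hW hWc h0 ↦ by
      rw [hcardι] at hWc
      have key := (hsys K).exists_sign_of_forall_natDegree_lt
        (p := fun k ↦ coeffPoly c k * v k) (fun q hq hdvd ↦ hB _ _ (hsys K)
          (hcard K) (coeffPoly c) (degree_coeffPoly_lt c) (exists_coeffPoly_ne_zero hc) q hq hdvd)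
        Set.ordConnected_Icc hJ hW hWc (fun z hz ↦ by
          have := h0 z hz
          rw [← hsum c (fun k ↦ discreteChain (X K) (w K) k 1)] at this
          simpa only [eval_mul, mul_assoc] using this)
      obtain ⟨s, hs, hsx⟩ := key
      refine ⟨s, hs, fun x hx ↦ ?_⟩
      have := hsx x hx
      rw [← hsum c (fun k ↦ discreteChain (X K) (w K) k 1)]
      simpa only [eval_mul, mul_assoc] using this)
    hE (by rwa [hcardι])
  refine ⟨coeffPoly c, degree_coeffPoly_lt c, exists_coeffPoly_ne_zero hc, fun x hx ↦ ?_⟩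
  rw [hsum c (fun k ↦ chain μ k 1)]
  exact hcx x hx

theorem PositiveSystem.exists_form_mul_prod_nonneg {m : ℕ} {l r : ℕ → ℝ} {μ : ℕ → Measure ℝ}
    (h : PositiveSystem m l r μ) (n : ℕ → ℕ) {E : Finset ℝ}
    (hE : ∀ z ∈ E, z ∈ Set.Icc (l 0) (r 0)) (hEc : E.card < ∑ k ∈ Finset.range (m + 1), n k) :
    ∃ p : ℕ → ℝ[X], (∀ k, (p k).degree < (n k : WithBot ℕ)) ∧ (∃ k ≤ m, p k ≠ 0) ∧
      ∀ x ∈ Set.Icc (l 0) (r 0), 0 ≤ (∑ k ∈ Finset.range (m + 1),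
        (p k).eval x * chain μ k 1 x) * ∏ z ∈ E, (x - z) := by
  have := h.exists_sum_mul_prod_nonneg (ν := n) (v := fun _ ↦ 1)
    (∑ k ∈ Finset.range (m + 1), n k + m + 2)
    (fun X w hX hcard p hp hne q hq hdvd ↦ hX.natDegree_lt_of_dvd hcard (fun k _ ↦ hp k) hne hq
      (by simpa using hdvd)) hE hEc
  simpa using this

theorem PositiveSystem.exists_form_stepIndex_mul_prod_nonneg {m : ℕ} {l r : ℕ → ℝ}
    {μ : ℕ → Measure ℝ} (h : PositiveSystem m l r μ) {n : ℕ → ℕ} {M : ℕ} (hn0 : n 0 = M)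
    (hn : ∀ k, k ≠ 0 → n k = M + 1) {j : ℕ} (hj : j ≤ m) {ξ : ℝ} (hξ : ξ ∈ Set.Icc (l 0) (r 0))
    {E : Finset ℝ} (hE : ∀ z ∈ E, z ∈ Set.Icc (l 0) (r 0))
    (hEc : E.card < ∑ k ∈ Finset.range (m + 1), n k + 1) :
    ∃ p : ℕ → ℝ[X], (p j).degree < ((n j + 1 : ℕ) : WithBot ℕ) ∧
      (∀ k, k ≠ j → (p k).degree < (n k : WithBot ℕ)) ∧ (∃ k ≤ m, p k ≠ 0) ∧
      ∀ x ∈ Set.Icc (l 0) (r 0), 0 ≤ ((p j).eval x * chain μ j 1 x +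
        (x - ξ) * ∑ k ∈ (Finset.range (m + 1)).erase j, (p k).eval x * chain μ k 1 x) *
          ∏ z ∈ E, (x - z) := by
  have hjm : j ∈ Finset.range (m + 1) := Finset.mem_range.2 (by omega)
  set ν : ℕ → ℕ := fun k ↦ if k = j then n j + 1 else n k with hν
  have hνsum : ∑ k ∈ Finset.range (m + 1), ν k = ∑ k ∈ Finset.range (m + 1), n k + 1 := by
    rw [← Finset.add_sum_erase _ ν hjm, ← Finset.add_sum_erase _ n hjm,
      Finset.sum_congr rfl (fun k hk ↦ if_neg (Finset.ne_of_mem_erase hk) :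
        ∀ k ∈ (Finset.range (m + 1)).erase j, ν k = n k)]
    simp only [hν, if_pos]
    ring
  have hξ1 : ξ ∉ levelInterval m l r 1 := Set.disjoint_left.1 h.disjoint_levelInterval hξ
  obtain ⟨p, hp, hne, hpx⟩ := h.exists_sum_mul_prod_nonneg (ν := ν)
    (v := fun k ↦ if k = j then 1 else Polynomial.X - C ξ)
    (∑ k ∈ Finset.range (m + 1), n k + m + 2)
    (fun X w hX hcard p hp hne q hq hdvd ↦ by
      rw [hνsum]
      refine hX.natDegree_lt_of_dvd_stepIndex hn0 hn hcard hj hξ1 (p := p) ?_ ?_ hne hq ?_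
      · simpa [hν] using hp j
      · intro k _ hkj
        simpa [hν, hkj] using hp k
      · rw [← Finset.add_sum_erase _ _ hjm] at hdvd
        simp only [if_pos, mul_one] at hdvd
        rw [Finset.mul_sum]
        convert hdvd using 2
        refine Finset.sum_congr rfl fun k hk ↦ ?_
        rw [if_neg (Finset.ne_of_mem_erase hk)]
        ring) hE (by rwa [hνsum])
  refine ⟨p, by simpa [hν] using hp j, fun k hkj ↦ by simpa [hν, hkj] using hp k, hne, fun x hx ↦ ?_⟩
  have := hpx x hx
  rw [← Finset.add_sum_erase _ _ hjm] at this
  simp only [if_pos, eval_one, one_mul] at this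
  rw [Finset.mul_sum]
  refine this.trans_eq ?_
  congr 2
  refine Finset.sum_congr rfl fun k hk ↦ ?_
  rw [if_neg (Finset.ne_of_mem_erase hk), eval_sub, eval_X, eval_C]
  ring

/-! ### Expansion of Cauchy transforms at infinity -/

theorem isBigO_integral_div {μ : Measure ℝ} [IsFiniteMeasure μ] {l r : ℝ}
    (hμ : μ (Set.Icc l r)ᶜ = 0) {G : ℝ → ℂ} (hG : ContinuousOn G (Set.Icc l r)) :
    (fun z : ℂ ↦ ∫ y, G y / (z - y) ∂μ) =O[Bornology.cobounded ℂ] fun z : ℂ ↦ 1 / z := by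
  obtain ⟨M, hM⟩ := isCompact_Icc.exists_bound_of_continuousOn hG
  obtain ⟨R, hR⟩ := (isCompact_Icc (a := l) (b := r)).exists_bound_of_continuousOn continuousOn_id
  have hae : ∀ᵐ t ∂μ, t ∈ Set.Icc l r := mem_ae_iff.2 hμ
  refine Asymptotics.IsBigO.of_bound (2 * |M| * μ.real Set.univ) ?_
  have hev : ∀ᶠ z : ℂ in Bornology.cobounded ℂ, 2 * |R| + 1 ≤ ‖z‖ :=
    tendsto_norm_cobounded_atTop.eventually_ge_atTop _
  filter_upwards [hev] with z hz
  have hz0 : 0 < ‖z‖ := by linarith [abs_nonneg R]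
  have hb : ∀ᵐ y ∂μ, ‖G y / (z - y)‖ ≤ 2 * |M| / ‖z‖ := hae.mono fun y hy ↦ by
    have h1 : ‖(y : ℂ)‖ ≤ |R| := by
      rw [Complex.norm_real]
      exact (hR y hy).trans (le_abs_self R)
    have h2 : ‖z‖ / 2 ≤ ‖z - y‖ := by
      have := norm_sub_norm_le z (y : ℂ)
      linarith
    rw [norm_div, div_le_div_iff₀ (by linarith) hz0]
    have h3 := (hM y hy).trans (le_abs_self M)
    nlinarith [norm_nonneg (G y), abs_nonneg M]
  refine (norm_integral_le_of_norm_le_const hb).trans_eq ?_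
  rw [norm_div, norm_one]
  ring

theorem eq_zero_of_tendsto_eval {f : Filter ℂ} [f.NeBot] (hf : f ≤ Bornology.cobounded ℂ) {A : ℂ[X]}
    (hA : Filter.Tendsto (fun z ↦ A.eval z) f (nhds 0)) : A = 0 := by
  rcases le_or_gt A.degree 0 with h | h
  · rw [eq_C_of_degree_le_zero h] at hA ⊢
    simp only [eval_C] at hA
    rw [tendsto_nhds_unique tendsto_const_nhds hA, C_0]
  · have h1 := A.tendsto_norm_atTop h (tendsto_norm_cobounded_atTop.mono_left hf)
    exact absurd hA.norm (not_tendsto_nhds_of_tendsto_atTop h1 _)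

theorem one_div_sub_eq_sum (n : ℕ) {z y : ℂ} (hzy : z - y ≠ 0) :
    z ^ n * (1 / (z - y)) = ∑ j ∈ Finset.range n, z ^ (n - 1 - j) * y ^ j + y ^ n / (z - y) := by
  have h := (Commute.all y z).geom_sum₂_mul n
  have e : ∑ j ∈ Finset.range n, z ^ (n - 1 - j) * y ^ j =
      ∑ i ∈ Finset.range n, y ^ i * z ^ (n - 1 - i) := Finset.sum_congr rfl fun _ _ ↦ mul_comm _ _
  rw [e]
  field_simp
  linear_combination h

theorem pow_mul_integral_div {μ : Measure ℝ} [IsFiniteMeasure μ] {l r : ℝ}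
    (hμ : μ (Set.Icc l r)ᶜ = 0) {G : ℝ → ℂ} (hG : ContinuousOn G (Set.Icc l r)) (n : ℕ) {z : ℂ}
    (hz : z ∉ Complex.ofReal '' Set.Icc l r) :
    z ^ n * ∫ y, G y / (z - y) ∂μ =
      ∑ j ∈ Finset.range n, z ^ (n - 1 - j) * ∫ y, (y : ℂ) ^ j * G y ∂μ +
        ∫ y, (y : ℂ) ^ n * G y / (z - y) ∂μ := by
  have hae : ∀ᵐ t ∂μ, t ∈ Set.Icc l r := mem_ae_iff.2 hμ
  have hne : ∀ y ∈ Set.Icc l r, z - (y : ℂ) ≠ 0 := fun y hy h0 ↦ hz ⟨y, hy, (sub_eq_zero.1 h0).symm⟩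
  have hi : ∀ j : ℕ, Integrable (fun y : ℝ ↦ (y : ℂ) ^ j * G y) μ := fun j ↦
    integrable_of_continuousOn_Icc hμ (ContinuousOn.mul (by fun_prop) hG)
  have hi' : Integrable (fun y : ℝ ↦ (y : ℂ) ^ n * G y / (z - y)) μ :=
    integrable_of_continuousOn_Icc hμ ((ContinuousOn.mul (by fun_prop) hG).div (by fun_prop) hne)
  simp only [← integral_const_mul]
  rw [← integral_finsetSum _ fun j _ ↦ (hi j).const_mul _, ← integral_add
    (integrable_finsetSum _ fun j _ ↦ (hi j).const_mul _) hi']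
  refine integral_congr_ae (hae.mono fun y hy ↦ ?_)
  simp only
  have := one_div_sub_eq_sum n (hne y hy)
  calc z ^ n * (G y / (z - y)) = (z ^ n * (1 / (z - y))) * G y := by ring
    _ = _ := by
      rw [this, add_mul, Finset.sum_mul]
      congr 1
      · exact Finset.sum_congr rfl fun _ _ ↦ by ring
      · ring

theorem eventually_notMem_image_Icc (l r : ℝ) :
    ∀ᶠ z : ℂ in Bornology.cobounded ℂ, z ≠ 0 ∧ z ∉ Complex.ofReal '' Set.Icc l r := by
  have hc : Bornology.IsBounded (Complex.ofReal '' Set.Icc l r) :=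
    (isCompact_Icc.image Complex.continuous_ofReal).isBounded
  have h1 : (Complex.ofReal '' Set.Icc l r)ᶜ ∈ Bornology.cobounded ℂ :=
    Bornology.isBounded_def.1 hc
  have h2 : ({0} : Set ℂ)ᶜ ∈ Bornology.cobounded ℂ :=
    Bornology.isBounded_def.1 Bornology.isBounded_singleton
  filter_upwards [h1, h2] with z h1 h2
  exact ⟨h2, h1⟩

/-- After multiplication by `z ^ n` the first `n` moments become coefficients of a polynomial `A`
that tends to zero along `f`, hence `A = 0`. The multiple of `T` occupies the degrees from `n` on
and the moments those below, so both vanish. The filter is left general in order to cover the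
approach to infinity along a ray. -/
theorem eq_zero_of_isBigO_add_integral_div {μ : Measure ℝ} [IsFiniteMeasure μ] {l r : ℝ}
    (hμ : μ (Set.Icc l r)ᶜ = 0) {G : ℝ → ℂ} (hG : ContinuousOn G (Set.Icc l r)) {f : Filter ℂ}
    [f.NeBot] (hf : f ≤ Bornology.cobounded ℂ) {T : ℂ[X]} {n : ℕ}
    (hO : (fun z : ℂ ↦ T.eval z + ∫ y, G y / (z - y) ∂μ) =O[f] fun z : ℂ ↦ (1 / z ^ (n + 1) : ℂ)) :
    T = 0 ∧ ∀ j < n, ∫ y, (y : ℂ) ^ j * G y ∂μ = 0 := by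
  set M : ℕ → ℂ := fun j ↦ ∫ y, (y : ℂ) ^ j * G y ∂μ with hM
  set A : ℂ[X] := T * Polynomial.X ^ n +
    ∑ j ∈ Finset.range n, C (M j) * Polynomial.X ^ (n - 1 - j) with hA
  have hinv : Filter.Tendsto (fun z : ℂ ↦ 1 / z) (Bornology.cobounded ℂ) (nhds 0) := by
    simpa using Filter.tendsto_inv₀_cobounded (α := ℂ)
  have hAeq : ∀ᶠ z in f, A.eval z = z ^ n * (T.eval z + ∫ y, G y / (z - y) ∂μ) -
      ∫ y, (y : ℂ) ^ n * G y / (z - y) ∂μ := by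
    filter_upwards [hf (eventually_notMem_image_Icc l r)] with z hz
    rw [mul_add, pow_mul_integral_div hμ hG n hz.2, hA]
    simp only [eval_add, eval_mul, eval_pow, eval_X, eval_finsetSum, eval_C]
    rw [Finset.sum_congr rfl fun j _ ↦ mul_comm (M j) (z ^ (n - 1 - j))]
    ring
  have hA0 : A = 0 := by
    refine eq_zero_of_tendsto_eval hf (Filter.Tendsto.congr' (hAeq.mono fun z hz ↦ hz.symm) ?_)
    have t1 : Filter.Tendsto (fun z : ℂ ↦ z ^ n * (T.eval z + ∫ y, G y / (z - y) ∂μ)) f (nhds 0) := by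
      have h1 := (Asymptotics.isBigO_refl (fun z : ℂ ↦ z ^ n) f).mul hO
      refine Asymptotics.IsBigO.trans_tendsto (h1.congr' Filter.EventuallyEq.rfl
        (g₂ := fun z ↦ 1 / z) ?_) (hinv.mono_left hf)
      filter_upwards [hf (eventually_notMem_image_Icc l r)] with z hz
      have := hz.1
      field_simp
      ring
    have t2 : Filter.Tendsto (fun z : ℂ ↦ ∫ y, (y : ℂ) ^ n * G y / (z - y) ∂μ) f (nhds 0) :=
      ((isBigO_integral_div hμ (ContinuousOn.mul (by fun_prop) hG)).trans_tendsto hinv).mono_left hf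
    simpa using t1.sub t2
  have hMz : ∀ j < n, M j = 0 := fun j hj ↦ by
    have h1 := congrArg (fun p ↦ coeff p (n - 1 - j)) hA0
    simp only [hA, coeff_add, coeff_mul_X_pow', finsetSum_coeff, coeff_C, coeff_zero] at h1
    rw [if_neg (by omega), Finset.sum_eq_single_of_mem j (Finset.mem_range.2 hj)
      (fun i hi hij ↦ by
        have := Finset.mem_range.1 hi
        split_ifs
        · omega
        all_goals rfl)] at h1
    simpa using h1
  refine ⟨?_, hMz⟩
  rw [hA, Finset.sum_eq_zero fun j hj ↦ by rw [hMz j (Finset.mem_range.1 hj), C_0, zero_mul],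
    add_zero] at hA0
  exact (mul_eq_zero.1 hA0).resolve_right (pow_ne_zero _ X_ne_zero)

theorem isBigO_integral_div_of_moments {μ : Measure ℝ} [IsFiniteMeasure μ] {l r : ℝ}
    (hμ : μ (Set.Icc l r)ᶜ = 0) {G : ℝ → ℂ} (hG : ContinuousOn G (Set.Icc l r)) {n : ℕ}
    (hM : ∀ j < n, ∫ y, (y : ℂ) ^ j * G y ∂μ = 0) :
    (fun z : ℂ ↦ ∫ y, G y / (z - y) ∂μ) =O[Bornology.cobounded ℂ]
      fun z : ℂ ↦ (1 / z ^ (n + 1) : ℂ) := by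
  have h1 := (Asymptotics.isBigO_refl (fun z : ℂ ↦ 1 / z ^ n) (Bornology.cobounded ℂ)).mul
    (isBigO_integral_div hμ (G := fun y ↦ (y : ℂ) ^ n * G y) (ContinuousOn.mul (by fun_prop) hG))
  refine h1.congr' ?_ (Filter.Eventually.of_forall fun z ↦ by simp only; ring)
  filter_upwards [eventually_notMem_image_Icc l r] with z hz
  have h2 := pow_mul_integral_div hμ hG n hz.2
  rw [Finset.sum_eq_zero fun j hj ↦ by rw [hM j (Finset.mem_range.1 hj), mul_zero], zero_add] at h2
  rw [← h2]
  have := hz.1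
  field_simp

/-- The polynomial `z ↦ ∫ (Q z - Q y) / (z - y) dμ y` in terms of the moments `M` of `μ`. -/
def quotientPoly (M : ℕ → ℂ) (Q : ℂ[X]) : ℂ[X] :=
  ∑ n ∈ Q.support, ∑ i ∈ Finset.range n, C (Q.coeff n * M (n - 1 - i)) * Polynomial.X ^ i

theorem divByMonic_X_sub_C_eq_sum (Q : ℂ[X]) (z : ℂ) : Q /ₘ (Polynomial.X - C z) =
    ∑ n ∈ Q.support, ∑ i ∈ Finset.range n,
      C (Q.coeff n * z ^ i) * Polynomial.X ^ (n - 1 - i) := by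
  refine mul_left_cancel₀ (X_sub_C_ne_zero z) ?_
  rw [X_sub_C_mul_divByMonic_eq_sub_modByMonic, modByMonic_X_sub_C_eq_C_eval]
  conv_lhs => rw [eval_eq_sum, Polynomial.sum, map_sum]
  nth_rewrite 1 [Q.as_sum_support_C_mul_X_pow]
  rw [← Finset.sum_sub_distrib, Finset.mul_sum]
  refine Finset.sum_congr rfl fun n _ ↦ ?_
  have h := (Commute.all (C z) (Polynomial.X : ℂ[X])).geom_sum₂_mul n
  have e : ∑ i ∈ Finset.range n, C (Q.coeff n * z ^ i) * Polynomial.X ^ (n - 1 - i) =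
      C (Q.coeff n) * ∑ i ∈ Finset.range n, C z ^ i * Polynomial.X ^ (n - 1 - i) := by
    rw [Finset.mul_sum]
    exact Finset.sum_congr rfl fun i _ ↦ by rw [C_mul, C_pow, mul_assoc]
  rw [e, C_mul, C_pow]
  linear_combination (C (Q.coeff n)) * h

/-- The value of `Q /ₘ (X - C z)` at `y` is the divided difference of `Q`. In this form the identity
holds for every `z`, in particular at the nodes inside the interval. -/
theorem eval_quotientPoly {μ : Measure ℝ} [IsFiniteMeasure μ] {l r : ℝ}
    (hμ : μ (Set.Icc l r)ᶜ = 0) {G : ℝ → ℂ} (hG : ContinuousOn G (Set.Icc l r)) (Q : ℂ[X]) (z : ℂ) :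
    (quotientPoly (fun j ↦ ∫ y, (y : ℂ) ^ j * G y ∂μ) Q).eval z =
      ∫ y, (Q /ₘ (Polynomial.X - C z)).eval (y : ℂ) * G y ∂μ := by
  have hi : ∀ (c : ℂ) (j : ℕ), Integrable (fun y : ℝ ↦ c * ((y : ℂ) ^ j * G y)) μ := fun c j ↦
    (integrable_of_continuousOn_Icc hμ (ContinuousOn.mul (by fun_prop) hG)).const_mul c
  have e : ∀ y : ℝ, (Q /ₘ (Polynomial.X - C z)).eval (y : ℂ) * G y = ∑ n ∈ Q.support,
      ∑ i ∈ Finset.range n, (Q.coeff n * z ^ i) * ((y : ℂ) ^ (n - 1 - i) * G y) := fun y ↦ by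
    rw [divByMonic_X_sub_C_eq_sum]
    simp only [eval_finsetSum, eval_mul, eval_C, eval_pow, eval_X, Finset.sum_mul, mul_assoc]
  simp only [e]
  rw [integral_finsetSum _ fun n _ ↦ integrable_finsetSum _ fun i _ ↦ hi _ _, quotientPoly,
    eval_finsetSum]
  refine Finset.sum_congr rfl fun n _ ↦ ?_
  rw [integral_finsetSum _ fun i _ ↦ hi _ _, eval_finsetSum]
  refine Finset.sum_congr rfl fun i _ ↦ ?_
  rw [integral_const_mul]
  simp only [eval_mul, eval_C, eval_pow, eval_X]
  ring

theorem eval_mul_integral_div {μ : Measure ℝ} [IsFiniteMeasure μ] {l r : ℝ}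
    (hμ : μ (Set.Icc l r)ᶜ = 0) {G : ℝ → ℂ} (hG : ContinuousOn G (Set.Icc l r)) (Q : ℂ[X]) {z : ℂ}
    (hz : z ∉ Complex.ofReal '' Set.Icc l r) :
    Q.eval z * ∫ y, G y / (z - y) ∂μ =
      (quotientPoly (fun j ↦ ∫ y, (y : ℂ) ^ j * G y ∂μ) Q).eval z +
        ∫ y, Q.eval (y : ℂ) * G y / (z - y) ∂μ := by
  have hae : ∀ᵐ t ∂μ, t ∈ Set.Icc l r := mem_ae_iff.2 hμ
  have hne : ∀ y ∈ Set.Icc l r, z - (y : ℂ) ≠ 0 := fun y hy h0 ↦ hz ⟨y, hy, (sub_eq_zero.1 h0).symm⟩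
  have hc : ∀ A : ℂ[X], Continuous fun y : ℝ ↦ A.eval (y : ℂ) := fun A ↦
    A.continuous.comp Complex.continuous_ofReal
  have h1 : ∀ A : ℂ[X], Integrable (fun y : ℝ ↦ A.eval (y : ℂ) * G y) μ := fun A ↦
    integrable_of_continuousOn_Icc hμ ((hc A).continuousOn.mul hG)
  have h2 : Integrable (fun y : ℝ ↦ Q.eval (y : ℂ) * G y / (z - y)) μ :=
    integrable_of_continuousOn_Icc hμ (((hc Q).continuousOn.mul hG).div (by fun_prop) hne)
  rw [eval_quotientPoly hμ hG, ← integral_const_mul, ← integral_add (h1 _) h2]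
  refine integral_congr_ae (hae.mono fun y hy ↦ ?_)
  simp only
  have h1 := congrArg (fun p ↦ eval (y : ℂ) p)
    (X_sub_C_mul_divByMonic_eq_sub_modByMonic Q z)
  simp only [modByMonic_X_sub_C_eq_C_eval, eval_mul, eval_sub, eval_X, eval_C] at h1
  have h2 := hne y hy
  field_simp
  linear_combination (G y) * h1

/-! ### Independence of the iterated Cauchy transforms over the polynomials -/

theorem support_subset_Icc {μ : Measure ℝ} {l r : ℝ} (hμ : μ (Set.Icc l r)ᶜ = 0) :
    μ.support ⊆ Set.Icc l r :=
  Measure.support_subset_of_isClosed isClosed_Icc (mem_ae_iff.2 hμ)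

theorem eq_zero_of_mem_support {μ : Measure ℝ} [IsFiniteMeasure μ] {l r : ℝ}
    (hμ : μ (Set.Icc l r)ᶜ = 0) {f : ℝ → ℝ} (hf : ContinuousOn f (Set.Icc l r))
    (h0 : ∀ x ∈ Set.Icc l r, 0 ≤ f x) (hInt : ∫ x, f x ∂μ = 0) {x : ℝ} (hx : x ∈ μ.support) :
    f x = 0 := by
  have hae : ∀ᵐ t ∂μ, t ∈ Set.Icc l r := mem_ae_iff.2 hμ
  have hz := (integral_eq_zero_iff_of_nonneg_ae (hae.mono fun t ht ↦ h0 t ht)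
    (integrable_of_continuousOn_Icc hμ hf)).1 hInt
  have hxI := support_subset_Icc hμ hx
  by_contra hne
  have hev : ∀ᶠ t in nhdsWithin x (Set.Icc l r), f t ≠ 0 := (hf x hxI).eventually_ne hne
  have h1 : {t | t ∈ Set.Icc l r → f t ≠ 0} ∈ nhds x := by
    rw [eventually_nhdsWithin_iff] at hev
    exact hev
  have h2 := (Measure.mem_support_iff_forall x).1 hx _ h1
  refine h2.ne' (measure_mono_null (t := {t | f t ≠ 0} ∪ (Set.Icc l r)ᶜ) (fun t ht ↦ ?_)
    (measure_union_null (ae_iff.1 hz) hμ))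
  by_cases htI : t ∈ Set.Icc l r
  · exact Or.inl (ht htI)
  · exact Or.inr htI

theorem integral_eval_mul_eq_zero {μ : Measure ℝ} [IsFiniteMeasure μ] {l r : ℝ}
    (hμ : μ (Set.Icc l r)ᶜ = 0) {G : ℝ → ℝ} (hG : ContinuousOn G (Set.Icc l r)) {n : ℕ}
    (hM : ∀ j < n, ∫ y, y ^ j * G y ∂μ = 0) {p : ℝ[X]} (hp : p.degree < (n : WithBot ℕ)) :
    ∫ y, p.eval y * G y ∂μ = 0 := by
  have hi : ∀ j : ℕ, Integrable (fun y : ℝ ↦ y ^ j * G y) μ := fun j ↦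
    integrable_of_continuousOn_Icc hμ (ContinuousOn.mul (by fun_prop) hG)
  have e : ∀ y, p.eval y * G y = ∑ i ∈ p.support, p.coeff i * (y ^ i * G y) := fun y ↦ by
    rw [eval_eq_sum, Polynomial.sum, Finset.sum_mul]
    exact Finset.sum_congr rfl fun _ _ ↦ by ring
  simp only [e]
  rw [integral_finsetSum _ fun i _ ↦ (hi i).const_mul _]
  refine Finset.sum_eq_zero fun i hi' ↦ ?_
  have : i < n := by exact_mod_cast (le_degree_of_mem_supp i hi').trans_lt hp
  rw [integral_const_mul, hM i this, mul_zero]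

/-- Weierstrass approximation of `G` by polynomials yields `∫ G² = 0`. -/
theorem eq_zero_on_support_of_moments {μ : Measure ℝ} [IsFiniteMeasure μ] {l r : ℝ}
    (hμ : μ (Set.Icc l r)ᶜ = 0) {G : ℝ → ℝ} (hG : ContinuousOn G (Set.Icc l r))
    (hM : ∀ j : ℕ, ∫ y, y ^ j * G y ∂μ = 0) {x : ℝ} (hx : x ∈ μ.support) : G x = 0 := by
  have hpoly : ∀ p : ℝ[X], ∫ y, p.eval y * G y ∂μ = 0 := fun p ↦
    integral_eval_mul_eq_zero hμ hG (n := p.natDegree + 1) (fun j _ ↦ hM j)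
      (degree_le_natDegree.trans_lt (by exact_mod_cast Nat.lt_succ_self _))
  have hae : ∀ᵐ t ∂μ, t ∈ Set.Icc l r := mem_ae_iff.2 hμ
  obtain ⟨M, hMb⟩ := isCompact_Icc.exists_bound_of_continuousOn hG
  have hsq : ∫ y, G y * G y ∂μ = 0 := by
    refine le_antisymm (le_of_forall_pos_le_add fun ε hε ↦ ?_) (integral_nonneg fun y ↦ mul_self_nonneg _)
    obtain ⟨p, hp⟩ := exists_polynomial_near_of_continuousOn l r G hG
      (ε / ((|M| + 1) * (μ.real Set.univ + 1))) (by positivity)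
    have e : ∫ y, G y * G y ∂μ = ∫ y, (G y - p.eval y) * G y ∂μ := by
      have h1 : Integrable (fun y ↦ G y * G y) μ := integrable_of_continuousOn_Icc hμ (hG.mul hG)
      have h2 : Integrable (fun y ↦ p.eval y * G y) μ :=
        integrable_of_continuousOn_Icc hμ (p.continuous.continuousOn.mul hG)
      simp only [sub_mul]
      rw [integral_sub h1 h2, hpoly p, sub_zero]
    have hb : ∀ᵐ y ∂μ, ‖(G y - p.eval y) * G y‖ ≤
        ε / ((|M| + 1) * (μ.real Set.univ + 1)) * (|M| + 1) := hae.mono fun y hy ↦ by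
      rw [norm_mul, Real.norm_eq_abs, abs_sub_comm]
      exact mul_le_mul (hp y hy).le (((hMb y hy).trans (le_abs_self M)).trans (by linarith))
        (norm_nonneg _) (by positivity)
    have h3 := norm_integral_le_of_norm_le_const hb
    rw [e, zero_add]
    refine (le_abs_self _).trans (h3.trans ?_)
    have hμ0 : (0 : ℝ) ≤ μ.real Set.univ := measureReal_nonneg
    calc ε / ((|M| + 1) * (μ.real Set.univ + 1)) * (|M| + 1) * μ.real Set.univ
        ≤ ε / ((|M| + 1) * (μ.real Set.univ + 1)) * (|M| + 1) * (μ.real Set.univ + 1) := by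
          gcongr; linarith
      _ = ε := by field_simp
  exact mul_self_eq_zero.1
    (eq_zero_of_mem_support hμ (hG.mul hG) (fun y _ ↦ mul_self_nonneg _) hsq hx)

theorem eval_map_ofReal (p : ℝ[X]) (x : ℝ) :
    (p.map Complex.ofRealHom).eval (x : ℂ) = ((p.eval x : ℝ) : ℂ) := by
  rw [eval_map]
  exact eval₂_at_apply Complex.ofRealHom x

/-- The left-hand side of `h0` is the restriction of a function holomorphic on a half-plane that
contains `[l', r']` and misses `[l, r]`. It vanishes at infinitely many points of a compact set,
hence identically. Along the real ray of the half-plane to infinity, the expansion then annihilates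
all moments of `∑ p_k c_k`. -/
theorem sum_mul_eq_zero_on_support {μ : Measure ℝ} [IsFiniteMeasure μ] {l r l' r' : ℝ}
    (hμ : μ (Set.Icc l r)ᶜ = 0) {s e : ℝ} (hs : s ≠ 0) (hsl : ∀ y ∈ Set.Icc l r, s * y ≤ e)
    (hsl' : ∀ x ∈ Set.Icc l' r', e < s * x) {d : ℕ} {c : ℕ → ℝ → ℝ}
    (hc : ∀ k < d, ContinuousOn (c k) (Set.Icc l r)) {q : ℝ[X]} {p : ℕ → ℝ[X]}
    {S : Set ℝ} (hS : S ⊆ Set.Icc l' r') (hSinf : S.Infinite)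
    (h0 : ∀ x ∈ S, q.eval x + ∑ k ∈ Finset.range d, (p k).eval x * ∫ y, c k y / (x - y) ∂μ = 0)
    {y : ℝ} (hy : y ∈ μ.support) : ∑ k ∈ Finset.range d, (p k).eval y * c k y = 0 := by
  set U : Set ℂ := {z | e < s * z.re} with hU
  have hUo : IsOpen U := isOpen_lt continuous_const (by fun_prop)
  have hUc : IsPreconnected U :=
    (convex_halfSpace_gt (f := fun z : ℂ ↦ s * z.re)
      ⟨fun x y ↦ by simp [mul_add], fun t x ↦ by simp; ring⟩ e).isPreconnected
  have hUI : U ⊆ (Complex.ofReal '' Set.Icc l r)ᶜ := by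
    rintro _ hz ⟨y, hy, rfl⟩
    exact absurd (hsl y hy) (not_le.2 hz)
  have hcC : ∀ k < d, ContinuousOn (fun y ↦ (c k y : ℂ)) (Set.Icc l r) := fun k hk ↦
    Complex.continuous_ofReal.comp_continuousOn (hc k hk)
  set F : ℂ → ℂ := fun z ↦ (q.map Complex.ofRealHom).eval z +
    ∑ k ∈ Finset.range d, ((p k).map Complex.ofRealHom).eval z * ∫ y, (c k y : ℂ) / (z - y) ∂μ with hF
  have hFd : DifferentiableOn ℂ F U := by
    refine (Polynomial.differentiable _).differentiableOn.add (DifferentiableOn.fun_sum fun k hk ↦ ?_)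
    exact (Polynomial.differentiable _).differentiableOn.mul
      ((differentiableOn_integral_div hμ (hcC k (Finset.mem_range.1 hk))).mono hUI)
  have hFx : ∀ x : ℝ, F x = ((q.eval x + ∑ k ∈ Finset.range d,
      (p k).eval x * ∫ y, c k y / (x - y) ∂μ : ℝ) : ℂ) := fun x ↦ by
    simp only [hF, eval_map_ofReal, ← ofReal_integral_div]
    push_cast
    rfl
  obtain ⟨x₀, hx₀, hacc⟩ := hSinf.exists_accPt_of_subset_isCompact isCompact_Icc hS
  rw [accPt_iff_frequently_nhdsNE] at hacc
  have hF0 : Set.EqOn F 0 U := by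
    refine (hFd.analyticOnNhd hUo).eqOn_zero_of_preconnected_of_frequently_eq_zero hUc
      (z₀ := (x₀ : ℂ)) (hsl' x₀ hx₀) ?_
    have ht : Filter.Tendsto Complex.ofReal (nhdsWithin x₀ {x₀}ᶜ) (nhdsWithin (x₀ : ℂ) {(x₀ : ℂ)}ᶜ) :=
      tendsto_nhdsWithin_iff.2 ⟨(Complex.continuous_ofReal.tendsto x₀).mono_left nhdsWithin_le_nhds,
        eventually_nhdsWithin_of_forall fun x hx h ↦ hx (Complex.ofReal_injective h)⟩
    refine ht.frequently (hacc.mono fun x hx ↦ ?_)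
    rw [hFx, h0 x hx, Complex.ofReal_zero]
  set f : Filter ℂ := Filter.map (fun t : ℝ ↦ ((s * t : ℝ) : ℂ)) Filter.atTop with hf
  have hfc : f ≤ Bornology.cobounded ℂ := by
    refine tendsto_norm_atTop_iff_cobounded.1 ?_
    simp only [Complex.norm_real, norm_mul, Real.norm_eq_abs]
    exact Filter.tendsto_abs_atTop_atTop.const_mul_atTop (abs_pos.2 hs)
  have hfU : ∀ᶠ z in f, z ∈ U := by
    rw [hf, Filter.eventually_map]
    have : Filter.Tendsto (fun t : ℝ ↦ s * s * t) Filter.atTop Filter.atTop :=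
      Filter.tendsto_id.const_mul_atTop (mul_self_pos.2 hs)
    filter_upwards [this.eventually_gt_atTop e] with t ht
    simpa only [hU, Set.mem_ofPred_eq, Complex.ofReal_re, ← mul_assoc] using ht
  set G : ℝ → ℝ := fun y ↦ ∑ k ∈ Finset.range d, (p k).eval y * c k y with hG
  have hGc : ContinuousOn G (Set.Icc l r) := continuousOn_finsetSum _ fun k hk ↦
    (p k).continuous.continuousOn.mul (hc k (Finset.mem_range.1 hk))
  set T : ℂ[X] := q.map Complex.ofRealHom + ∑ k ∈ Finset.range d,
    quotientPoly (fun j ↦ ∫ y, (y : ℂ) ^ j * (c k y : ℂ) ∂μ) ((p k).map Complex.ofRealHom) with hT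
  have hFT : ∀ z ∈ U, F z = T.eval z + ∫ y, (G y : ℂ) / (z - y) ∂μ := fun z hz ↦ by
    have hne : ∀ y ∈ Set.Icc l r, z - (y : ℂ) ≠ 0 := fun y hy h0 ↦
      hUI hz ⟨y, hy, (sub_eq_zero.1 h0).symm⟩
    have hi : ∀ k ∈ Finset.range d, Integrable
        (fun y : ℝ ↦ ((p k).map Complex.ofRealHom).eval (y : ℂ) * (c k y : ℂ) / (z - y)) μ :=
      fun k hk ↦ integrable_of_continuousOn_Icc hμ
        (((((p k).map Complex.ofRealHom).continuous.comp Complex.continuous_ofReal).continuousOn.mul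
          (hcC k (Finset.mem_range.1 hk))).div (by fun_prop) hne)
    have e1 : ∫ y, (G y : ℂ) / (z - y) ∂μ = ∑ k ∈ Finset.range d,
        ∫ y : ℝ, ((p k).map Complex.ofRealHom).eval (y : ℂ) * (c k y : ℂ) / (z - y) ∂μ := by
      rw [← integral_finsetSum _ hi]
      refine integral_congr_ae (Filter.Eventually.of_forall fun y ↦ ?_)
      simp only [hG, eval_map_ofReal]
      push_cast
      rw [Finset.sum_div]
    rw [e1, hT, eval_add, eval_finsetSum, add_assoc, ← Finset.sum_add_distrib]
    simp only [hF]
    congr 1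
    exact Finset.sum_congr rfl fun k hk ↦
      eval_mul_integral_div hμ (hcC k (Finset.mem_range.1 hk)) _ (hUI hz)
  refine eq_zero_on_support_of_moments hμ hGc (fun j ↦ ?_) hy
  have h1 := (eq_zero_of_isBigO_add_integral_div hμ (G := fun y ↦ (G y : ℂ))
    (Complex.continuous_ofReal.comp_continuousOn hGc) hfc (T := T) (n := j + 1) (by
      refine (Asymptotics.isBigO_zero _ _).congr' (f₁ := fun _ ↦ (0 : ℂ)) ?_ Filter.EventuallyEq.rfl
      filter_upwards [hfU] with z hz
      rw [← hFT z hz]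
      exact (hF0 hz).symm)).2 j (Nat.lt_succ_self j)
  have h2 : ((∫ y, y ^ j * G y ∂μ : ℝ) : ℂ) = 0 := by
    rw [← h1, ← integral_complex_ofReal]
    refine integral_congr_ae (Filter.Eventually.of_forall fun y ↦ ?_)
    push_cast
    rfl
  exact_mod_cast h2

theorem exists_separating_of_disjoint_Icc {l r l' r' : ℝ} (h : l ≤ r) (h' : l' ≤ r')
    (hd : Disjoint (Set.Icc l' r') (Set.Icc l r)) : ∃ s e : ℝ, s ≠ 0 ∧
      (∀ y ∈ Set.Icc l r, s * y ≤ e) ∧ ∀ x ∈ Set.Icc l' r', e < s * x := by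
  rcases lt_or_ge r l' with hlt | hge
  · exact ⟨1, r, one_ne_zero, fun y hy ↦ by linarith [hy.2], fun x hx ↦ by linarith [hx.1]⟩
  · have hlt : r' < l := by
      by_contra! hle
      exact Set.disjoint_left.1 hd (show max l l' ∈ _ from ⟨le_max_right _ _, max_le hle h'⟩)
        ⟨le_max_left _ _, max_le h hge⟩
    exact ⟨-1, -l, by norm_num, fun y hy ↦ by linarith [hy.1], fun x hx ↦ by linarith [hx.2]⟩

/-- The term `k = 0` is a polynomial and the others are Cauchy transforms over level `a + 1`. The
preceding lemma yields a relation with one term fewer on the support of that level, and finally `p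
0` has infinitely many roots. -/
theorem PositiveSystem.eq_zero_of_sum_chain_eq_zero {m : ℕ} {l r : ℕ → ℝ} {μ : ℕ → Measure ℝ}
    (h : PositiveSystem m l r μ) (d : ℕ) : ∀ a, a + d ≤ m → ∀ p : ℕ → ℝ[X], ∀ S ⊆ Set.Icc (l a) (r a),
    S.Infinite → (∀ x ∈ S, ∑ k ∈ Finset.range (d + 1), (p k).eval x * chain μ k (a + 1) x = 0) →
    ∀ k ≤ d, p k = 0 := by
  induction d with
  | zero =>
    intro a ha p S hS hinf h0 k hk
    obtain rfl : k = 0 := by omega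
    refine eq_zero_of_infinite_isRoot _ (hinf.mono fun x hx ↦ ?_)
    simpa [chain] using h0 x hx
  | succ d ih =>
    intro a ha p S hS hinf h0
    have := h.finite (a + 1)
    obtain ⟨s, e, hs, hsl, hsl'⟩ := exists_separating_of_disjoint_Icc (h.lt (a + 1) (by omega)).le
      (h.lt a (by omega)).le (h.disjoint a (by omega))
    have h1 : ∀ y ∈ (μ (a + 1)).support,
        ∑ k ∈ Finset.range (d + 1), (p (k + 1)).eval y * chain μ k (a + 1 + 1) y = 0 := fun y hy ↦
      sum_mul_eq_zero_on_support (h.null_compl (a + 1) (by omega)) hs hsl hsl' (q := p 0)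
        (p := fun k ↦ p (k + 1)) (c := fun k ↦ chain μ k (a + 1 + 1))
        (fun k hk ↦ h.continuousOn_chain_Icc (by omega)) hS hinf (fun x hx ↦ by
          have := h0 x hx
          rw [Finset.sum_range_succ'] at this
          simp only [chain, mul_one] at this
          rw [add_comm]
          exact this) hy
    have h2 := ih (a + 1) (by omega) (fun k ↦ p (k + 1)) (μ (a + 1)).support
      (support_subset_Icc (h.null_compl (a + 1) (by omega))) (h.infinite (a + 1) (by omega)) h1
    intro k hk
    cases k with
    | succ k => exact h2 k (by omega)
    | zero =>
      refine eq_zero_of_infinite_isRoot _ (hinf.mono fun x hx ↦ ?_)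
      have := h0 x hx
      rw [Finset.sum_range_succ', Finset.sum_eq_zero fun k hk ↦ by
        rw [h2 k (by simpa [Nat.lt_succ_iff] using hk), eval_zero, zero_mul]] at this
      simpa [chain] using this

/-! ### Zeros of the multiple orthogonal polynomials, and sign of the weights -/

/-- `Q` is orthogonal to the polynomials of degree less than `n k` for the density
`chain μ k 1` with respect to `μ 0`, for all `k ≤ m`. -/
def IsOrthogonal (m : ℕ) (μ : ℕ → Measure ℝ) (n : ℕ → ℕ) (Q : ℝ[X]) : Prop :=
  ∀ k ≤ m, ∀ j < n k, ∫ y, y ^ j * (Q.eval y * chain μ k 1 y) ∂μ 0 = 0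

namespace PositiveSystem

variable {m : ℕ} {l r : ℕ → ℝ} {μ : ℕ → Measure ℝ}

theorem continuousOn_sum_chain (h : PositiveSystem m l r μ) (p : ℕ → ℝ[X]) {s : Finset ℕ}
    (hs : ∀ k ∈ s, k ≤ m) :
    ContinuousOn (fun x ↦ ∑ k ∈ s, (p k).eval x * chain μ k 1 x) (Set.Icc (l 0) (r 0)) :=
  continuousOn_finsetSum _ fun k hk ↦ (p k).continuous.continuousOn.mul
    (h.continuousOn_chain_Icc (a := 0) (by have := hs k hk; omega))

theorem integral_mul_sum_chain_eq_zero (h : PositiveSystem m l r μ) {n : ℕ → ℕ} {Q : ℝ[X]}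
    (hQ : IsOrthogonal m μ n Q) {p : ℕ → ℝ[X]} {s : Finset ℕ} (hs : ∀ k ∈ s, k ≤ m)
    (hp : ∀ k ∈ s, (p k).degree < (n k : WithBot ℕ)) :
    ∫ x, Q.eval x * ∑ k ∈ s, (p k).eval x * chain μ k 1 x ∂μ 0 = 0 := by
  have := h.finite 0
  have hc : ∀ k ∈ s, ContinuousOn (fun y ↦ Q.eval y * chain μ k 1 y) (Set.Icc (l 0) (r 0)) :=
    fun k hk ↦ Q.continuous.continuousOn.mul
      (h.continuousOn_chain_Icc (a := 0) (by have := hs k hk; omega))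
  have e : ∀ x, Q.eval x * ∑ k ∈ s, (p k).eval x * chain μ k 1 x =
      ∑ k ∈ s, (p k).eval x * (Q.eval x * chain μ k 1 x) := fun x ↦ by
    rw [Finset.mul_sum]
    exact Finset.sum_congr rfl fun _ _ ↦ by ring
  have hi : ∀ k ∈ s, Integrable (fun x ↦ (p k).eval x * (Q.eval x * chain μ k 1 x)) (μ 0) :=
    fun k hk ↦ integrable_of_continuousOn_Icc (h.null_compl 0 (by omega))
      ((p k).continuous.continuousOn.mul (hc k hk))
  simp only [e]
  rw [integral_finsetSum _ hi]
  exact Finset.sum_eq_zero fun k hk ↦ integral_eval_mul_eq_zero (h.null_compl 0 (by omega)) (hc k hk)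
    (hQ k (hs k hk)) (hp k hk)

theorem not_forall_mem_support_sum_eq_zero (h : PositiveSystem m l r μ) {p : ℕ → ℝ[X]}
    (hne : ∃ k ≤ m, p k ≠ 0) {Q : ℝ[X]} (hQ : Q ≠ 0) :
    ¬ ∀ x ∈ (μ 0).support, Q.eval x * ∑ k ∈ Finset.range (m + 1), (p k).eval x * chain μ k 1 x = 0 := by
  intro h0
  obtain ⟨k, hk, hpk⟩ := hne
  have hfin : {x | Q.IsRoot x}.Finite := by
    by_contra hinf
    exact hQ (eq_zero_of_infinite_isRoot Q hinf)
  refine hpk (h.eq_zero_of_sum_chain_eq_zero m 0 (by omega) p ((μ 0).support \ {x | Q.IsRoot x})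
    (Set.sdiff_subset.trans (support_subset_Icc (h.null_compl 0 (by omega))))
    ((h.infinite 0 (by omega)).sdiff hfin) (fun x hx ↦ ?_) k hk)
  exact (mul_eq_zero.1 (h0 x hx.1)).resolve_left hx.2

/-- With fewer than `|n|` roots of odd order inside, some nonzero form would share the sign changes
of `Q`. Its product with `Q`, whose integral is zero by orthogonality, would then vanish on the
support of `μ 0`, which independence forbids. -/
theorem exists_eq_C_mul_prod_of_isOrthogonal (h : PositiveSystem m l r μ) {n : ℕ → ℕ} {Q : ℝ[X]}
    (hQ : IsOrthogonal m μ n Q) (hQ0 : Q ≠ 0)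
    (hdeg : Q.natDegree ≤ ∑ k ∈ Finset.range (m + 1), n k) :
    ∃ (Z : Finset ℝ) (c : ℝ), c ≠ 0 ∧ (∀ z ∈ Z, z ∈ Set.Ioo (l 0) (r 0)) ∧
      Z.card = ∑ k ∈ Finset.range (m + 1), n k ∧ Q = C c * ∏ z ∈ Z, (Polynomial.X - C z) := by
  have hlr := h.lt 0 (by omega)
  have := h.finite 0
  obtain ⟨Z, s, hs, hZ, hsign⟩ := exists_finset_roots_mul_nonneg
    (Set.ordConnected_Ioo (a := l 0) (b := r 0)) hQ0
  -- The roots are sought in the open interval; the sign extends to the end points by continuity.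
  have hsign' : ∀ x ∈ Set.Icc (l 0) (r 0), 0 ≤ s * (Q.eval x * ∏ z ∈ Z, (x - z)) := by
    rw [← closure_Ioo hlr.ne]
    refine closure_minimal (t := {x | 0 ≤ s * (Q.eval x * ∏ z ∈ Z, (x - z))}) hsign
      (isClosed_le continuous_const ?_)
    have := Q.continuous
    fun_prop
  have hcard : ∑ k ∈ Finset.range (m + 1), n k ≤ Z.card := by
    by_contra! hlt
    obtain ⟨p, hp, hne, hpx⟩ := h.exists_form_mul_prod_nonneg n
      (fun z hz ↦ Set.Ioo_subset_Icc_self (hZ z hz).1) hlt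
    have hInt := h.integral_mul_sum_chain_eq_zero hQ (s := Finset.range (m + 1)) (p := p)
      (fun k hk ↦ Nat.lt_succ_iff.1 (Finset.mem_range.1 hk)) (fun k _ ↦ hp k)
    have hHc := h.continuousOn_sum_chain p (s := Finset.range (m + 1))
      (fun k hk ↦ Nat.lt_succ_iff.1 (Finset.mem_range.1 hk))
    set H : ℝ → ℝ := fun x ↦ ∑ k ∈ Finset.range (m + 1), (p k).eval x * chain μ k 1 x with hH
    refine h.not_forall_mem_support_sum_eq_zero hne hQ0 fun x hx ↦ ?_
    have hz := eq_zero_of_mem_support (h.null_compl 0 (by omega)) (f := fun x ↦ s * (Q.eval x * H x))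
      (continuousOn_const.mul (Q.continuous.continuousOn.mul hHc)) (fun y hy ↦ ?_)
      (by rw [integral_const_mul, hInt, mul_zero]) hx
    · exact (mul_eq_zero.1 hz).resolve_left hs
    · have h1 := hsign' y hy
      have h2 := hpx y hy
      by_cases h0 : ∏ z ∈ Z, (y - z) = 0
      · obtain ⟨z, hzZ, hz0⟩ := Finset.prod_eq_zero_iff.1 h0
        have : Q.eval y = 0 := by
          rw [sub_eq_zero.1 hz0]
          exact (hZ z hzZ).2
        simp [this]
      · have h3 : 0 < (∏ z ∈ Z, (y - z)) ^ 2 := by positivity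
        refine nonneg_of_mul_nonneg_left ((mul_nonneg h1 h2).trans_eq ?_) h3
        simp only [hH]
        ring
  have hdvd : ∏ z ∈ Z, (Polynomial.X - C z) ∣ Q := prod_X_sub_C_dvd fun z hz ↦ (hZ z hz).2
  obtain ⟨q, hq⟩ := hdvd
  have hq0 : q ≠ 0 := by
    rintro rfl
    exact hQ0 (by rw [hq, mul_zero])
  have hdq := natDegree_mul (monic_prod_X_sub_C_finset Z).ne_zero hq0
  rw [← hq, natDegree_prod_X_sub_C] at hdq
  refine ⟨Z, q.coeff 0, ?_, fun z hz ↦ (hZ z hz).1, by omega, ?_⟩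
  · intro h0
    rw [eq_C_of_natDegree_eq_zero (by omega : q.natDegree = 0), h0, C_0] at hq0
    exact hq0 rfl
  · rw [← eq_C_of_natDegree_eq_zero (by omega : q.natDegree = 0), hq, mul_comm]

/-- With `c = p_j(ξ)` and `H` of the sign of `q`, the numbers `∫ q H = c ∫ q u_j` and `q(ξ) H(ξ) = c
q(ξ) u_j(ξ)` are both positive. Their product is `(c q(ξ))²` times the quantity in question. -/
theorem weight_mul_chain_pos (h : PositiveSystem m l r μ) {n : ℕ → ℕ} {M : ℕ} (hn0 : n 0 = M)
    (hn : ∀ k, k ≠ 0 → n k = M + 1) {Z : Finset ℝ} (hZ : ∀ z ∈ Z, z ∈ Set.Icc (l 0) (r 0))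
    (hcard : Z.card = ∑ k ∈ Finset.range (m + 1), n k)
    (hQ : IsOrthogonal m μ n (∏ z ∈ Z, (Polynomial.X - C z))) {ξ : ℝ} (hξ : ξ ∈ Z) {j : ℕ}
    (hj : j ≤ m) :
    0 < (∫ y, (∏ z ∈ Z.erase ξ, (y - z)) * chain μ j 1 y ∂μ 0) /
      (∏ z ∈ Z.erase ξ, (ξ - z)) * chain μ j 1 ξ := by
  have := h.finite 0
  have hμ := h.null_compl 0 (by omega)
  set u : ℕ → ℝ → ℝ := fun k ↦ chain μ k 1 with hu
  set q : ℝ[X] := ∏ z ∈ Z.erase ξ, (Polynomial.X - C z) with hq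
  have hqe : ∀ y, q.eval y = ∏ z ∈ Z.erase ξ, (y - z) := fun y ↦ by simp [hq, eval_prod]
  set Q : ℝ[X] := ∏ z ∈ Z, (Polynomial.X - C z) with hQdef
  have hQq : ∀ y, Q.eval y = (y - ξ) * q.eval y := fun y ↦ by
    rw [hQdef, ← Finset.mul_prod_erase _ _ hξ, eval_mul, eval_sub, eval_X, eval_C]
  obtain ⟨p, hpj, hp, hne, hpx⟩ := h.exists_form_stepIndex_mul_prod_nonneg hn0 hn hj (hZ ξ hξ)
    (E := Z.erase ξ) (fun z hz ↦ hZ z (Finset.mem_of_mem_erase hz))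
    (by rw [Finset.card_erase_of_mem hξ]; omega)
  set s := (Finset.range (m + 1)).erase j with hs
  have hsm : ∀ k ∈ s, k ≤ m := fun k hk ↦
    Nat.lt_succ_iff.1 (Finset.mem_range.1 (Finset.mem_of_mem_erase hk))
  have huc : ContinuousOn (u j) (Set.Icc (l 0) (r 0)) := h.continuousOn_chain_Icc (a := 0) (by omega)
  have hScont := h.continuousOn_sum_chain p hsm
  set c := (p j).eval ξ with hc
  -- the integral of `q` against the form reduces to a multiple of the weight
  obtain ⟨p', hp'⟩ : (Polynomial.X - C ξ) ∣ p j - C c := by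
    rw [dvd_iff_isRoot]
    simp [hc]
  have hp'deg : p'.degree < (n j : WithBot ℕ) := by
    by_cases h0 : p' = 0
    · rw [h0, degree_zero]; exact WithBot.bot_lt_coe _
    have h1 : (p j - C c).degree < ((n j + 1 : ℕ) : WithBot ℕ) :=
      (degree_sub_le _ _).trans_lt (max_lt hpj (degree_C_le.trans_lt (by exact_mod_cast Nat.succ_pos _)))
    rw [hp', degree_mul, degree_X_sub_C, degree_eq_natDegree h0] at h1
    rw [degree_eq_natDegree h0]
    have h2 : 1 + p'.natDegree < n j + 1 := by exact_mod_cast h1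
    exact_mod_cast (by omega : p'.natDegree < n j)
  have hpe : ∀ y, (p j).eval y = c + (y - ξ) * p'.eval y := fun y ↦ by
    have := congrArg (eval y) hp'
    simp only [eval_sub, eval_C, eval_mul, eval_X] at this
    linarith
  set H : ℝ → ℝ := fun x ↦ (p j).eval x * u j x + (x - ξ) * ∑ k ∈ s, (p k).eval x * u k x with hH
  have hHc : ContinuousOn H (Set.Icc (l 0) (r 0)) :=
    ((p j).continuous.continuousOn.mul huc).add (ContinuousOn.mul (by fun_prop) hScont)
  have e1 : ∫ y, Q.eval y * ∑ k ∈ s, (p k).eval y * u k y ∂μ 0 = 0 :=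
    h.integral_mul_sum_chain_eq_zero hQ hsm fun k hk ↦ hp k (Finset.ne_of_mem_erase hk)
  have e2 : ∫ y, p'.eval y * (Q.eval y * u j y) ∂μ 0 = 0 :=
    integral_eval_mul_eq_zero hμ (Q.continuous.continuousOn.mul huc) (hQ j hj) hp'deg
  have hInt : ∫ y, q.eval y * H y ∂μ 0 = c * ∫ y, q.eval y * u j y ∂μ 0 := by
    have i1 : Integrable (fun y ↦ c * (q.eval y * u j y)) (μ 0) :=
      (integrable_of_continuousOn_Icc hμ (q.continuous.continuousOn.mul huc)).const_mul c
    have i2 : Integrable (fun y ↦ p'.eval y * (Q.eval y * u j y)) (μ 0) :=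
      integrable_of_continuousOn_Icc hμ
        (p'.continuous.continuousOn.mul (Q.continuous.continuousOn.mul huc))
    have i3 : Integrable (fun y ↦ Q.eval y * ∑ k ∈ s, (p k).eval y * u k y) (μ 0) :=
      integrable_of_continuousOn_Icc hμ (Q.continuous.continuousOn.mul hScont)
    have e : ∀ y, q.eval y * H y = c * (q.eval y * u j y) + p'.eval y * (Q.eval y * u j y) +
        Q.eval y * ∑ k ∈ s, (p k).eval y * u k y := fun y ↦ by
      simp only [hH]
      rw [hpe, hQq]
      ring
    simp only [e]
    rw [integral_add (f := fun y ↦ c * (q.eval y * u j y) + p'.eval y * (Q.eval y * u j y))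
      (i1.add i2) i3, integral_add i1 i2, e1, e2, integral_const_mul, add_zero, add_zero]
  have hnn : ∀ x ∈ Set.Icc (l 0) (r 0), 0 ≤ q.eval x * H x := fun x hx ↦ by
    rw [hqe, mul_comm]
    exact hpx x hx
  have hpos : 0 < ∫ y, q.eval y * H y ∂μ 0 := by
    have hae : ∀ᵐ t ∂μ 0, t ∈ Set.Icc (l 0) (r 0) := mem_ae_iff.2 hμ
    refine lt_of_le_of_ne (integral_nonneg_of_ae (hae.mono fun t ht ↦ hnn t ht)) fun h0 ↦ ?_
    have hjm : j ∈ Finset.range (m + 1) := Finset.mem_range.2 (by omega)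
    -- A zero integral would make `q H` vanish on the support. Moving `X - ξ` into the coefficients
    -- turns `H` into an ordinary form, to which independence applies.
    refine h.not_forall_mem_support_sum_eq_zero
      (p := fun k ↦ if k = j then p j else (Polynomial.X - C ξ) * p k) ?_
      (monic_prod_X_sub_C_finset (Z.erase ξ)).ne_zero fun x hx ↦ ?_
    · obtain ⟨k, hk, hpk⟩ := hne
      refine ⟨k, hk, ?_⟩
      split_ifs with hkj
      · rwa [← hkj]
      · exact mul_ne_zero (X_sub_C_ne_zero ξ) hpk
    · have hz := eq_zero_of_mem_support hμ (q.continuous.continuousOn.mul hHc) hnn h0.symm hx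
      rw [← hz]
      simp only [Pi.mul_apply, hH]
      rw [← Finset.add_sum_erase _ _ hjm, Finset.mul_sum]
      simp only [if_pos]
      congr 2
      refine Finset.sum_congr rfl fun k hk ↦ ?_
      rw [if_neg (Finset.ne_of_mem_erase hk), eval_mul, eval_sub, eval_X, eval_C, mul_assoc]
  have hξn := hnn ξ (hZ ξ hξ)
  simp only [hH, sub_self, zero_mul, add_zero] at hξn
  rw [hInt] at hpos
  have hqξ : q.eval ξ ≠ 0 := by
    rw [hqe]
    exact Finset.prod_ne_zero_iff.2 fun z hz ↦ sub_ne_zero.2 (Finset.ne_of_mem_erase hz).symm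
  have hune : u j ξ ≠ 0 := h.chain_ne_zero_of_mem (a := 0) (by omega) (hZ ξ hξ)
  simp only [← hqe]
  set w := ∫ y, q.eval y * u j y ∂μ 0 with hw
  have hcne : c ≠ 0 := fun h0 ↦ by simp [h0] at hpos
  have hξp : 0 < q.eval ξ * (c * u j ξ) := lt_of_le_of_ne hξn
    (mul_ne_zero hqξ (mul_ne_zero hcne hune)).symm
  have hprod : 0 < (c * q.eval ξ) ^ 2 * (w / q.eval ξ * u j ξ) := by
    refine (mul_pos hpos hξp).trans_eq ?_
    field_simp
  exact (mul_pos_iff_of_pos_left (by positivity)).1 hprod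

end PositiveSystem

/-! ### Type II approximants and their quadrature formulas -/

/-- `Q` times the transform of `G dμ` is `quotientPoly` plus the transform of `Q G dμ`; the
expansion of the latter at infinity has the moments of `Q G` as coefficients. -/
theorem isBigO_sub_iff_orthogonal {μ : Measure ℝ} [IsFiniteMeasure μ] {l r : ℝ}
    (hμ : μ (Set.Icc l r)ᶜ = 0) {G : ℝ → ℂ} (hG : ContinuousOn G (Set.Icc l r)) {Q P : ℂ[X]} {n : ℕ} :
    (fun z : ℂ ↦ Q.eval z * (∫ y, G y / (z - y) ∂μ) - P.eval z)
      =O[Bornology.cobounded ℂ] (fun z : ℂ ↦ (1 / z ^ (n + 1) : ℂ)) ↔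
    P = quotientPoly (fun j ↦ ∫ y, (y : ℂ) ^ j * G y ∂μ) Q ∧
      ∀ j < n, ∫ y, (y : ℂ) ^ j * (Q.eval (y : ℂ) * G y) ∂μ = 0 := by
  have hQG : ContinuousOn (fun y : ℝ ↦ Q.eval (y : ℂ) * G y) (Set.Icc l r) :=
    (Q.continuous.comp Complex.continuous_ofReal).continuousOn.mul hG
  set R := quotientPoly (fun j ↦ ∫ y, (y : ℂ) ^ j * G y ∂μ) Q with hR
  have e : (fun z : ℂ ↦ Q.eval z * (∫ y, G y / (z - y) ∂μ) - P.eval z) =ᶠ[Bornology.cobounded ℂ]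
      fun z ↦ (R - P).eval z + ∫ y, Q.eval (y : ℂ) * G y / (z - y) ∂μ := by
    filter_upwards [eventually_notMem_image_Icc l r] with z hz
    rw [eval_mul_integral_div hμ hG Q hz.2, eval_sub]
    ring
  rw [Asymptotics.isBigO_congr e Filter.EventuallyEq.rfl]
  constructor
  · intro h
    obtain ⟨h1, h2⟩ := eq_zero_of_isBigO_add_integral_div hμ hQG le_rfl h
    exact ⟨(sub_eq_zero.1 h1).symm, h2⟩
  · rintro ⟨rfl, h2⟩
    simpa using isBigO_integral_div_of_moments hμ hQG h2

/-- The polynomial formed by the real parts of the coefficients. -/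
def rePoly (Q : ℂ[X]) : ℝ[X] :=
  ∑ i ∈ Finset.range (Q.natDegree + 1), C (Q.coeff i).re * Polynomial.X ^ i

theorem coeff_rePoly (Q : ℂ[X]) (i : ℕ) : (rePoly Q).coeff i = (Q.coeff i).re := by
  simp only [rePoly, finsetSum_coeff, coeff_C_mul, coeff_X_pow, mul_ite, mul_one, mul_zero,
    Finset.sum_ite_eq, Finset.mem_range]
  split_ifs with h
  · rfl
  · rw [coeff_eq_zero_of_natDegree_lt (by omega), Complex.zero_re]

theorem natDegree_rePoly_le (Q : ℂ[X]) : (rePoly Q).natDegree ≤ Q.natDegree := by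
  rw [natDegree_le_iff_coeff_eq_zero]
  intro i hi
  rw [coeff_rePoly, coeff_eq_zero_of_natDegree_lt hi, Complex.zero_re]

theorem eval_rePoly (Q : ℂ[X]) (x : ℝ) : (rePoly Q).eval x = (Q.eval (x : ℂ)).re := by
  rw [rePoly, eval_finsetSum, eval_eq_sum_range, Complex.re_sum]
  refine Finset.sum_congr rfl fun i _ ↦ ?_
  rw [eval_mul, eval_C, eval_pow, eval_X, ← Complex.ofReal_pow, Complex.re_mul_ofReal]

/-- Orthogonality of a polynomial with complex coefficients. -/
def IsOrthogonalComplex (m : ℕ) (μ : ℕ → Measure ℝ) (n : ℕ → ℕ) (Q : ℂ[X]) : Prop :=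
  ∀ k ≤ m, ∀ j < n k, ∫ y, (y : ℂ) ^ j * (Q.eval (y : ℂ) * (chain μ k 1 y : ℂ)) ∂μ 0 = 0

namespace PositiveSystem

variable {m : ℕ} {l r : ℕ → ℝ} {μ : ℕ → Measure ℝ}

theorem continuousOn_ofReal_chain (h : PositiveSystem m l r μ) {k : ℕ} (hk : k ≤ m) :
    ContinuousOn (fun y ↦ (chain μ k 1 y : ℂ)) (Set.Icc (l 0) (r 0)) :=
  Complex.continuous_ofReal.comp_continuousOn (h.continuousOn_chain_Icc (a := 0) (by omega))

theorem isOrthogonal_rePoly (h : PositiveSystem m l r μ) {n : ℕ → ℕ} {Q : ℂ[X]}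
    (hQ : IsOrthogonalComplex m μ n Q) (c : ℂ) : IsOrthogonal m μ n (rePoly (C c * Q)) := by
  intro k hk j hj
  have := h.finite 0
  have h1 : ∫ y, (y : ℂ) ^ j * ((C c * Q).eval (y : ℂ) * (chain μ k 1 y : ℂ)) ∂μ 0 = 0 := by
    have : ∀ y : ℝ, (y : ℂ) ^ j * ((C c * Q).eval (y : ℂ) * (chain μ k 1 y : ℂ)) =
        c * ((y : ℂ) ^ j * (Q.eval (y : ℂ) * (chain μ k 1 y : ℂ))) := fun y ↦ by
      rw [eval_mul, eval_C]
      ring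
    simp only [this]
    rw [integral_const_mul, hQ k hk j hj, mul_zero]
  have hi : Integrable
      (fun y : ℝ ↦ (y : ℂ) ^ j * ((C c * Q).eval (y : ℂ) * (chain μ k 1 y : ℂ))) (μ 0) :=
    integrable_of_continuousOn_Icc (h.null_compl 0 (by omega)) (ContinuousOn.mul (by fun_prop)
      (((C c * Q).continuous.comp Complex.continuous_ofReal).continuousOn.mul
        (h.continuousOn_ofReal_chain hk)))
  have h2 := integral_re hi
  simp only [RCLike.re_eq_complex_re] at h2
  rw [h1, Complex.zero_re] at h2
  rw [← h2]
  refine integral_congr_ae (Filter.Eventually.of_forall fun y ↦ ?_)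
  simp only
  rw [eval_rePoly, ← Complex.ofReal_pow, Complex.re_ofReal_mul, Complex.re_mul_ofReal]

theorem eq_zero_of_isOrthogonal_of_coeff_eq_zero (h : PositiveSystem m l r μ) {n : ℕ → ℕ} {Q : ℝ[X]}
    (hQ : IsOrthogonal m μ n Q) (hdeg : Q.natDegree ≤ ∑ k ∈ Finset.range (m + 1), n k)
    (hc : Q.coeff (∑ k ∈ Finset.range (m + 1), n k) = 0) : Q = 0 := by
  by_contra h0
  obtain ⟨Z, c, hc0, -, hcard, rfl⟩ := h.exists_eq_C_mul_prod_of_isOrthogonal hQ h0 hdeg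
  rw [← hcard, coeff_C_mul] at hc
  have h1 := (monic_prod_X_sub_C_finset Z).coeff_natDegree
  rw [natDegree_prod_X_sub_C] at h1
  rw [h1, mul_one] at hc
  exact hc0 hc

/-- The real part of `c Q` is orthogonal for every complex `c`. If its coefficient of degree `|n|`
vanishes it is zero, because nonzero real orthogonal polynomials have full degree. Hence that
coefficient of `Q` is not zero, and `Q` is its multiple of a real polynomial. -/
theorem exists_eq_C_mul_prod_of_isOrthogonalComplex (h : PositiveSystem m l r μ) {n : ℕ → ℕ}
    {Q : ℂ[X]} (hQ : IsOrthogonalComplex m μ n Q) (hQ0 : Q ≠ 0)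
    (hdeg : Q.natDegree ≤ ∑ k ∈ Finset.range (m + 1), n k) :
    ∃ (Z : Finset ℝ) (γ : ℂ), γ ≠ 0 ∧ (∀ z ∈ Z, z ∈ Set.Ioo (l 0) (r 0)) ∧
      Z.card = ∑ k ∈ Finset.range (m + 1), n k ∧
      IsOrthogonal m μ n (∏ z ∈ Z, (Polynomial.X - C z)) ∧
      Q = C γ * ∏ z ∈ Z, (Polynomial.X - C (z : ℂ)) := by
  set N := ∑ k ∈ Finset.range (m + 1), n k with hN
  have hdeg' : ∀ c : ℂ, (rePoly (C c * Q)).natDegree ≤ N := fun c ↦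
    (natDegree_rePoly_le _).trans ((natDegree_C_mul_le c Q).trans hdeg)
  have hzero : ∀ c : ℂ, (c * Q.coeff N).re = 0 → ∀ i, (c * Q.coeff i).re = 0 := fun c hc i ↦ by
    have h1 := h.eq_zero_of_isOrthogonal_of_coeff_eq_zero (h.isOrthogonal_rePoly hQ c) (hdeg' c)
      (by rw [coeff_rePoly, coeff_C_mul, ← hN, hc])
    rw [← coeff_C_mul, ← coeff_rePoly, h1, coeff_zero]
  have hγ : Q.coeff N ≠ 0 := fun h0 ↦ by
    refine hQ0 (Polynomial.ext fun i ↦ Complex.ext ?_ ?_)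
    · simpa using hzero 1 (by simp [h0]) i
    · simpa using hzero (-Complex.I) (by simp [h0]) i
  set γ := Q.coeff N with hγd
  set A := rePoly (C γ⁻¹ * Q) with hA
  have hAQ : Q = C γ * A.map Complex.ofRealHom := by
    ext i
    rw [coeff_C_mul, coeff_map, hA, coeff_rePoly, coeff_C_mul]
    have him : (γ⁻¹ * Q.coeff i).im = 0 := by
      have := hzero (-Complex.I * γ⁻¹) (by rw [mul_assoc, inv_mul_cancel₀ hγ]; simp) i
      rw [mul_assoc, neg_mul, Complex.neg_re, Complex.I_mul_re] at this
      simpa using this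
    have hre : (Complex.ofRealHom (γ⁻¹ * Q.coeff i).re : ℂ) = γ⁻¹ * Q.coeff i :=
      Complex.ext (by simp) (by simpa using him.symm)
    rw [hre, mul_inv_cancel_left₀ hγ]
  have hA0 : A ≠ 0 := fun h0 ↦ hQ0 (by rw [hAQ, h0, Polynomial.map_zero, mul_zero])
  have hAN : A.coeff N = 1 := by
    rw [hA, coeff_rePoly, coeff_C_mul, ← hγd, inv_mul_cancel₀ hγ, Complex.one_re]
  have hAo := h.isOrthogonal_rePoly hQ γ⁻¹
  obtain ⟨Z, c, hc0, hZ, hcard, hAZ⟩ := h.exists_eq_C_mul_prod_of_isOrthogonal hAo hA0 (hdeg' _)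
  have hc1 : c = 1 := by
    have h1 := (monic_prod_X_sub_C_finset Z).coeff_natDegree
    rw [natDegree_prod_X_sub_C, hcard] at h1
    rw [← hA] at hAZ
    rw [hAZ, coeff_C_mul, h1, mul_one] at hAN
    exact hAN
  rw [hc1, C_1, one_mul] at hAZ
  refine ⟨Z, γ, hγ, hZ, hcard, hAZ ▸ hAo, ?_⟩
  rw [hAQ, hA, hAZ, Polynomial.map_prod]
  simp

/-- There are `N` linear conditions on `N + 1` coefficients. -/
theorem exists_isOrthogonalComplex (h : PositiveSystem m l r μ) (n : ℕ → ℕ) :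
    ∃ Q : ℂ[X], Q ≠ 0 ∧ Q.natDegree ≤ ∑ k ∈ Finset.range (m + 1), n k ∧
      IsOrthogonalComplex m μ n Q := by
  have := h.finite 0
  set N := ∑ k ∈ Finset.range (m + 1), n k with hN
  let M : ℕ → ℕ → ℂ := fun k j ↦ ∫ y, (y : ℂ) ^ j * (chain μ k 1 y : ℂ) ∂μ 0
  let L : (Fin (N + 1) → ℂ) →ₗ[ℂ] ((Σ k : Fin (m + 1), Fin (n k)) → ℂ) :=
    { toFun := fun c t ↦ ∑ i : Fin (N + 1), c i * M t.1 (t.2 + i)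
      map_add' := fun c c' ↦ by ext t; simp [add_mul, Finset.sum_add_distrib]
      map_smul' := fun a c ↦ by ext t; simp [mul_assoc, Finset.mul_sum] }
  have hker : LinearMap.ker L ≠ ⊥ := LinearMap.ker_ne_bot_of_finrank_lt (by
    simp only [Module.finrank_fintype_fun_eq_card, Fintype.card_sigma, Fintype.card_fin]
    rw [Fin.sum_univ_eq_sum_range (fun k ↦ n k)]
    omega)
  obtain ⟨c, hc, hc0⟩ := (Submodule.ne_bot_iff _).1 hker
  set Q : ℂ[X] := ∑ i : Fin (N + 1), C (c i) * Polynomial.X ^ (i : ℕ) with hQ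
  refine ⟨Q, fun h0 ↦ hc0 (funext fun i ↦ ?_), ?_, fun k hk j hj ↦ ?_⟩
  · have h1 := congrArg (fun p ↦ coeff p (i : ℕ)) h0
    simp only [hQ, finsetSum_coeff, coeff_C_mul, coeff_X_pow, coeff_zero] at h1
    rw [Finset.sum_eq_single i (fun j _ hj ↦ by simp [Fin.val_inj, hj.symm]) (by simp)] at h1
    simpa using h1
  · exact natDegree_sum_le_of_forall_le _ _ fun i _ ↦ (natDegree_C_mul_X_pow_le _ _).trans (by omega)
  · have h1 := congrFun (LinearMap.mem_ker.1 hc) ⟨⟨k, by omega⟩, ⟨j, hj⟩⟩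
    have h2 : ∑ i : Fin (N + 1), c i * M k (j + i) = 0 := h1
    rw [← h2]
    have hi : ∀ i : Fin (N + 1), Integrable
        (fun y : ℝ ↦ c i * ((y : ℂ) ^ (j + (i : ℕ)) * (chain μ k 1 y : ℂ))) (μ 0) := fun i ↦
      (integrable_of_continuousOn_Icc (h.null_compl 0 (by omega))
        (ContinuousOn.mul (by fun_prop) (h.continuousOn_ofReal_chain hk))).const_mul _
    simp only [M, ← integral_const_mul]
    rw [← integral_finsetSum _ fun i _ ↦ hi i]
    refine integral_congr_ae (Filter.Eventually.of_forall fun y ↦ ?_)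
    simp only [hQ, eval_finsetSum, eval_mul, eval_C, eval_pow, eval_X, Finset.sum_mul,
      Finset.mul_sum]
    exact Finset.sum_congr rfl fun i _ ↦ by ring

end PositiveSystem

/-- The weight at `ξ` of the interpolatory quadrature formula with nodes `Z` for `g dμ`. -/
def quadratureWeight (μ : Measure ℝ) (g : ℝ → ℝ) (Z : Finset ℝ) (ξ : ℝ) : ℝ :=
  (∫ y, (∏ z ∈ Z.erase ξ, (y - z)) * g y ∂μ) / ∏ z ∈ Z.erase ξ, (ξ - z)

/-- At a root `ξ` the numerator is the integral of `Q(y) / (y - ξ)` against `g dμ`, and the constant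
`γ` cancels against `Q'(ξ)`. -/
theorem weight_eq_quadratureWeight {μ : Measure ℝ} [IsFiniteMeasure μ] {l r : ℝ}
    (hμ : μ (Set.Icc l r)ᶜ = 0) {g : ℝ → ℝ} (hg : ContinuousOn g (Set.Icc l r)) {Z : Finset ℝ} {γ : ℂ}
    (hγ : γ ≠ 0) {ξ : ℝ} (hξ : ξ ∈ Z) :
    weight (C γ * ∏ z ∈ Z, (Polynomial.X - C (z : ℂ)))
      (quotientPoly (fun j ↦ ∫ y, (y : ℂ) ^ j * (g y : ℂ) ∂μ)
        (C γ * ∏ z ∈ Z, (Polynomial.X - C (z : ℂ)))) ξ = quadratureWeight μ g Z ξ := by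
  have hd : (C γ * ∏ z ∈ Z, (Polynomial.X - C (z : ℂ))) =
      (Polynomial.X - C (ξ : ℂ)) * (C γ * ∏ z ∈ Z.erase ξ, (Polynomial.X - C (z : ℂ))) := by
    rw [← Finset.mul_prod_erase _ _ hξ]
    ring
  have hdiv : (C γ * ∏ z ∈ Z, (Polynomial.X - C (z : ℂ))) /ₘ (Polynomial.X - C (ξ : ℂ)) =
      C γ * ∏ z ∈ Z.erase ξ, (Polynomial.X - C (z : ℂ)) := by
    rw [hd, mul_divByMonic_cancel_left _ (monic_X_sub_C _)]
  rw [weight, eval_quotientPoly hμ (G := fun y ↦ (g y : ℂ))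
    (Complex.continuous_ofReal.comp_continuousOn hg), hdiv]
  have hder : (derivative (C γ * ∏ z ∈ Z, (Polynomial.X - C (z : ℂ)))).eval (ξ : ℂ) =
      γ * ((∏ z ∈ Z.erase ξ, (ξ - z) : ℝ) : ℂ) := by
    rw [hd]
    simp [eval_prod]
  have hInt : ∫ y, (C γ * ∏ z ∈ Z.erase ξ, (Polynomial.X - C (z : ℂ))).eval (y : ℂ) * (g y : ℂ) ∂μ =
      γ * ((∫ y, (∏ z ∈ Z.erase ξ, (y - z)) * g y ∂μ : ℝ) : ℂ) := by
    rw [← integral_complex_ofReal, ← integral_const_mul]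
    refine integral_congr_ae (Filter.Eventually.of_forall fun y ↦ ?_)
    simp [eval_prod, mul_assoc]
  rw [hder, hInt, quadratureWeight, mul_div_mul_left _ _ hγ]
  push_cast
  rfl

/-- Gauss's argument: in `p = ρ + Q q` the quotient has degree below `n`, so `Q q` integrates to
zero, and `ρ` is its own Lagrange interpolant at the nodes. -/
theorem integral_eval_mul_eq_sum_quadratureWeight {μ : Measure ℝ} [IsFiniteMeasure μ] {l r : ℝ}
    (hμ : μ (Set.Icc l r)ᶜ = 0) {g : ℝ → ℝ} (hg : ContinuousOn g (Set.Icc l r)) {Z : Finset ℝ} {n : ℕ}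
    (horth : ∀ j < n, ∫ y, (y : ℂ) ^ j *
      ((∏ z ∈ Z, (Polynomial.X - C (z : ℂ))).eval (y : ℂ) * (g y : ℂ)) ∂μ = 0)
    {p : ℂ[X]} (hp : p.degree < ((Z.card + n : ℕ) : WithBot ℕ)) :
    ∫ y, p.eval (y : ℂ) * (g y : ℂ) ∂μ = ∑ ξ ∈ Z, (quadratureWeight μ g Z ξ : ℂ) * p.eval (ξ : ℂ) := by
  set Q : ℂ[X] := ∏ z ∈ Z, (Polynomial.X - C (z : ℂ)) with hQ
  have hQm : Q.Monic := monic_prod_of_monic _ _ fun z _ ↦ monic_X_sub_C _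
  have hQd : Q.natDegree = Z.card := by
    rw [hQ, natDegree_prod_of_monic _ _ fun z _ ↦ monic_X_sub_C _]
    simp
  have hgc : ContinuousOn (fun y ↦ (g y : ℂ)) (Set.Icc l r) :=
    Complex.continuous_ofReal.comp_continuousOn hg
  have hi : ∀ A : ℂ[X], Integrable (fun y : ℝ ↦ A.eval (y : ℂ) * (g y : ℂ)) μ := fun A ↦
    integrable_of_continuousOn_Icc hμ ((A.continuous.comp Complex.continuous_ofReal).continuousOn.mul hgc)
  set q := p /ₘ Q with hq
  set ρ := p %ₘ Q with hρ
  have hpq : p = ρ + Q * q := (modByMonic_add_div p Q).symm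
  have hqn : ∀ i ∈ q.support, i < n := fun i hi' ↦ by
    have h1 := natDegree_divByMonic p hQm
    have h2 := le_natDegree_of_mem_supp i hi'
    rw [← hq, hQd] at h1
    have hp0 : p ≠ 0 := by
      rintro rfl
      simp [hq] at hi'
    rw [degree_eq_natDegree hp0] at hp
    have hp' : p.natDegree < Z.card + n := by exact_mod_cast hp
    by_contra! hle
    have : q.natDegree = 0 ∨ 0 < q.natDegree := by omega
    rcases this with h0 | h0
    · -- a constant quotient forces `n = 0`
      have hi0 : i = 0 := by omega
      have hn0 : n = 0 := by omega
      have : q = 0 := (divByMonic_eq_zero_iff hQm).2 (by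
        rw [degree_eq_natDegree hp0, degree_eq_natDegree hQm.ne_zero, hQd]
        exact_mod_cast (by omega))
      rw [this] at hi'
      simp at hi'
    · omega
  have hQq : ∫ y, (Q * q).eval (y : ℂ) * (g y : ℂ) ∂μ = 0 := by
    have hj : ∀ (a : ℂ) (j : ℕ), Integrable
        (fun y : ℝ ↦ a * ((y : ℂ) ^ j * (Q.eval (y : ℂ) * (g y : ℂ)))) μ := fun a j ↦
      (integrable_of_continuousOn_Icc hμ (ContinuousOn.mul (by fun_prop)
        ((Q.continuous.comp Complex.continuous_ofReal).continuousOn.mul hgc))).const_mul a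
    have e : ∀ y : ℝ, (Q * q).eval (y : ℂ) * (g y : ℂ) = ∑ i ∈ q.support,
        q.coeff i * ((y : ℂ) ^ i * (Q.eval (y : ℂ) * (g y : ℂ))) := fun y ↦ by
      rw [eval_mul, eval_eq_sum (p := q), Polynomial.sum, Finset.mul_sum, Finset.sum_mul]
      exact Finset.sum_congr rfl fun _ _ ↦ by ring
    simp only [e]
    rw [integral_finsetSum _ fun i _ ↦ hj _ i]
    exact Finset.sum_eq_zero fun i hi' ↦ by rw [integral_const_mul, horth i (hqn i hi'), mul_zero]
  have hinj : Set.InjOn (fun z : ℝ ↦ (z : ℂ)) Z := Complex.ofReal_injective.injOn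
  have hρd : ρ.degree < (Z.card : WithBot ℕ) := by
    have := degree_modByMonic_lt p hQm
    rwa [degree_eq_natDegree hQm.ne_zero, hQd] at this
  have hρe : ∀ y : ℝ, ρ.eval (y : ℂ) = ∑ ξ ∈ Z, ρ.eval (ξ : ℂ) *
      ((∏ z ∈ Z.erase ξ, (y - z) : ℝ) : ℂ) / ((∏ z ∈ Z.erase ξ, (ξ - z) : ℝ) : ℂ) := fun y ↦ by
    conv_lhs => rw [Lagrange.eq_interpolate hinj hρd]
    rw [Lagrange.interpolate_apply, eval_finsetSum]
    refine Finset.sum_congr rfl fun ξ _ ↦ ?_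
    rw [eval_mul, eval_C, Lagrange.basis, eval_prod, mul_div_assoc]
    congr 1
    push_cast
    rw [← Finset.prod_div_distrib]
    refine Finset.prod_congr rfl fun z _ ↦ ?_
    simp [Lagrange.basisDivisor, div_eq_inv_mul]
  have hroot : ∀ ξ ∈ Z, Q.eval (ξ : ℂ) = 0 := fun ξ hξ ↦ by
    rw [hQ, eval_prod]
    exact Finset.prod_eq_zero hξ (by simp)
  have hρp : ∀ ξ ∈ Z, ρ.eval (ξ : ℂ) = p.eval (ξ : ℂ) := fun ξ hξ ↦ by
    conv_rhs => rw [hpq, eval_add, eval_mul, hroot ξ hξ, zero_mul, add_zero]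
  have e1 : ∫ y, p.eval (y : ℂ) * (g y : ℂ) ∂μ = ∫ y, ρ.eval (y : ℂ) * (g y : ℂ) ∂μ := by
    have : ∀ y : ℝ, p.eval (y : ℂ) * (g y : ℂ) =
        ρ.eval (y : ℂ) * (g y : ℂ) + (Q * q).eval (y : ℂ) * (g y : ℂ) := fun y ↦ by
      conv_lhs => rw [hpq, eval_add, add_mul]
    simp only [this]
    rw [integral_add (hi _) (hi _), hQq, add_zero]
  rw [e1]
  have e2 : ∀ y : ℝ, ρ.eval (y : ℂ) * (g y : ℂ) = ∑ ξ ∈ Z,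
      (ρ.eval (ξ : ℂ) / ((∏ z ∈ Z.erase ξ, (ξ - z) : ℝ) : ℂ)) *
        (((∏ z ∈ Z.erase ξ, (y - z)) * g y : ℝ) : ℂ) := fun y ↦ by
    rw [hρe, Finset.sum_mul]
    refine Finset.sum_congr rfl fun ξ _ ↦ ?_
    push_cast
    ring
  simp only [e2]
  have hi2 : ∀ ξ ∈ Z, Integrable (fun y : ℝ ↦
      (ρ.eval (ξ : ℂ) / ((∏ z ∈ Z.erase ξ, (ξ - z) : ℝ) : ℂ)) *
        (((∏ z ∈ Z.erase ξ, (y - z)) * g y : ℝ) : ℂ)) μ := fun ξ _ ↦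
    (integrable_of_continuousOn_Icc hμ (Complex.continuous_ofReal.comp_continuousOn
      (ContinuousOn.mul (by fun_prop) hg))).const_mul _
  rw [integral_finsetSum _ hi2]
  refine Finset.sum_congr rfl fun ξ hξ ↦ ?_
  rw [integral_const_mul, integral_complex_ofReal, hρp ξ hξ, quadratureWeight]
  push_cast
  ring

/-! ### Riemann–Stieltjes integrability and continuity almost everywhere -/

/-- The set whose mass is the value at `t` of the integrator on an interval starting at `a`. -/
def initialSet (a t : ℝ) : Set ℝ := if t ≤ a then ∅ else Set.Icc a t

theorem initialSet_subset (a t : ℝ) : initialSet a t ⊆ Set.Icc a t := by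
  rw [initialSet]
  split_ifs
  exacts [Set.empty_subset _, subset_rfl]

theorem initialSet_mono (a : ℝ) {t t' : ℝ} (h : t ≤ t') : initialSet a t ⊆ initialSet a t' := by
  rw [initialSet, initialSet]
  split_ifs with h1 h2
  · exact subset_rfl
  · exact Set.empty_subset _
  · linarith
  · exact Set.Icc_subset_Icc_right h

theorem measurableSet_initialSet (a t : ℝ) : MeasurableSet (initialSet a t) := by
  rw [initialSet]
  split_ifs
  exacts [MeasurableSet.empty, measurableSet_Icc]

theorem initialSet_diff_subset (a t t' : ℝ) : initialSet a t' \ initialSet a t ⊆ Set.Icc t t' := by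
  rintro x ⟨h1, h2⟩
  have h3 := initialSet_subset a t' h1
  refine ⟨?_, h3.2⟩
  by_contra! hlt
  refine h2 ?_
  rw [initialSet, if_neg (by linarith [h3.1])]
  exact ⟨h3.1, hlt.le⟩

theorem measureReal_initialSet_sub (ν : Measure ℝ) [IsFiniteMeasure ν] (a : ℝ) {t t' : ℝ}
    (h : t ≤ t') : ν.real (initialSet a t') - ν.real (initialSet a t) =
      ν.real (initialSet a t' \ initialSet a t) :=
  (measureReal_sdiff (initialSet_mono a h) (measurableSet_initialSet a t)).symm

theorem exists_partition {D : Set ℝ} (hD : Dense D) {a b : ℝ} (hab : a < b) {δ : ℝ} (hδ : 0 < δ) :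
    ∃ (N : ℕ) (t : ℕ → ℝ), t 0 = a ∧ t N = b ∧ (∀ i < N, t i ≤ t (i + 1) ∧ t (i + 1) - t i < δ) ∧
      ∀ i, t i = a ∨ t i = b ∨ t i ∈ D := by
  obtain ⟨N, hN⟩ := exists_nat_gt (2 * (b - a) / δ)
  have hN0 : (0 : ℝ) < N := lt_of_le_of_lt (div_nonneg (by linarith) hδ.le) hN
  set h := (b - a) / N with hh
  have hh0 : 0 < h := div_pos (by linarith) hN0
  have hNh : N * h = b - a := by rw [hh]; field_simp
  have h2h : 2 * h < δ := by
    rw [div_lt_iff₀ hδ] at hN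
    rw [hh, ← mul_div_assoc, div_lt_iff₀ hN0]
    linarith
  have hpt : ∀ i : ℕ, ∃ x ∈ D, x ∈ Set.Ioo (a + (i - 1) * h) (a + i * h) := fun i ↦ by
    obtain ⟨x, hx, hxD⟩ := hD.exists_mem_open (isOpen_Ioo (a := a + (i - 1) * h) (b := a + i * h))
      (Set.nonempty_Ioo.2 (by nlinarith))
    exact ⟨x, hx, hxD⟩
  choose x hxD hx using hpt
  have hNpos : 0 < N := by exact_mod_cast hN0
  refine ⟨N, fun i ↦ if i = 0 then a else if i < N then x i else b, by simp,
    by simp [hNpos.ne'], fun i hi ↦ ?_, fun i ↦ ?_⟩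
  · have hiN : (i : ℝ) + 1 ≤ N := by exact_mod_cast hi
    have hx0 := hx i
    have hx1 := hx (i + 1)
    push_cast at hx1
    simp only [Set.mem_Ioo] at hx0 hx1
    rcases Nat.eq_zero_or_pos i with rfl | hi0
    · by_cases h1 : 1 < N
      · simp only [zero_add, h1, if_true, one_ne_zero, if_false] at hx1 ⊢
        simp only [Nat.cast_zero] at hx1
        norm_num at hx1
        constructor <;> linarith
      · have : N = 1 := by omega
        subst this
        simp only [zero_add, lt_irrefl, if_true, one_ne_zero, if_false]
        norm_num at hNh
        constructor <;> linarith
    · by_cases h1 : i + 1 < N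
      · simp only [hi0.ne', hi, h1, if_true, if_false, Nat.succ_ne_zero]
        constructor <;> nlinarith
      · have h2 : (N : ℝ) = i + 1 := by exact_mod_cast (by omega : N = i + 1)
        simp only [hi0.ne', hi, h1, if_true, if_false, Nat.succ_ne_zero]
        rw [h2] at hNh
        constructor <;> nlinarith
  · by_cases h0 : i = 0
    · simp [h0]
    · by_cases h1 : i < N
      · simp [h0, h1, hxD i]
      · simp [h0, h1]

theorem dense_measure_singleton_eq_zero (ν : Measure ℝ) [IsFiniteMeasure ν] :
    Dense {x : ℝ | ν {x} = 0} := by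
  have hc : {x : ℝ | 0 < ν {x}}.Countable := Measure.countable_meas_pos_of_disjoint_iUnion
    (fun x ↦ measurableSet_singleton x) fun x y hxy ↦ by simpa using hxy
  convert hc.dense_compl ℝ using 1
  ext x
  simp

/-- At the point `x` the function `f` oscillates by at least `τ` on `[a, b]`. -/
def OscillatesAt (f : ℝ → ℝ) (a b τ x : ℝ) : Prop :=
  ∀ U ∈ nhds x, ∃ y ∈ U ∩ Set.Icc a b, ∃ y' ∈ U ∩ Set.Icc a b, τ ≤ f y - f y'

theorem exists_oscillatesAt {f : ℝ → ℝ} {a b x : ℝ} (hx : x ∈ Set.Icc a b)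
    (h : ¬ ContinuousWithinAt f (Set.Icc a b) x) :
    ∃ n : ℕ, OscillatesAt f a b (1 / ((n : ℝ) + 1)) x := by
  rw [Metric.continuousWithinAt_iff] at h
  push Not at h
  obtain ⟨ε, hε, h⟩ := h
  obtain ⟨n, hn⟩ := exists_nat_one_div_lt hε
  refine ⟨n, fun U hU ↦ ?_⟩
  obtain ⟨ρ, hρ, hb⟩ := Metric.mem_nhds_iff.1 hU
  obtain ⟨y, hy, hyx, hd⟩ := h ρ hρ
  have hxU : x ∈ U ∩ Set.Icc a b := ⟨mem_of_mem_nhds hU, hx⟩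
  have hyU : y ∈ U ∩ Set.Icc a b := ⟨hb hyx, hy⟩
  rw [Real.dist_eq] at hd
  rcases le_total (f x) (f y) with hle | hle
  · rw [abs_of_nonneg (by linarith)] at hd
    exact ⟨y, hyU, x, hxU, by linarith⟩
  · rw [abs_of_nonpos (by linarith)] at hd
    exact ⟨x, hxU, y, hyU, by linarith⟩

/-- Two choices of tags on one partition give sums that differ by at least `τ` times the mass of the
cells where `f` varies by `τ`, yet both are within `ε` of `J`. Interior partition points are chosen
off the atoms of `ν`, so outside a null set every point of `S` lies in such a cell. -/
theorem measure_oscillatesAt_eq_zero {ν : Measure ℝ} [IsFiniteMeasure ν] {a b : ℝ} (hab : a < b)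
    {f : ℝ → ℝ} {J : ℝ} (hf : HasRSIntegral f (fun t ↦ ν.real (initialSet a t)) a b J) {τ : ℝ}
    (hτ : 0 < τ) : ν {x | x ∈ Set.Icc a b ∧ OscillatesAt f a b τ x} = 0 := by
  set S := {x | x ∈ Set.Icc a b ∧ OscillatesAt f a b τ x} with hS
  have key : ∀ ε > 0, ν.real S ≤ 2 * ε / τ := by
    intro ε hε
    obtain ⟨δ, hδ, hsum⟩ := hf ε hε
    obtain ⟨N, t, ht0, htN, hstep, hnull⟩ :=
      exists_partition (dense_measure_singleton_eq_zero ν) hab hδ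
    set cell : ℕ → Set ℝ := fun i ↦ initialSet a (t (i + 1)) \ initialSet a (t i) with hcell
    set bad : ℕ → Prop := fun i ↦ ∃ y ∈ Set.Icc (t i) (t (i + 1)), ∃ y' ∈ Set.Icc (t i) (t (i + 1)),
      τ ≤ f y - f y' with hbad
    have htag : ∀ i, ∃ ξ ξ' : ℝ, i < N → ξ ∈ Set.Icc (t i) (t (i + 1)) ∧ ξ' ∈ Set.Icc (t i) (t (i + 1)) ∧
        (bad i → τ ≤ f ξ - f ξ') ∧ 0 ≤ f ξ - f ξ' := fun i ↦ by
      by_cases hb : bad i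
      · obtain ⟨y, hy, y', hy', hyy⟩ := hb
        exact ⟨y, y', fun _ ↦ ⟨hy, hy', fun _ ↦ hyy, by linarith⟩⟩
      · refine ⟨t i, t i, fun hi ↦ ⟨Set.left_mem_Icc.2 (hstep i hi).1, Set.left_mem_Icc.2 (hstep i hi).1,
          fun h ↦ absurd h hb, by simp⟩⟩
    choose ξ ξ' hξ using htag
    have h1 := hsum N t ξ ht0 htN fun i hi ↦ ⟨(hξ i hi).1.1, (hξ i hi).1.2, (hstep i hi).2⟩
    have h2 := hsum N t ξ' ht0 htN fun i hi ↦ ⟨(hξ i hi).2.1.1, (hξ i hi).2.1.2, (hstep i hi).2⟩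
    classical
    have h3 : τ * ∑ i ∈ (Finset.range N).filter bad, ν.real (cell i) ≤ 2 * ε := by
      have h4 : τ * ∑ i ∈ (Finset.range N).filter bad, ν.real (cell i) ≤
          ∑ i ∈ Finset.range N, (f (ξ i) - f (ξ' i)) * ν.real (cell i) := by
        rw [Finset.mul_sum, Finset.sum_filter]
        refine Finset.sum_le_sum fun i hi ↦ ?_
        have hi' := hξ i (Finset.mem_range.1 hi)
        split_ifs with hb
        · exact mul_le_mul_of_nonneg_right (hi'.2.2.1 hb) measureReal_nonneg
        · exact mul_nonneg hi'.2.2.2 measureReal_nonneg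
      refine h4.trans ?_
      have h5 : ∑ i ∈ Finset.range N, (f (ξ i) - f (ξ' i)) * ν.real (cell i) =
          ∑ i ∈ Finset.range N, f (ξ i) *
            (ν.real (initialSet a (t (i + 1))) - ν.real (initialSet a (t i))) -
          ∑ i ∈ Finset.range N, f (ξ' i) *
            (ν.real (initialSet a (t (i + 1))) - ν.real (initialSet a (t i))) := by
        rw [← Finset.sum_sub_distrib]
        refine Finset.sum_congr rfl fun i hi ↦ ?_
        rw [measureReal_initialSet_sub ν a (hstep i (Finset.mem_range.1 hi)).1]
        ring
      rw [h5]
      linarith [(abs_lt.1 h1).2, (abs_lt.1 h2).1]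
    have hcover : S ⊆ (⋃ i ∈ (Finset.range (N + 1)).filter (fun i ↦ ν {t i} = 0), {t i}) ∪
        ⋃ i ∈ (Finset.range N).filter bad, cell i := by
      rintro x ⟨hx, hosc⟩
      by_cases hxt : ∃ i ≤ N, ν {t i} = 0 ∧ x = t i
      · obtain ⟨i, hi, hν, rfl⟩ := hxt
        left
        simp only [Set.mem_iUnion, Finset.mem_filter, Finset.mem_range]
        exact ⟨i, ⟨by omega, hν⟩, rfl⟩
      push Not at hxt
      right
      -- The least such `j` ends the cell that contains `x`.
      have hex : ∃ j, x ∈ initialSet a (t j) := ⟨N, by rwa [htN, initialSet, if_neg (not_le.2 hab)]⟩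
      have hj0 : Nat.find hex ≠ 0 := fun h0 ↦ by
        have := Nat.find_spec hex
        rw [h0, ht0, initialSet, if_pos le_rfl] at this
        exact this
      obtain ⟨i, hi⟩ := Nat.exists_eq_succ_of_ne_zero hj0
      have hjN : Nat.find hex ≤ N :=
        Nat.find_min' hex (by rwa [htN, initialSet, if_neg (not_le.2 hab)])
      have hin : x ∈ initialSet a (t (i + 1)) := by
        have := Nat.find_spec hex
        rwa [hi] at this
      have hout : x ∉ initialSet a (t i) := Nat.find_min hex (by omega)
      have hiN : i < N := by omega
      have hxI := initialSet_subset _ _ hin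
      have hlow : t i ≤ a ∨ t i < x := by
        by_contra! hcon
        refine hout ?_
        rw [initialSet, if_neg (not_le.2 hcon.1)]
        exact ⟨hxI.1, hcon.2⟩
      have hupp : t (i + 1) = b ∨ x < t (i + 1) := by
        rcases hnull (i + 1) with h | h | h
        · rw [h, initialSet, if_pos le_rfl] at hin
          exact absurd hin (Set.notMem_empty x)
        · exact Or.inl h
        · exact Or.inr (lt_of_le_of_ne hxI.2 (hxt (i + 1) (by omega) h))
      -- At an end point of `[a, b]` one inequality can be dropped, because the oscillation is taken
      -- within `[a, b]`. This keeps possible atoms at `a` and `b` under control.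
      have hU : {y | (t i ≤ a ∨ t i < y) ∧ (t (i + 1) = b ∨ y < t (i + 1))} ∈ nhds x := by
        refine Filter.inter_mem ?_ ?_
        · rcases hlow with h | h
          · exact Filter.univ_mem' fun y ↦ Or.inl h
          · exact Filter.mem_of_superset (Ioi_mem_nhds h) fun y hy ↦ Or.inr hy
        · rcases hupp with h | h
          · exact Filter.univ_mem' fun y ↦ Or.inl h
          · exact Filter.mem_of_superset (Iio_mem_nhds h) fun y hy ↦ Or.inr hy
      have hsub : ∀ y, y ∈ {y | (t i ≤ a ∨ t i < y) ∧ (t (i + 1) = b ∨ y < t (i + 1))} ∩ Set.Icc a b →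
          y ∈ Set.Icc (t i) (t (i + 1)) := by
        rintro y ⟨⟨h1, h2⟩, hyI⟩
        refine ⟨?_, ?_⟩
        · rcases h1 with h | h
          · exact h.trans hyI.1
          · exact h.le
        · rcases h2 with h | h
          · exact h ▸ hyI.2
          · exact h.le
      obtain ⟨y, hy, y', hy', hyy⟩ := hosc _ hU
      simp only [Set.mem_iUnion, Finset.mem_filter, Finset.mem_range]
      exact ⟨i, ⟨hiN, y, hsub y hy, y', hsub y' hy', hyy⟩, hin, hout⟩
    have h6 : ν.real S ≤ ∑ i ∈ (Finset.range N).filter bad, ν.real (cell i) := by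
      refine (measureReal_mono hcover).trans ((measureReal_union_le _ _).trans ?_)
      have hz : ν.real (⋃ i ∈ (Finset.range (N + 1)).filter (fun i ↦ ν {t i} = 0), {t i}) = 0 := by
        refine le_antisymm ((measureReal_biUnion_finset_le _ _).trans_eq
          (Finset.sum_eq_zero fun i hi ↦ ?_)) measureReal_nonneg
        rw [measureReal_def, (Finset.mem_filter.1 hi).2, ENNReal.toReal_zero]
      rw [hz, zero_add]
      exact measureReal_biUnion_finset_le _ _
    rw [le_div_iff₀ hτ, mul_comm]
    exact (mul_le_mul_of_nonneg_left h6 hτ.le).trans h3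
  have h0 : ν.real S ≤ 0 := by
    refine le_of_forall_pos_le_add fun ε hε ↦ ?_
    have := key (ε * τ / 2) (by positivity)
    rw [zero_add]
    refine this.trans_eq ?_
    field_simp
  exact (measureReal_eq_zero_iff (measure_ne_top ν S)).1 (le_antisymm h0 measureReal_nonneg)

theorem HasRSIntegral.ae_continuousWithinAt {ν : Measure ℝ} [IsFiniteMeasure ν] {a b : ℝ} (hab : a < b)
    (hν : ν (Set.Icc a b)ᶜ = 0) {f : ℝ → ℝ} {J : ℝ}
    (hf : HasRSIntegral f (fun t ↦ ν.real (initialSet a t)) a b J) :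
    ∀ᵐ x ∂ν, ContinuousWithinAt f (Set.Icc a b) x := by
  refine measure_mono_null (t := (Set.Icc a b)ᶜ ∪
    ⋃ n : ℕ, {x | x ∈ Set.Icc a b ∧ OscillatesAt f a b (1 / ((n : ℝ) + 1)) x}) ?_
    (measure_union_null hν (measure_iUnion_null fun n ↦
      measure_oscillatesAt_eq_zero hab hf (by positivity)))
  intro x hx
  by_cases hxI : x ∈ Set.Icc a b
  · obtain ⟨n, hn⟩ := exists_oscillatesAt hxI hx
    exact Or.inr (Set.mem_iUnion.2 ⟨n, hxI, hn⟩)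
  · exact Or.inl hxI

/-! ### Sandwiching by continuous functions -/

/-- The largest `n`-Lipschitz function below `f` on `[a, b]`. -/
def lowerEnvelope (a b : ℝ) (f : ℝ → ℝ) (n : ℕ) (x : ℝ) : ℝ :=
  ⨅ y : Set.Icc a b, (f y + n * |x - y|)

section lowerEnvelope

variable {a b : ℝ} {f : ℝ → ℝ} {M : ℝ}

theorem bddBelow_lowerEnvelope (hM : ∀ t ∈ Set.Icc a b, |f t| ≤ M) (n : ℕ) (x : ℝ) :
    BddBelow (Set.range fun y : Set.Icc a b ↦ f y + n * |x - y|) := by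
  refine ⟨-M, ?_⟩
  rintro _ ⟨y, rfl⟩
  have h1 := (abs_le.1 (hM y y.2)).1
  have h2 : 0 ≤ (n : ℝ) * |x - y| := by positivity
  simp only
  linarith

theorem lowerEnvelope_le (hM : ∀ t ∈ Set.Icc a b, |f t| ≤ M) (n : ℕ) {x : ℝ}
    (hx : x ∈ Set.Icc a b) : lowerEnvelope a b f n x ≤ f x :=
  (ciInf_le (bddBelow_lowerEnvelope hM n x) ⟨x, hx⟩).trans_eq (by simp)

theorem neg_le_lowerEnvelope (hM : ∀ t ∈ Set.Icc a b, |f t| ≤ M) (hab : a ≤ b) (n : ℕ) (x : ℝ) :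
    -M ≤ lowerEnvelope a b f n x := by
  have : Nonempty (Set.Icc a b) := ⟨⟨a, Set.left_mem_Icc.2 hab⟩⟩
  refine le_ciInf fun y ↦ ?_
  have h1 := (abs_le.1 (hM y y.2)).1
  have h2 : 0 ≤ (n : ℝ) * |x - y| := by positivity
  linarith

theorem continuous_lowerEnvelope (hM : ∀ t ∈ Set.Icc a b, |f t| ≤ M) (hab : a ≤ b) (n : ℕ) :
    Continuous (lowerEnvelope a b f n) := by
  have : Nonempty (Set.Icc a b) := ⟨⟨a, Set.left_mem_Icc.2 hab⟩⟩
  refine (LipschitzWith.of_le_add_mul n fun x x' ↦ ?_).continuous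
  rw [← sub_le_iff_le_add]
  refine le_ciInf fun y ↦ ?_
  have h1 : lowerEnvelope a b f n x ≤ f y + n * |x - y| := ciInf_le (bddBelow_lowerEnvelope hM n x) y
  have h2 := abs_sub_le x x' y
  have h3 : (n : ℝ) * |x - y| ≤ n * (|x - x'| + |x' - y|) := by gcongr
  rw [Real.dist_eq]
  push_cast
  linarith

theorem tendsto_lowerEnvelope (hM : ∀ t ∈ Set.Icc a b, |f t| ≤ M) {x : ℝ} (hx : x ∈ Set.Icc a b)
    (hc : ContinuousWithinAt f (Set.Icc a b) x) :
    Filter.Tendsto (fun n ↦ lowerEnvelope a b f n x) Filter.atTop (nhds (f x)) := by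
  have hne : Nonempty (Set.Icc a b) := ⟨⟨x, hx⟩⟩
  rw [Metric.tendsto_atTop]
  intro ε hε
  obtain ⟨δ, hδ, hcδ⟩ := Metric.continuousWithinAt_iff.1 hc (ε / 2) (by positivity)
  obtain ⟨n₀, hn₀⟩ := exists_nat_gt (2 * M / δ)
  refine ⟨n₀, fun n hn ↦ ?_⟩
  have h1 := lowerEnvelope_le hM n hx
  have h2 : f x - ε / 2 ≤ lowerEnvelope a b f n x := by
    refine le_ciInf fun y ↦ ?_
    -- Near `x` continuity bounds `f y` from below; farther away the penalty `n * |x - y|` is at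
    -- least `2 * M`.
    by_cases hy : dist (y : ℝ) x < δ
    · have := hcδ y.2 hy
      rw [Real.dist_eq] at this
      have h3 : 0 ≤ (n : ℝ) * |x - y| := by positivity
      linarith [(abs_lt.1 this).1]
    · rw [not_lt, dist_comm, Real.dist_eq] at hy
      have h3 : (n₀ : ℝ) ≤ n := by exact_mod_cast hn
      rw [div_lt_iff₀ hδ] at hn₀
      have h4 : 2 * M ≤ n * |x - y| :=
        hn₀.le.trans (mul_le_mul h3 hy hδ.le (by positivity))
      linarith [(abs_le.1 (hM y y.2)).1, (abs_le.1 (hM x hx)).2]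
  rw [Real.dist_eq, abs_lt]
  constructor <;> linarith

end lowerEnvelope

/-- On `[a, b]`, `f` lies between continuous functions with integrals arbitrarily close. -/
def IsSandwiched (ν : Measure ℝ) (a b : ℝ) (f : ℝ → ℝ) : Prop :=
  ∀ η > 0, ∃ g h : ℝ → ℝ, Continuous g ∧ Continuous h ∧
    (∀ x ∈ Set.Icc a b, g x ≤ f x ∧ f x ≤ h x) ∧
    ∫ x, f x ∂ν - η < ∫ x, g x ∂ν ∧ ∫ x, h x ∂ν < ∫ x, f x ∂ν + η

theorem integrable_and_tendsto_lowerEnvelope {ν : Measure ℝ} [IsFiniteMeasure ν] {a b : ℝ}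
    (hab : a ≤ b) (hν : ν (Set.Icc a b)ᶜ = 0) {f : ℝ → ℝ} {M : ℝ} (hM : ∀ t ∈ Set.Icc a b, |f t| ≤ M)
    (hc : ∀ᵐ x ∂ν, ContinuousWithinAt f (Set.Icc a b) x) : Integrable f ν ∧
      Filter.Tendsto (fun n ↦ ∫ x, lowerEnvelope a b f n x ∂ν) Filter.atTop (nhds (∫ x, f x ∂ν)) := by
  have hae : ∀ᵐ t ∂ν, t ∈ Set.Icc a b := mem_ae_iff.2 hν
  have hlim : ∀ᵐ x ∂ν, Filter.Tendsto (fun n ↦ lowerEnvelope a b f n x) Filter.atTop (nhds (f x)) := by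
    filter_upwards [hae, hc] with x hx hcx
    exact tendsto_lowerEnvelope hM hx hcx
  have hmeas : ∀ n, AEStronglyMeasurable (lowerEnvelope a b f n) ν := fun n ↦
    (continuous_lowerEnvelope hM hab n).aestronglyMeasurable
  refine ⟨Integrable.of_bound (aestronglyMeasurable_of_tendsto_ae _ hmeas hlim) M
    (hae.mono fun x hx ↦ hM x hx), ?_⟩
  refine tendsto_integral_of_dominated_convergence (fun _ ↦ M) hmeas (integrable_const M)
    (fun n ↦ hae.mono fun x hx ↦ ?_) hlim
  rw [Real.norm_eq_abs, abs_le]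
  exact ⟨neg_le_lowerEnvelope hM hab n x,
    (lowerEnvelope_le hM n hx).trans (abs_le.1 (hM x hx)).2⟩

theorem isSandwiched_of_ae_continuousWithinAt {ν : Measure ℝ} [IsFiniteMeasure ν] {a b : ℝ}
    (hab : a ≤ b) (hν : ν (Set.Icc a b)ᶜ = 0) {f : ℝ → ℝ} {M : ℝ} (hM : ∀ t ∈ Set.Icc a b, |f t| ≤ M)
    (hc : ∀ᵐ x ∂ν, ContinuousWithinAt f (Set.Icc a b) x) : IsSandwiched ν a b f := by
  intro η hη
  have hM' : ∀ t ∈ Set.Icc a b, |(-f) t| ≤ M := fun t ht ↦ by simpa using hM t ht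
  have h1 := (integrable_and_tendsto_lowerEnvelope hab hν hM hc).2
  have h2 := (integrable_and_tendsto_lowerEnvelope hab hν hM' (hc.mono fun x hx ↦ hx.neg)).2
  simp only [Pi.neg_apply, integral_neg] at h2
  obtain ⟨n, hn1, hn2⟩ := ((h1.eventually_const_lt (sub_lt_self _ hη)).and
    (h2.eventually_const_lt (sub_lt_self _ hη))).exists
  refine ⟨lowerEnvelope a b f n, fun x ↦ -lowerEnvelope a b (-f) n x, continuous_lowerEnvelope hM hab n,
    (continuous_lowerEnvelope hM' hab n).neg, fun x hx ↦ ⟨lowerEnvelope_le hM n hx, ?_⟩, hn1, ?_⟩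
  · have := lowerEnvelope_le hM' n hx
    simp only [Pi.neg_apply] at this
    linarith
  · rw [integral_neg]
    linarith

/-! ### Riemann–Stieltjes sums of continuous and of sandwiched functions -/

theorem abs_sum_sub_setIntegral_le {ν : Measure ℝ} [IsFiniteMeasure ν] {a b : ℝ}
    {g : ℝ → ℝ} {ε δ : ℝ}
    (hosc : ∀ x ∈ Set.Icc a b, ∀ y ∈ Set.Icc a b, |x - y| < δ → |g x - g y| ≤ ε) (hgi : Integrable g ν)
    {t ξ : ℕ → ℝ} (ht0 : t 0 = a) (n : ℕ)
    (hstep : ∀ i < n, t i ≤ ξ i ∧ ξ i ≤ t (i + 1) ∧ t (i + 1) - t i < δ)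
    (hmem : ∀ i ≤ n, t i ∈ Set.Icc a b) :
    |∑ i ∈ Finset.range n, g (ξ i) * (ν.real (initialSet a (t (i + 1))) - ν.real (initialSet a (t i))) -
      ∫ x in initialSet a (t n), g x ∂ν| ≤ ε * ν.real (initialSet a (t n)) := by
  induction n with
  | zero => simp [ht0, initialSet]
  | succ n ih =>
    have ih' := ih (fun i hi ↦ hstep i (by omega)) (fun i hi ↦ hmem i (by omega))
    obtain ⟨h1, h2, h3⟩ := hstep n (Nat.lt_succ_self n)
    have hle := h1.trans h2
    set A := initialSet a (t n) with hA
    set B := initialSet a (t (n + 1)) with hB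
    have hAB : A ⊆ B := initialSet_mono a hle
    have hAm := measurableSet_initialSet a (t n)
    have hBm := measurableSet_initialSet a (t (n + 1))
    have hd : ∫ x in B \ A, g x ∂ν = ∫ x in B, g x ∂ν - ∫ x in A, g x ∂ν :=
      setIntegral_sdiff hAm hgi.integrableOn hAB
    have hw := measureReal_initialSet_sub ν a hle
    have hcell : |g (ξ n) * ν.real (B \ A) - ∫ x in B \ A, g x ∂ν| ≤ ε * ν.real (B \ A) := by
      have e : g (ξ n) * ν.real (B \ A) - ∫ x in B \ A, g x ∂ν = ∫ x in B \ A, (g (ξ n) - g x) ∂ν := by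
        rw [integral_sub (integrable_const _) hgi.integrableOn, setIntegral_const, smul_eq_mul, mul_comm]
      rw [e, ← Real.norm_eq_abs]
      refine norm_setIntegral_le_of_norm_le_const (measure_lt_top _ _) fun x hx ↦ ?_
      have hx1 := initialSet_diff_subset _ _ _ hx
      have hn0 := hmem n (by omega)
      have hn1 := hmem (n + 1) le_rfl
      refine hosc _ ⟨hn0.1.trans h1, h2.trans hn1.2⟩ _ ⟨hn0.1.trans hx1.1, hx1.2.trans hn1.2⟩ ?_
      rw [abs_lt]
      constructor <;> linarith [hx1.1, hx1.2]
    rw [Finset.sum_range_succ, hw]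
    have hw' : ν.real B = ν.real A + ν.real (B \ A) := by rw [← hw]; ring
    rw [hw']
    have e2 : ∑ i ∈ Finset.range n, g (ξ i) *
        (ν.real (initialSet a (t (i + 1))) - ν.real (initialSet a (t i))) +
          g (ξ n) * ν.real (B \ A) - ∫ x in B, g x ∂ν =
        (∑ i ∈ Finset.range n, g (ξ i) *
          (ν.real (initialSet a (t (i + 1))) - ν.real (initialSet a (t i))) - ∫ x in A, g x ∂ν) +
        (g (ξ n) * ν.real (B \ A) - ∫ x in B \ A, g x ∂ν) := by
      rw [hd]
      ring
    rw [e2, mul_add]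
    exact (abs_add_le _ _).trans (add_le_add ih' hcell)

theorem hasRSIntegral_of_continuous {ν : Measure ℝ} [IsFiniteMeasure ν] {a b : ℝ} (hab : a < b)
    (hν : ν (Set.Icc a b)ᶜ = 0) {g : ℝ → ℝ} (hg : Continuous g) :
    HasRSIntegral g (fun t ↦ ν.real (initialSet a t)) a b (∫ x, g x ∂ν) := by
  intro ε hε
  have hae : ∀ᵐ t ∂ν, t ∈ Set.Icc a b := mem_ae_iff.2 hν
  have huc := (isCompact_Icc (a := a) (b := b)).uniformContinuousOn_of_continuous hg.continuousOn
  rw [Metric.uniformContinuousOn_iff] at huc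
  obtain ⟨δ, hδ, hosc⟩ := huc (ε / (ν.real Set.univ + 1)) (by positivity)
  refine ⟨δ, hδ, fun N t ξ ht0 htN hstep ↦ ?_⟩
  have hmono : ∀ i j, i ≤ j → j ≤ N → t i ≤ t j := fun i j hij ↦ by
    induction j, hij using Nat.le_induction with
    | base => exact fun _ ↦ le_rfl
    | succ j hij ih =>
      exact fun hj ↦ (ih (by omega)).trans ((hstep j (by omega)).1.trans (hstep j (by omega)).2.1)
  have key := abs_sum_sub_setIntegral_le (ν := ν) (ε := ε / (ν.real Set.univ + 1))
    (fun x hx y hy hxy ↦ (hosc x hx y hy hxy).le)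
    (integrable_of_continuousOn_Icc hν hg.continuousOn) ht0 N hstep
    (fun i hi ↦ ⟨ht0 ▸ hmono 0 i (Nat.zero_le i) hi, htN ▸ hmono i N hi le_rfl⟩)
  rw [htN, initialSet, if_neg (not_le.2 hab), Measure.restrict_eq_self_of_ae_mem hae] at key
  refine key.trans_lt ?_
  have h1 : ν.real (Set.Icc a b) ≤ ν.real Set.univ := measureReal_mono (Set.subset_univ _)
  have h0 : (0 : ℝ) ≤ ν.real Set.univ := measureReal_nonneg
  rw [div_mul_eq_mul_div, div_lt_iff₀ (by linarith)]
  nlinarith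

theorem IsSandwiched.hasRSIntegral {ν : Measure ℝ} [IsFiniteMeasure ν] {a b : ℝ} (hab : a < b)
    (hν : ν (Set.Icc a b)ᶜ = 0) {f : ℝ → ℝ} (hf : IsSandwiched ν a b f) :
    HasRSIntegral f (fun t ↦ ν.real (initialSet a t)) a b (∫ x, f x ∂ν) := by
  intro ε hε
  obtain ⟨g, h, hg, hh, hgh, hg1, hh1⟩ := hf (ε / 2) (by positivity)
  obtain ⟨δ₁, hδ₁, hs₁⟩ := hasRSIntegral_of_continuous hab hν hg (ε / 2) (by positivity)
  obtain ⟨δ₂, hδ₂, hs₂⟩ := hasRSIntegral_of_continuous hab hν hh (ε / 2) (by positivity)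
  refine ⟨min δ₁ δ₂, lt_min hδ₁ hδ₂, fun N t ξ ht0 htN hstep ↦ ?_⟩
  have hmono : ∀ i j, i ≤ j → j ≤ N → t i ≤ t j := fun i j hij ↦ by
    induction j, hij using Nat.le_induction with
    | base => exact fun _ ↦ le_rfl
    | succ j hij ih =>
      exact fun hj ↦ (ih (by omega)).trans ((hstep j (by omega)).1.trans (hstep j (by omega)).2.1)
  have h1 := hs₁ N t ξ ht0 htN fun i hi ↦
    ⟨(hstep i hi).1, (hstep i hi).2.1, (hstep i hi).2.2.trans_le (min_le_left _ _)⟩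
  have h2 := hs₂ N t ξ ht0 htN fun i hi ↦
    ⟨(hstep i hi).1, (hstep i hi).2.1, (hstep i hi).2.2.trans_le (min_le_right _ _)⟩
  have hξ : ∀ i < N, ξ i ∈ Set.Icc a b := fun i hi ↦
    ⟨(ht0 ▸ hmono 0 i (Nat.zero_le i) hi.le).trans (hstep i hi).1,
      (hstep i hi).2.1.trans (htN ▸ hmono (i + 1) N (by omega) le_rfl)⟩
  have hw : ∀ i < N, 0 ≤ ν.real (initialSet a (t (i + 1))) - ν.real (initialSet a (t i)) :=
    fun i hi ↦ sub_nonneg.2 (measureReal_mono (initialSet_mono a ((hstep i hi).1.trans (hstep i hi).2.1)))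
  have l1 : ∑ i ∈ Finset.range N, g (ξ i) *
      (ν.real (initialSet a (t (i + 1))) - ν.real (initialSet a (t i))) ≤ ∑ i ∈ Finset.range N, f (ξ i) *
      (ν.real (initialSet a (t (i + 1))) - ν.real (initialSet a (t i))) :=
    Finset.sum_le_sum fun i hi ↦ mul_le_mul_of_nonneg_right
      (hgh _ (hξ i (Finset.mem_range.1 hi))).1 (hw i (Finset.mem_range.1 hi))
  have l2 : ∑ i ∈ Finset.range N, f (ξ i) *
      (ν.real (initialSet a (t (i + 1))) - ν.real (initialSet a (t i))) ≤ ∑ i ∈ Finset.range N, h (ξ i) *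
      (ν.real (initialSet a (t (i + 1))) - ν.real (initialSet a (t i))) :=
    Finset.sum_le_sum fun i hi ↦ mul_le_mul_of_nonneg_right
      (hgh _ (hξ i (Finset.mem_range.1 hi))).2 (hw i (Finset.mem_range.1 hi))
  rw [abs_lt] at h1 h2 ⊢
  constructor <;> linarith [h1.1, h2.2]

/-! ### Convergence of quadrature formulas with nonnegative weights -/

theorem tendsto_quadrature_of_continuous {ν : Measure ℝ} [IsFiniteMeasure ν] {a b : ℝ}
    (hν : ν (Set.Icc a b)ᶜ = 0) {Z : ℕ → Finset ℝ} {w : ℕ → ℝ → ℝ}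
    (hZ : ∀ N, ∀ z ∈ Z N, z ∈ Set.Icc a b) (hw : ∀ N, ∀ z ∈ Z N, 0 ≤ w N z)
    (hexact : ∀ p : ℝ[X], ∀ᶠ N in Filter.atTop, ∑ z ∈ Z N, w N z * p.eval z = ∫ x, p.eval x ∂ν)
    {g : ℝ → ℝ} (hg : Continuous g) :
    Filter.Tendsto (fun N ↦ ∑ z ∈ Z N, w N z * g z) Filter.atTop (nhds (∫ x, g x ∂ν)) := by
  have hae : ∀ᵐ t ∂ν, t ∈ Set.Icc a b := mem_ae_iff.2 hν
  rw [Metric.tendsto_nhds]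
  intro ε hε
  set A := ν.real Set.univ with hA
  have hA0 : 0 ≤ A := measureReal_nonneg
  obtain ⟨p, hp⟩ := exists_polynomial_near_of_continuousOn a b g hg.continuousOn
    (ε / (2 * (A + 1))) (by positivity)
  filter_upwards [hexact p, hexact 1] with N h1 h2
  -- Exactness on the constant `1` fixes the total weight, so uniform approximation by polynomials
  -- suffices.
  have hsum : ∑ z ∈ Z N, w N z = A := by simpa using h2
  have e1 : |∑ z ∈ Z N, w N z * g z - ∑ z ∈ Z N, w N z * p.eval z| ≤ A * (ε / (2 * (A + 1))) := by
    refine le_of_le_of_eq ?_ (congrArg (· * (ε / (2 * (A + 1)))) hsum)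
    rw [← Finset.sum_sub_distrib, Finset.sum_mul]
    refine (Finset.abs_sum_le_sum_abs _ _).trans (Finset.sum_le_sum fun z hz ↦ ?_)
    rw [← mul_sub, abs_mul, abs_of_nonneg (hw N z hz), abs_sub_comm]
    exact mul_le_mul_of_nonneg_left (hp z (hZ N z hz)).le (hw N z hz)
  have e2 : |∫ x, p.eval x ∂ν - ∫ x, g x ∂ν| ≤ ε / (2 * (A + 1)) * A := by
    rw [← integral_sub (integrable_of_continuousOn_Icc hν p.continuous.continuousOn)
      (integrable_of_continuousOn_Icc hν hg.continuousOn), ← Real.norm_eq_abs]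
    exact norm_integral_le_of_norm_le_const (hae.mono fun x hx ↦ (hp x hx).le)
  rw [h1] at e1
  have e3 : A * (ε / (2 * (A + 1))) < ε / 2 := by
    rw [mul_div_assoc', div_lt_div_iff₀ (by positivity) (by positivity)]
    nlinarith
  rw [Real.dist_eq]
  have := abs_sub_le (∑ z ∈ Z N, w N z * g z) (∫ x, p.eval x ∂ν) (∫ x, g x ∂ν)
  rw [mul_comm] at e2
  linarith

/-- Nonnegative weights make the quadrature monotone, which squeezes it between those of the two
continuous functions. -/
theorem IsSandwiched.tendsto_quadrature {ν : Measure ℝ} [IsFiniteMeasure ν] {a b : ℝ}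
    (hν : ν (Set.Icc a b)ᶜ = 0) {Z : ℕ → Finset ℝ} {w : ℕ → ℝ → ℝ}
    (hZ : ∀ N, ∀ z ∈ Z N, z ∈ Set.Icc a b) (hw : ∀ N, ∀ z ∈ Z N, 0 ≤ w N z)
    (hexact : ∀ p : ℝ[X], ∀ᶠ N in Filter.atTop, ∑ z ∈ Z N, w N z * p.eval z = ∫ x, p.eval x ∂ν)
    {f : ℝ → ℝ} (hf : IsSandwiched ν a b f) :
    Filter.Tendsto (fun N ↦ ∑ z ∈ Z N, w N z * f z) Filter.atTop (nhds (∫ x, f x ∂ν)) := by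
  rw [Metric.tendsto_nhds]
  intro ε hε
  obtain ⟨g, h, hg, hh, hgh, hg1, hh1⟩ := hf (ε / 2) (by positivity)
  have t1 := tendsto_quadrature_of_continuous hν hZ hw hexact hg
  have t2 := tendsto_quadrature_of_continuous hν hZ hw hexact hh
  filter_upwards [t1.eventually_const_lt (sub_lt_self _ (half_pos hε)),
    t2.eventually_lt_const (lt_add_of_pos_right _ (half_pos hε))] with N h1 h2
  have l1 : ∑ z ∈ Z N, w N z * g z ≤ ∑ z ∈ Z N, w N z * f z := Finset.sum_le_sum fun z hz ↦
    mul_le_mul_of_nonneg_left (hgh z (hZ N z hz)).1 (hw N z hz)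
  have l2 : ∑ z ∈ Z N, w N z * f z ≤ ∑ z ∈ Z N, w N z * h z := Finset.sum_le_sum fun z hz ↦
    mul_le_mul_of_nonneg_left (hgh z (hZ N z hz)).2 (hw N z hz)
  rw [Real.dist_eq, abs_lt]
  constructor <;> linarith

/-! ### Signed measures of constant sign -/

theorem variation_smul_toSignedMeasure {ν : Measure ℝ} [IsFiniteMeasure ν] {θ : ℝ}
    (hθ : θ = 1 ∨ θ = -1) : (θ • ν.toSignedMeasure).variation = ν := by
  rcases hθ with rfl | rfl
  · rw [one_smul, Measure.variation_toSignedMeasure]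
  · simp [VectorMeasure.variation_smul]

theorem integral_smul_toSignedMeasure {G : Type*} [NormedAddCommGroup G] [NormedSpace ℝ G]
    {ν : Measure ℝ} [IsFiniteMeasure ν] (θ : ℝ) (f : ℝ → G) :
    ∫ᵛ x, f x ∂<•(θ • ν.toSignedMeasure) = θ • ∫ x, f x ∂ν := by
  rw [VectorMeasure.integral_smul_vectorMeasure, VectorMeasure.integral_toSignedMeasure]

theorem exists_eq_smul_toSignedMeasure {s : SignedMeasure ℝ} (hs : 0 ≤ s ∨ s ≤ 0) :
    ∃ (_ : IsFiniteMeasure s.variation) (θ : ℝ), (θ = 1 ∨ θ = -1) ∧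
      s = θ • s.variation.toSignedMeasure := by
  have key : ∀ (ν : Measure ℝ) [IsFiniteMeasure ν] (θ : ℝ), (θ = 1 ∨ θ = -1) →
      s = θ • ν.toSignedMeasure → ∃ (_ : IsFiniteMeasure s.variation) (θ : ℝ), (θ = 1 ∨ θ = -1) ∧
      s = θ • s.variation.toSignedMeasure := fun ν _ θ hθ h ↦ by
    have hv : s.variation = ν := by rw [h, variation_smul_toSignedMeasure hθ]
    have hfin : IsFiniteMeasure s.variation := by rw [hv]; infer_instance
    refine ⟨hfin, θ, hθ, ?_⟩
    rw [Measure.toSignedMeasure_congr hv]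
    exact h
  rcases hs with h | h
  · have h' := (VectorMeasure.le_restrict_univ_iff_le (0 : SignedMeasure ℝ) s).2 h
    refine key (s.toMeasureOfZeroLE Set.univ MeasurableSet.univ h') 1 (Or.inl rfl) ?_
    rw [SignedMeasure.toMeasureOfZeroLE_toSignedMeasure, one_smul]
  · have h' := (VectorMeasure.le_restrict_univ_iff_le s (0 : SignedMeasure ℝ)).2 h
    refine key (s.toMeasureOfLEZero Set.univ MeasurableSet.univ h') (-1) (Or.inr rfl) ?_
    rw [SignedMeasure.toMeasureOfLEZero_toSignedMeasure]
    ext i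
    simp

theorem withDensity_smul_toSignedMeasure {μ : Measure ℝ} [IsFiniteMeasure μ] {θ : ℝ} {f : ℝ → ℝ}
    (hθ : θ = 1 ∨ θ = -1) (hf : Integrable f μ) :
    (θ • μ.toSignedMeasure).withDensity f (ContinuousLinearMap.mul ℝ ℝ) = θ • μ.withDensityᵥ f := by
  have hB : ContinuousLinearMap.mul ℝ ℝ = (ContinuousLinearMap.lsmul ℝ ℝ).flip := by
    ext
    simp
  have hfi : (θ • μ.toSignedMeasure).Integrable f := by
    rw [VectorMeasure.Integrable, variation_smul_toSignedMeasure hθ]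
    exact hf
  ext s hs
  rw [VectorMeasure.withDensity_apply hfi, VectorMeasure.restrict_smul,
    VectorMeasure.restrict_toSignedMeasure hs, hB, integral_smul_toSignedMeasure,
    _root_.smul_apply, withDensityᵥ_apply hf hs]

/-- The positive measure with density `|g|` with respect to `μ`. -/
def absDensity (μ : Measure ℝ) (g : ℝ → ℝ) : Measure ℝ :=
  μ.withDensity fun x ↦ ENNReal.ofReal |g x|

theorem isFiniteMeasure_absDensity {μ : Measure ℝ} {g : ℝ → ℝ} (hg : Integrable g μ) :
    IsFiniteMeasure (absDensity μ g) :=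
  isFiniteMeasure_withDensity_ofReal hg.abs.2

theorem integral_absDensity {G : Type*} [NormedAddCommGroup G] [NormedSpace ℝ G] {μ : Measure ℝ}
    {g : ℝ → ℝ} (hg : Integrable g μ) (f : ℝ → G) :
    ∫ x, f x ∂absDensity μ g = ∫ x, |g x| • f x ∂μ := by
  rw [absDensity, integral_withDensity_eq_integral_toReal_smul₀
    hg.abs.aemeasurable.ennreal_ofReal (by simp)]
  simp

theorem withDensityᵥ_eq_smul_absDensity {μ : Measure ℝ} {g : ℝ → ℝ}
    (hg : Integrable g μ) {κ : ℝ} (hκ : κ = 1 ∨ κ = -1) (hsign : ∀ᵐ x ∂μ, |g x| = κ * g x)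
    [IsFiniteMeasure (absDensity μ g)] :
    μ.withDensityᵥ g = κ • (absDensity μ g).toSignedMeasure := by
  ext s hs
  rw [withDensityᵥ_apply hg hs, _root_.smul_apply, Measure.toSignedMeasure_apply_measurable hs,
    measureReal_def, absDensity, MeasureTheory.withDensity_apply _ hs,
    ← integral_eq_lintegral_of_nonneg_ae (Filter.Eventually.of_forall fun x ↦ abs_nonneg _)
      hg.abs.aestronglyMeasurable.restrict, integral_congr_ae (ae_restrict_of_ae hsign),
    integral_const_mul, smul_eq_mul, ← mul_assoc]
  rcases hκ with rfl | rfl <;> simp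

theorem chain_comp_succ (μ : ℕ → Measure ℝ) (d : ℕ) : ∀ a,
    chain (fun i ↦ μ (i + 1)) d a = chain μ d (a + 1) := by
  induction d with
  | zero => exact fun a ↦ rfl
  | succ d ih =>
    intro a
    ext x
    simp only [chain, ih]

namespace PositiveSystem

variable {m : ℕ} {l r : ℕ → ℝ} {μ : ℕ → Measure ℝ}

theorem tail (h : PositiveSystem (m + 1) l r μ) :
    PositiveSystem m (fun i ↦ l (i + 1)) (fun i ↦ r (i + 1)) (fun i ↦ μ (i + 1)) where
  finite a := h.finite (a + 1)
  lt a ha := h.lt (a + 1) (by omega)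
  null_compl a ha := h.null_compl (a + 1) (by omega)
  disjoint a ha := h.disjoint (a + 1) (by omega)
  infinite a ha := h.infinite (a + 1) (by omega)

theorem integrable_chain (h : PositiveSystem m l r μ) {k : ℕ} (hk : k ≤ m) :
    Integrable (chain μ k 1) (μ 0) := by
  have := h.finite 0
  exact integrable_of_continuousOn_Icc (h.null_compl 0 (by omega))
    (h.continuousOn_chain_Icc (a := 0) (by omega))

theorem exists_abs_chain_eq (h : PositiveSystem m l r μ) {k : ℕ} (hk : k ≤ m) :
    ∃ κ : ℝ, (κ = 1 ∨ κ = -1) ∧ ∀ x ∈ Set.Icc (l 0) (r 0), |chain μ k 1 x| = κ * chain μ k 1 x := by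
  rcases exists_sign_of_continuousOn Set.ordConnected_Icc
    (h.continuousOn_chain_Icc (a := 0) (by omega : 0 + 1 + k ≤ m + 1))
    (fun x hx ↦ h.chain_ne_zero_of_mem (a := 0) (by omega) hx) with hs | hs
  · exact ⟨1, Or.inl rfl, fun x hx ↦ by rw [one_mul]; exact abs_of_pos (hs x hx)⟩
  · exact ⟨-1, Or.inr rfl, fun x hx ↦ by rw [neg_one_mul]; exact abs_of_neg (hs x hx)⟩

theorem integral_absDensity_chain (h : PositiveSystem m l r μ) {k : ℕ} (hk : k ≤ m) {κ : ℝ}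
    (hκ : ∀ x ∈ Set.Icc (l 0) (r 0), |chain μ k 1 x| = κ * chain μ k 1 x)
    {G : Type*} [NormedAddCommGroup G] [NormedSpace ℝ G] (f : ℝ → G) :
    ∫ x, f x ∂absDensity (μ 0) (chain μ k 1) = κ • ∫ x, chain μ k 1 x • f x ∂μ 0 := by
  have hae : ∀ᵐ t ∂μ 0, t ∈ Set.Icc (l 0) (r 0) := mem_ae_iff.2 (h.null_compl 0 (by omega))
  rw [integral_absDensity (h.integrable_chain hk), ← integral_smul]
  refine integral_congr_ae (hae.mono fun x hx ↦ ?_)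
  simp only
  rw [hκ x hx, mul_smul]

end PositiveSystem

theorem absDensity_one (μ : Measure ℝ) : absDensity μ (fun _ ↦ 1) = μ := by
  simp [absDensity]

/-- Induction along the tail of the generators: the Cauchy transform of the system measure of the
tail is a chain up to sign, and the constant sign of this chain on the first interval turns the
bracket into a signed multiple of a positive measure. The four signs multiply up to `c`. -/
theorem PositiveSystem.exists_nikishin_eq {m : ℕ} : ∀ {l r : ℕ → ℝ} {μ : ℕ → Measure ℝ},
    PositiveSystem m l r μ → ∀ {σ : Fin (m + 1) → SignedMeasure ℝ},
    (∀ j : Fin (m + 1), ∃ (_ : IsFiniteMeasure (μ j)) (θ : ℝ), (θ = 1 ∨ θ = -1) ∧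
      σ j = θ • (μ j).toSignedMeasure) → ∀ k : Fin (m + 1),
    ∃ (_ : IsFiniteMeasure (absDensity (μ 0) (chain μ k 1))) (c : ℝ), (c = 1 ∨ c = -1) ∧
      nikishin σ k = c • (absDensity (μ 0) (chain μ k 1)).toSignedMeasure := by
  have base : ∀ (ν : Measure ℝ) (s : SignedMeasure ℝ), (∃ (_ : IsFiniteMeasure ν) (θ : ℝ),
      (θ = 1 ∨ θ = -1) ∧ s = θ • ν.toSignedMeasure) →
      ∃ (_ : IsFiniteMeasure (absDensity ν fun _ ↦ 1)) (c : ℝ), (c = 1 ∨ c = -1) ∧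
        s = c • (absDensity ν fun _ ↦ 1).toSignedMeasure := by
    rintro ν s ⟨h1, θ, hθ, hs⟩
    have h1' : IsFiniteMeasure (absDensity ν fun _ ↦ 1) := by rw [absDensity_one]; exact h1
    refine ⟨h1', θ, hθ, ?_⟩
    rw [Measure.toSignedMeasure_congr (absDensity_one ν)]
    exact hs
  induction m with
  | zero =>
    intro l r μ h σ hσ k
    obtain rfl : k = 0 := Fin.fin_one_eq_zero k
    exact base (μ 0) (σ 0) (hσ 0)
  | succ m ih =>
    intro l r μ h σ hσ k
    refine Fin.cases ?_ (fun j ↦ ?_) k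
    · exact base (μ 0) (σ 0) (hσ 0)
    · have h0 := h.finite 0
      obtain ⟨hfin', c', hc', hs'⟩ := ih h.tail (σ := Fin.tail σ) (fun i ↦ hσ i.succ) j
      obtain ⟨κ', hκ', hκx'⟩ := h.tail.exists_abs_chain_eq (k := j) (by omega)
      obtain ⟨_, θ, hθ, hσ0⟩ := hσ 0
      obtain ⟨κ, hκ, hκx⟩ := h.exists_abs_chain_eq (k := j + 1) (by omega)
      have hInt := h.integrable_chain (k := j + 1) (by omega)
      have hfin := isFiniteMeasure_absDensity hInt
      have hcauchy : (fun x : ℝ ↦ cauchyTransform (nikishin (Fin.tail σ) j) x) =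
          fun x ↦ (c' * κ') * chain μ (j + 1) 1 x := by
        ext x
        rw [cauchyTransform, hs', integral_smul_toSignedMeasure,
          h.tail.integral_absDensity_chain (by omega) hκx', chain, smul_eq_mul, smul_eq_mul, mul_assoc]
        congr 2
        refine integral_congr_ae (Filter.Eventually.of_forall fun y ↦ ?_)
        simp only [chain_comp_succ, smul_eq_mul, div_eq_mul_inv]
        rfl
      refine ⟨hfin, θ * (c' * κ') * κ, ?_, ?_⟩
      · rcases hθ with rfl | rfl <;> rcases hc' with rfl | rfl <;> rcases hκ' with rfl | rfl <;>
          rcases hκ with rfl | rfl <;> norm_num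
      · have hμ0 : ∀ᵐ t ∂μ 0, t ∈ Set.Icc (l 0) (r 0) := mem_ae_iff.2 (h.null_compl 0 (by omega))
        have e : nikishin σ j.succ = bracket (σ 0) (nikishin (Fin.tail σ) j) := rfl
        have hσ0' : σ 0 = θ • (μ 0).toSignedMeasure := hσ0
        rw [e, bracket, hcauchy, hσ0', withDensity_smul_toSignedMeasure hθ (hInt.const_mul _)]
        have e2 : (μ 0).withDensityᵥ (fun x ↦ (c' * κ') * chain μ (j + 1) 1 x) =
            (c' * κ') • (μ 0).withDensityᵥ (chain μ (j + 1) 1) :=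
          withDensityᵥ_smul (chain μ (j + 1) 1) (c' * κ')
        rw [e2, withDensityᵥ_eq_smul_absDensity hInt hκ (hμ0.mono fun x hx ↦ hκx x hx), smul_smul,
          smul_smul]
        rfl

theorem convexHull_eq_Icc {K : Set ℝ} (hK : IsCompact K) (hne : K.Nonempty) :
    convexHull ℝ K = Set.Icc (sInf K) (sSup K) := by
  refine subset_antisymm (convexHull_min (fun x hx ↦ ⟨csInf_le hK.bddBelow hx, le_csSup hK.bddAbove hx⟩)
    (convex_Icc _ _)) ?_
  exact (convex_convexHull ℝ K).ordConnected.out (subset_convexHull ℝ K (hK.sInf_mem hne))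
    (subset_convexHull ℝ K (hK.sSup_mem hne))

theorem IsAdmissible.hull_eq {s : SignedMeasure ℝ} (h : IsAdmissible s) :
    hull s = Set.Icc (sInf (supp s)) (sSup (supp s)) :=
  convexHull_eq_Icc h.compact_supp h.infinite_supp.nonempty

theorem IsAdmissible.sInf_lt_sSup {s : SignedMeasure ℝ} (h : IsAdmissible s) :
    sInf (supp s) < sSup (supp s) := by
  by_contra! hle
  refine h.infinite_supp (Set.Finite.subset (Set.finite_singleton (sInf (supp s))) fun x hx ↦ ?_)
  exact le_antisymm ((le_csSup h.compact_supp.bddAbove hx).trans hle)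
    (csInf_le h.compact_supp.bddBelow hx)

theorem IsAdmissible.variation_compl_eq_zero {s : SignedMeasure ℝ} (h : IsAdmissible s) :
    s.variation (Set.Icc (sInf (supp s)) (sSup (supp s)))ᶜ = 0 := by
  refine measure_mono_null (Set.compl_subset_compl.2 ?_) (Measure.measure_compl_support (μ := s.variation))
  rw [← h.hull_eq]
  exact subset_convexHull ℝ _

/-- The total variations of the generators, extended by zero. -/
def generatorMeasure {m : ℕ} (σ : Fin (m + 1) → SignedMeasure ℝ) (a : ℕ) : Measure ℝ :=
  if h : a < m + 1 then (σ ⟨a, h⟩).variation else 0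

theorem IsGenerator.exists_positiveSystem {m : ℕ} {σ : Fin (m + 1) → SignedMeasure ℝ}
    (hσ : IsGenerator σ) : ∃ l r : ℕ → ℝ, l 0 = sInf (supp (σ 0)) ∧ r 0 = sSup (supp (σ 0)) ∧
      PositiveSystem m l r (generatorMeasure σ) ∧
      ∀ j : Fin (m + 1), ∃ (_ : IsFiniteMeasure (generatorMeasure σ j)) (θ : ℝ), (θ = 1 ∨ θ = -1) ∧
        σ j = θ • (generatorMeasure σ j).toSignedMeasure := by
  have hμ : ∀ (a : ℕ) (ha : a < m + 1), generatorMeasure σ a = (σ ⟨a, ha⟩).variation := fun a ha ↦ by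
    rw [generatorMeasure, dif_pos ha]
  have hrep : ∀ j : Fin (m + 1), ∃ (_ : IsFiniteMeasure (generatorMeasure σ j)) (θ : ℝ),
      (θ = 1 ∨ θ = -1) ∧ σ j = θ • (generatorMeasure σ j).toSignedMeasure := fun j ↦ by
    obtain ⟨hf, θ, hθ, h⟩ := exists_eq_smul_toSignedMeasure (hσ.admissible j).constant_sign
    have e := hμ j j.isLt
    refine ⟨by rw [e]; exact hf, θ, hθ, ?_⟩
    have hf' : IsFiniteMeasure (generatorMeasure σ j) := by rw [e]; exact hf
    rw [Measure.toSignedMeasure_congr e]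
    exact h
  refine ⟨fun a ↦ if h : a < m + 1 then sInf (supp (σ ⟨a, h⟩)) else 0,
    fun a ↦ if h : a < m + 1 then sSup (supp (σ ⟨a, h⟩)) else 0, by simp, by simp, ?_, hrep⟩
  refine ⟨fun a ↦ ?_, fun a ha ↦ ?_, fun a ha ↦ ?_, fun a ha ↦ ?_, fun a ha ↦ ?_⟩
  · by_cases ha : a < m + 1
    · exact (hrep ⟨a, ha⟩).1
    · rw [generatorMeasure, dif_neg ha]
      infer_instance
  · have ha' : a < m + 1 := by omega
    simp only [ha', dif_pos]
    exact (hσ.admissible ⟨a, ha'⟩).sInf_lt_sSup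
  · have ha' : a < m + 1 := by omega
    simp only [ha', dif_pos, hμ a ha']
    exact (hσ.admissible ⟨a, ha'⟩).variation_compl_eq_zero
  · have ha' : a < m + 1 := by omega
    have ha'' : a + 1 < m + 1 := by omega
    simp only [ha', ha'', dif_pos]
    rw [← (hσ.admissible ⟨a, ha'⟩).hull_eq, ← (hσ.admissible ⟨a + 1, ha''⟩).hull_eq]
    exact hσ.disjoint ⟨a, ha⟩
  · have ha' : a < m + 1 := by omega
    rw [hμ a ha']
    exact (hσ.admissible ⟨a, ha'⟩).infinite_supp

/-! ### The Nikishin system in terms of positive measures -/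

/-- `s = ± |chain μ k 1| μ 0`, where `c` is the sign of `s` and `κ` the sign of `chain μ k 1`. -/
structure IsRepresentedBy (s : SignedMeasure ℝ) (l r : ℕ → ℝ) (μ : ℕ → Measure ℝ) (k : ℕ) (c κ : ℝ) :
    Prop where
  sign : c = 1 ∨ c = -1
  chain_sign : κ = 1 ∨ κ = -1
  abs_chain : ∀ x ∈ Set.Icc (l 0) (r 0), |chain μ k 1 x| = κ * chain μ k 1 x
  finite : IsFiniteMeasure (absDensity (μ 0) (chain μ k 1))
  eq_smul : s = c • (absDensity (μ 0) (chain μ k 1)).toSignedMeasure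

theorem IsGenerator.exists_representation {m : ℕ} {σ : Fin (m + 1) → SignedMeasure ℝ}
    (hσ : IsGenerator σ) : ∃ (l r : ℕ → ℝ) (μ : ℕ → Measure ℝ) (c κ : Fin (m + 1) → ℝ),
      l 0 = sInf (supp (σ 0)) ∧ r 0 = sSup (supp (σ 0)) ∧ PositiveSystem m l r μ ∧
      ∀ k : Fin (m + 1), IsRepresentedBy (nikishin σ k) l r μ k (c k) (κ k) := by
  obtain ⟨l, r, hl, hr, h, hrep⟩ := hσ.exists_positiveSystem
  choose hfin c hc hs using fun k ↦ h.exists_nikishin_eq hrep k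
  choose κ hκ hκx using fun k : Fin (m + 1) ↦ h.exists_abs_chain_eq (k := k) (by omega)
  exact ⟨l, r, _, c, κ, hl, hr, h, fun k ↦ ⟨hc k, hκ k, hκx k, hfin k, hs k⟩⟩

namespace IsRepresentedBy

variable {s : SignedMeasure ℝ} {m : ℕ} {l r : ℕ → ℝ} {μ : ℕ → Measure ℝ} {k : ℕ} {c κ : ℝ}

theorem integral_eq_smul (hs : IsRepresentedBy s l r μ k c κ) {G : Type*} [NormedAddCommGroup G]
    [NormedSpace ℝ G] (f : ℝ → G) :
    ∫ᵛ x, f x ∂<•s = c • ∫ x, f x ∂absDensity (μ 0) (chain μ k 1) := by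
  have := hs.finite
  rw [hs.eq_smul, integral_smul_toSignedMeasure]

theorem integral_eq (hs : IsRepresentedBy s l r μ k c κ) (h : PositiveSystem m l r μ) (hk : k ≤ m)
    {G : Type*} [NormedAddCommGroup G] [NormedSpace ℝ G] (f : ℝ → G) :
    ∫ᵛ x, f x ∂<•s = ∫ x, (c * κ * chain μ k 1 x) • f x ∂μ 0 := by
  rw [hs.integral_eq_smul, h.integral_absDensity_chain hk hs.abs_chain, smul_smul, ← integral_smul]
  simp only [smul_smul]

theorem cauchyTransform_eq (hs : IsRepresentedBy s l r μ k c κ) (h : PositiveSystem m l r μ)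
    (hk : k ≤ m) (z : ℂ) : cauchyTransform s z =
      ∫ y, ((c * κ * chain μ k 1 y : ℝ) : ℂ) / (z - y) ∂μ 0 := by
  rw [cauchyTransform, hs.integral_eq h hk]
  simp only [Complex.real_smul, div_eq_mul_inv]
  rfl

theorem variation_eq (hs : IsRepresentedBy s l r μ k c κ) :
    s.variation = absDensity (μ 0) (chain μ k 1) := by
  have := hs.finite
  rw [hs.eq_smul, variation_smul_toSignedMeasure hs.sign]

theorem nonneg (hs : IsRepresentedBy s l r μ k c κ) (hc : c = 1) : 0 ≤ s := by
  have := hs.finite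
  rw [hs.eq_smul]
  intro i hi
  simp [hi, hc]

theorem nonpos (hs : IsRepresentedBy s l r μ k c κ) (hc : c = -1) : s ≤ 0 := by
  have := hs.finite
  rw [hs.eq_smul]
  intro i hi
  simp [hi, hc]

theorem distribution_eq (hs : IsRepresentedBy s l r μ k c κ) (a : ℝ) :
    distribution s a = fun t ↦ c * (absDensity (μ 0) (chain μ k 1)).real (initialSet a t) := by
  have := hs.finite
  ext t
  rw [distribution, initialSet]
  split_ifs with h
  · simp
  · rw [hs.eq_smul, _root_.smul_apply, Measure.toSignedMeasure_apply_measurable measurableSet_Icc,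
      smul_eq_mul]

end IsRepresentedBy

theorem absDensity_compl_eq_zero {μ : Measure ℝ} {g : ℝ → ℝ} {a b : ℝ} (hμ : μ (Set.Icc a b)ᶜ = 0) :
    absDensity μ g (Set.Icc a b)ᶜ = 0 :=
  withDensity_absolutelyContinuous _ _ hμ

/-- The density has no zeros on the interval, so these measures share their null sets with `μ 0` for
all `k`; this transfers almost everywhere continuity between indices. -/
theorem PositiveSystem.ae_absDensity_iff {m : ℕ} {l r : ℕ → ℝ} {μ : ℕ → Measure ℝ}
    (h : PositiveSystem m l r μ) {k : ℕ} (hk : k ≤ m) {p : ℝ → Prop} :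
    (∀ᵐ x ∂absDensity (μ 0) (chain μ k 1), p x) ↔ ∀ᵐ x ∂μ 0, p x := by
  have hae : ∀ᵐ t ∂μ 0, t ∈ Set.Icc (l 0) (r 0) := mem_ae_iff.2 (h.null_compl 0 (by omega))
  rw [absDensity, ae_withDensity_iff' (h.integrable_chain hk).abs.aemeasurable.ennreal_ofReal]
  refine Filter.eventually_congr (hae.mono fun x hx ↦ ?_)
  have : ENNReal.ofReal |chain μ k 1 x| ≠ 0 := by
    simpa using h.chain_ne_zero_of_mem (a := 0) (by omega) hx
  simp [this]

theorem HasRSIntegral.const_mul {f α : ℝ → ℝ} {a b I c : ℝ} (hc : c = 1 ∨ c = -1)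
    (h : HasRSIntegral f α a b I) : HasRSIntegral f (fun t ↦ c * α t) a b (c * I) := by
  intro ε hε
  obtain ⟨δ, hδ, hs⟩ := h ε hε
  refine ⟨δ, hδ, fun N t ξ h0 hN ht ↦ ?_⟩
  have e : ∑ i ∈ Finset.range N, f (ξ i) * (c * α (t (i + 1)) - c * α (t i)) - c * I =
      c * (∑ i ∈ Finset.range N, f (ξ i) * (α (t (i + 1)) - α (t i)) - I) := by
    rw [mul_sub, Finset.mul_sum]
    congr 1
    exact Finset.sum_congr rfl fun _ _ ↦ by ring
  have hc1 : |c| = 1 := by rcases hc with rfl | rfl <;> simp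
  rw [e, abs_mul, hc1, one_mul]
  exact hs N t ξ h0 hN ht

/-! ### The zeros of a type II polynomial -/

theorem IsZeroEnumeration.sum_eq {γ : ℂ} (hγ : γ ≠ 0) {Z : Finset ℝ} {N : ℕ} {x : Fin N → ℝ}
    (hx : IsZeroEnumeration (C γ * ∏ z ∈ Z, (Polynomial.X - C (z : ℂ))) x) :
    (∀ i, x i ∈ Z) ∧ ∀ {M : Type} [AddCommMonoid M] (F : ℝ → M), ∑ i, F (x i) = ∑ z ∈ Z, F z := by
  have hroot : ∀ t : ℝ, (C γ * ∏ z ∈ Z, (Polynomial.X - C (z : ℂ))).IsRoot (t : ℂ) ↔ t ∈ Z := fun t ↦ by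
    simp only [IsRoot.def, eval_mul, eval_C, mul_eq_zero, hγ, false_or, eval_prod,
      Finset.prod_eq_zero_iff, eval_sub, eval_X, sub_eq_zero, Complex.ofReal_inj]
    exact ⟨fun ⟨a, ha, h⟩ ↦ h ▸ ha, fun h ↦ ⟨t, h, rfl⟩⟩
  have hmem : ∀ i, x i ∈ Z := fun i ↦ (hroot _).1 ((hx.isRoot_iff _).2 ⟨i, rfl⟩)
  refine ⟨hmem, fun F ↦ ?_⟩
  have himg : Finset.univ.image x = Z := by
    ext t
    simp only [Finset.mem_image, Finset.mem_univ, true_and]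
    refine ⟨fun ⟨i, hi⟩ ↦ hi ▸ hmem i, fun ht ↦ ?_⟩
    obtain ⟨i, hi⟩ := (hx.isRoot_iff _).1 ((hroot t).2 ht)
    exact ⟨i, (Complex.ofReal_injective hi).symm⟩
  rw [← himg, Finset.sum_image fun i _ j _ h ↦ hx.injective h]

theorem exists_isZeroEnumeration {γ : ℂ} (hγ : γ ≠ 0) {Z : Finset ℝ} {N : ℕ} (hN : Z.card = N) :
    ∃ x : Fin N → ℝ, IsZeroEnumeration (C γ * ∏ z ∈ Z, (Polynomial.X - C (z : ℂ))) x ∧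
      ∀ i, x i ∈ Z := by
  refine ⟨Z.orderEmbOfFin hN, ⟨(Z.orderEmbOfFin hN).injective, fun z ↦ ?_⟩,
    fun i ↦ Z.orderEmbOfFin_mem hN i⟩
  simp only [IsRoot.def, eval_mul, eval_C, mul_eq_zero, hγ, false_or, eval_prod,
    Finset.prod_eq_zero_iff, eval_sub, eval_X, sub_eq_zero]
  constructor
  · rintro ⟨t, ht, rfl⟩
    obtain ⟨i, hi⟩ : t ∈ Set.range (Z.orderEmbOfFin hN) := by
      rw [Finset.range_orderEmbOfFin]
      exact ht
    exact ⟨i, by rw [hi]⟩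
  · rintro ⟨i, rfl⟩
    exact ⟨_, Z.orderEmbOfFin_mem hN i, rfl⟩

theorem quadratureWeight_const_mul (μ : Measure ℝ) (g : ℝ → ℝ) (Z : Finset ℝ) (ξ e : ℝ) :
    quadratureWeight μ (fun y ↦ e * g y) Z ξ = e * quadratureWeight μ g Z ξ := by
  rw [quadratureWeight, quadratureWeight, ← mul_div_assoc, ← integral_const_mul]
  congr 2
  ext y
  ring

namespace PositiveSystem

variable {m : ℕ} {l r : ℕ → ℝ} {μ : ℕ → Measure ℝ} {s : Fin (m + 1) → SignedMeasure ℝ}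
  {c κ : Fin (m + 1) → ℝ}

theorem continuousOn_density (h : PositiveSystem m l r μ) (k : Fin (m + 1)) (e : ℝ) :
    ContinuousOn (fun y ↦ e * chain μ k 1 y) (Set.Icc (l 0) (r 0)) :=
  continuousOn_const.mul (h.continuousOn_chain_Icc (a := 0) (by omega))

theorem isTypeII_iff (h : PositiveSystem m l r μ)
    (hs : ∀ k : Fin (m + 1), IsRepresentedBy (s k) l r μ k (c k) (κ k)) {n : Fin (m + 1) → ℕ} {Q : ℂ[X]}
    {P : Fin (m + 1) → ℂ[X]} : IsTypeII s n Q P ↔ Q ≠ 0 ∧ Q.natDegree ≤ ∑ j, n j ∧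
      ∀ k, P k = quotientPoly (fun j ↦ ∫ y, (y : ℂ) ^ j * ((c k * κ k * chain μ k 1 y : ℝ) : ℂ) ∂μ 0) Q ∧
        ∀ j < n k, ∫ y, (y : ℂ) ^ j *
          (Q.eval (y : ℂ) * ((c k * κ k * chain μ k 1 y : ℝ) : ℂ)) ∂μ 0 = 0 := by
  have := h.finite 0
  have key : ∀ k, ((fun z : ℂ ↦ Q.eval z * cauchyTransform (s k) z - (P k).eval z)
      =O[Bornology.cobounded ℂ] fun z : ℂ ↦ (1 / z ^ (n k + 1) : ℂ)) ↔ _ := fun k ↦ by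
    simp only [(hs k).cauchyTransform_eq h (by omega)]
    exact isBigO_sub_iff_orthogonal (h.null_compl 0 (by omega))
      (G := fun y ↦ ((c k * κ k * chain μ k 1 y : ℝ) : ℂ))
      (Complex.continuous_ofReal.comp_continuousOn (h.continuousOn_density k _))
  exact ⟨fun ⟨h1, h2, h3⟩ ↦ ⟨h1, h2, fun k ↦ (key k).1 (h3 k)⟩,
    fun ⟨h1, h2, h3⟩ ↦ ⟨h1, h2, fun k ↦ (key k).2 (h3 k)⟩⟩

theorem integral_density_eq (Q : ℂ[X]) (k : ℕ) (j : ℕ) (e : ℝ) :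
    ∫ y, (y : ℂ) ^ j * (Q.eval (y : ℂ) * ((e * chain μ k 1 y : ℝ) : ℂ)) ∂μ 0 =
      e * ∫ y, (y : ℂ) ^ j * (Q.eval (y : ℂ) * (chain μ k 1 y : ℂ)) ∂μ 0 := by
  rw [← integral_const_mul]
  refine integral_congr_ae (Filter.Eventually.of_forall fun y ↦ ?_)
  simp only
  push_cast
  ring

theorem exists_isTypeII (h : PositiveSystem m l r μ)
    (hs : ∀ k : Fin (m + 1), IsRepresentedBy (s k) l r μ k (c k) (κ k)) (n : Fin (m + 1) → ℕ) :
    ∃ Q P, IsTypeII s n Q P := by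
  set n' : ℕ → ℕ := fun k ↦ if hk : k < m + 1 then n ⟨k, hk⟩ else 0 with hn'
  have hn : ∀ k : Fin (m + 1), n' k = n k := fun k ↦ dif_pos k.isLt
  obtain ⟨Q, hQ0, hQd, hQ⟩ := h.exists_isOrthogonalComplex n'
  rw [← Fin.sum_univ_eq_sum_range] at hQd
  simp only [hn] at hQd
  refine ⟨Q, _, (h.isTypeII_iff hs).2 ⟨hQ0, hQd, fun k ↦ ⟨rfl, fun j hj ↦ ?_⟩⟩⟩
  rw [integral_density_eq, hQ k (by omega) j (by rwa [hn]), mul_zero]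

theorem exists_nodes_of_isTypeII (h : PositiveSystem m l r μ)
    (hs : ∀ k : Fin (m + 1), IsRepresentedBy (s k) l r μ k (c k) (κ k)) {n : Fin (m + 1) → ℕ}
    {n' : ℕ → ℕ} (hn : ∀ k : Fin (m + 1), n' k = n k) {Q : ℂ[X]} {P : Fin (m + 1) → ℂ[X]}
    (hQ : IsTypeII s n Q P) : ∃ (Z : Finset ℝ) (γ : ℂ), γ ≠ 0 ∧ (∀ z ∈ Z, z ∈ Set.Ioo (l 0) (r 0)) ∧
      Z.card = ∑ j, n j ∧ IsOrthogonal m μ n' (∏ z ∈ Z, (Polynomial.X - C z)) ∧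
      Q = C γ * ∏ z ∈ Z, (Polynomial.X - C (z : ℂ)) ∧
      (∀ k, ∀ ξ ∈ Z, weight Q (P k) ξ = c k * κ k * quadratureWeight (μ 0) (chain μ k 1) Z ξ) ∧
      ∀ (k : Fin (m + 1)) (p : ℂ[X]), p.degree < (((∑ j, n j) + n k : ℕ) : WithBot ℕ) →
        ∫ᵛ t, p.eval (t : ℂ) ∂<•(s k) = ∑ z ∈ Z, weight Q (P k) z * p.eval (z : ℂ) := by
  have := h.finite 0
  have hμ := h.null_compl 0 (by omega)
  obtain ⟨hQ0, hQd, hPk⟩ := (h.isTypeII_iff hs).1 hQ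
  have hsum : ∑ k ∈ Finset.range (m + 1), n' k = ∑ j, n j := by
    rw [← Fin.sum_univ_eq_sum_range]
    simp only [hn]
  have hck : ∀ k, c k * κ k ≠ 0 := fun k ↦ by
    rcases (hs k).sign with h1 | h1 <;> rcases (hs k).chain_sign with h2 | h2 <;> simp [h1, h2]
  have horth : IsOrthogonalComplex m μ n' Q := fun k hk j hj ↦ by
    have h1 := (hPk ⟨k, by omega⟩).2 j (by rwa [← hn])
    rw [integral_density_eq] at h1
    exact (mul_eq_zero.1 h1).resolve_left (by exact_mod_cast hck _)
  obtain ⟨Z, γ, hγ, hZ, hcard, hZo, hQZ⟩ := h.exists_eq_C_mul_prod_of_isOrthogonalComplex horth hQ0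
    (by rwa [hsum])
  have hw : ∀ k, ∀ ξ ∈ Z, weight Q (P k) ξ =
      quadratureWeight (μ 0) (fun y ↦ c k * κ k * chain μ k 1 y) Z ξ := fun k ξ hξ ↦ by
    rw [(hPk k).1, hQZ]
    exact weight_eq_quadratureWeight hμ (h.continuousOn_density k _) hγ hξ
  refine ⟨Z, γ, hγ, hZ, by rw [hcard, hsum], hZo, hQZ, fun k ξ hξ ↦ ?_, fun k p hp ↦ ?_⟩
  · rw [hw k ξ hξ, quadratureWeight_const_mul]
    push_cast
    rfl
  · rw [(hs k).integral_eq h (by omega)]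
    have hq := integral_eval_mul_eq_sum_quadratureWeight hμ
      (h.continuousOn_density k (c k * κ k)) (Z := Z) (n := n k) (fun j hj ↦ ?_) (p := p)
      (by rwa [hcard, hsum])
    · rw [Finset.sum_congr rfl fun z hz ↦ by rw [hw k z hz], ← hq]
      refine integral_congr_ae (Filter.Eventually.of_forall fun y ↦ ?_)
      simp only [Complex.real_smul]
      ring
    · have h1 := (hPk k).2 j hj
      rw [hQZ] at h1
      have e : ∀ y : ℝ, (y : ℂ) ^ j * ((C γ * ∏ z ∈ Z, (Polynomial.X - C (z : ℂ))).eval (y : ℂ) *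
          ((c k * κ k * chain μ k 1 y : ℝ) : ℂ)) = γ * ((y : ℂ) ^ j *
          ((∏ z ∈ Z, (Polynomial.X - C (z : ℂ))).eval (y : ℂ) *
            ((c k * κ k * chain μ k 1 y : ℝ) : ℂ))) := fun y ↦ by
        rw [eval_mul, eval_C]
        ring
      simp only [e] at h1
      rw [integral_const_mul] at h1
      exact (mul_eq_zero.1 h1).resolve_left hγ

/-- The factors `c k` and `κ k` separate the sign of `s k` from that of the chain. Multiplied by `κ
k`, the quadrature weight is positive, as `κ k` times the chain is its absolute value. Exactness is
kept only for `natDegree < N`, which is enough for the limit. -/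
theorem exists_positive_weights_of_isTypeII (h : PositiveSystem m l r μ)
    (hs : ∀ k : Fin (m + 1), IsRepresentedBy (s k) l r μ k (c k) (κ k)) {N : ℕ} {Q : ℂ[X]}
    {P : Fin (m + 1) → ℂ[X]} (hQ : IsTypeII s (stepIndex m N) Q P) :
    ∃ (Z : Finset ℝ) (γ : ℂ) (w : Fin (m + 1) → ℝ → ℝ), γ ≠ 0 ∧
      (∀ z ∈ Z, z ∈ Set.Icc (l 0) (r 0)) ∧ Q = C γ * ∏ z ∈ Z, (Polynomial.X - C (z : ℂ)) ∧
      (∀ k, ∀ z ∈ Z, 0 < w k z ∧ weight Q (P k) z = c k * w k z) ∧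
      ∀ (k : Fin (m + 1)) (p : ℝ[X]), p.natDegree < N →
        ∑ z ∈ Z, w k z * p.eval z = ∫ x, p.eval x ∂absDensity (μ 0) (chain μ k 1) := by
  have hn : ∀ k : Fin (m + 1), (if (k : ℕ) = 0 then N else N + 1) = stepIndex m N k := fun k ↦ by
    refine Fin.cases ?_ (fun j ↦ ?_) k <;> simp [stepIndex]
  obtain ⟨Z, γ, hγ, hZ, hcard, hZo, hQZ, hwt, hquad⟩ := h.exists_nodes_of_isTypeII hs
    (n' := fun k ↦ if k = 0 then N else N + 1) hn hQ
  have hsum : ∑ k ∈ Finset.range (m + 1), (if k = 0 then N else N + 1) = ∑ j, stepIndex m N j := by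
    rw [← Fin.sum_univ_eq_sum_range (fun k ↦ if k = 0 then N else N + 1)]
    simp only [hn]
  have hZ' : ∀ z ∈ Z, z ∈ Set.Icc (l 0) (r 0) := fun z hz ↦ Set.Ioo_subset_Icc_self (hZ z hz)
  have hwt' : ∀ k, ∀ z ∈ Z, weight Q (P k) z =
      c k * ((κ k * quadratureWeight (μ 0) (chain μ k 1) Z z : ℝ) : ℂ) := fun k z hz ↦ by
    rw [hwt k z hz]
    push_cast
    ring
  refine ⟨Z, γ, fun k z ↦ κ k * quadratureWeight (μ 0) (chain μ k 1) Z z, hγ, hZ', hQZ,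
    fun k z hz ↦ ⟨?_, hwt' k z hz⟩, fun k p hp ↦ ?_⟩
  · have h1 := h.weight_mul_chain_pos (n := fun k ↦ if k = 0 then N else N + 1) (M := N) (by simp)
      (fun k hk ↦ by simp [hk]) hZ' (by rw [hcard, hsum]) hZo hz (j := k) (by omega)
    have h2 : 0 < κ k * chain μ k 1 z := by
      rw [← (hs k).abs_chain z (hZ' z hz)]
      exact abs_pos.2 (h.chain_ne_zero_of_mem (a := 0) (by omega) (hZ' z hz))
    have h3 : κ k * κ k = 1 := by rcases (hs k).chain_sign with h | h <;> simp [h]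
    refine (mul_pos_iff_of_pos_right h2).1 (h1.trans_eq ?_)
    simp only [quadratureWeight]
    linear_combination (-(∫ y, (∏ z' ∈ Z.erase z, (y - z')) * chain μ k 1 y ∂μ 0) /
      (∏ z' ∈ Z.erase z, (z - z')) * chain μ k 1 z) * h3
  · have hle : N ≤ ∑ j, stepIndex m N j :=
      (le_of_eq (by simp [stepIndex])).trans (Finset.single_le_sum (fun j _ ↦ Nat.zero_le _)
        (Finset.mem_univ (0 : Fin (m + 1))))
    have h1 := hquad k (p.map Complex.ofRealHom) (by
      rw [degree_map]
      exact degree_le_natDegree.trans_lt (by exact_mod_cast (by omega)))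
    rw [(hs k).integral_eq_smul, Finset.sum_congr rfl fun z hz ↦ by rw [hwt' k z hz]] at h1
    simp only [eval_map_ofReal] at h1
    rw [integral_complex_ofReal, Complex.real_smul] at h1
    have hc0 : c k ≠ 0 := by rcases (hs k).sign with h | h <;> simp [h]
    have h2 : c k * ∫ x, p.eval x ∂absDensity (μ 0) (chain μ k 1) = c k * ∑ z ∈ Z,
        κ k * quadratureWeight (μ 0) (chain μ k 1) Z z * p.eval z := by
      have : ((c k * ∫ x, p.eval x ∂absDensity (μ 0) (chain μ k 1) : ℝ) : ℂ) = ((c k * ∑ z ∈ Z,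
          κ k * quadratureWeight (μ 0) (chain μ k 1) Z z * p.eval z : ℝ) : ℂ) := by
        push_cast
        rw [h1, Finset.mul_sum]
        refine Finset.sum_congr rfl fun z _ ↦ ?_
        push_cast
        ring
      exact_mod_cast this
    exact (mul_left_cancel₀ hc0 h2).symm

end PositiveSystem

end NikishinSystem

end

/-! ### Quadrature, signs of the weights and convergence for a Nikishin system -/

open NikishinSystem in
theorem corollary2 {m : ℕ} (σ : Fin (m + 1) → SignedMeasure ℝ) (hσ : IsGenerator σ) :
    -- for every multi-index the type II polynomial exists, its zeros are real, simple and lie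
    -- inside the interval, and the quadrature is exact
    (∀ n : Fin (m + 1) → ℕ,
      (∃ Q P, IsTypeII (nikishin σ) n Q P) ∧
      ∀ Q P, IsTypeII (nikishin σ) n Q P →
        (∃ x : Fin (∑ j, n j) → ℝ, IsZeroEnumeration Q x ∧ ∀ i, x i ∈ interior (hull (σ 0))) ∧
        ∀ x : Fin (∑ j, n j) → ℝ, IsZeroEnumeration Q x →
          ∀ (k : Fin (m + 1)) (p : ℂ[X]), p.degree < (((∑ j, n j) + n k : ℕ) : WithBot ℕ) →
            ∫ᵛ t, p.eval (t : ℂ) ∂<•(nikishin σ k)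
              = ∑ i, weight Q (P k) (x i) * p.eval (x i : ℂ)) ∧
    -- for `n = (N, N + 1, …, N + 1)` the weights have the sign of the measure
    (∀ (N : ℕ) (Q : ℂ[X]) (P : Fin (m + 1) → ℂ[X]),
      IsTypeII (nikishin σ) (stepIndex m N) Q P →
      ∀ x : Fin (∑ j, stepIndex m N j) → ℝ, IsZeroEnumeration Q x → ∀ k : Fin (m + 1),
        (0 ≤ nikishin σ k ∧
          ∀ i, (weight Q (P k) (x i)).im = 0 ∧ 0 < (weight Q (P k) (x i)).re) ∨
        (nikishin σ k ≤ 0 ∧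
          ∀ i, (weight Q (P k) (x i)).im = 0 ∧ (weight Q (P k) (x i)).re < 0)) ∧
    -- the quadratures converge
    (∀ (Q : ℕ → ℂ[X]) (P : ℕ → Fin (m + 1) → ℂ[X])
      (x : (N : ℕ) → Fin (∑ j, stepIndex m N j) → ℝ),
      (∀ N, IsTypeII (nikishin σ) (stepIndex m N) (Q N) (P N)) →
      (∀ N, IsZeroEnumeration (Q N) (x N)) →
      ∀ f : ℝ → ℝ, (∃ M : ℝ, ∀ t ∈ hull (σ 0), |f t| ≤ M) →
        (∃ (j : Fin (m + 1)) (J : ℝ), HasRSIntegralOn (σ 0) (nikishin σ j) f J) →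
        ∀ k : Fin (m + 1), ∃ I : ℝ,
          HasRSIntegralOn (σ 0) (nikishin σ k) f I ∧
          (nikishin σ k).Integrable f ∧ ∫ᵛ t, f t ∂<•(nikishin σ k) = I ∧
          Filter.Tendsto (fun N ↦ ∑ i, weight (Q N) (P N k) (x N i) * (f (x N i) : ℂ))
            Filter.atTop (nhds (I : ℂ))) := by
  obtain ⟨l, r, μ, c, κ, hl, hr, h, hs⟩ := hσ.exists_representation
  have hhull : hull (σ 0) = Set.Icc (l 0) (r 0) := by rw [(hσ.admissible 0).hull_eq, hl, hr]
  have hlr := h.lt 0 (by omega)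
  refine ⟨fun n ↦ ⟨h.exists_isTypeII hs n, fun Q P hQ ↦ ?_⟩, fun N Q P hQ x hx k ↦ ?_,
    fun Q P x hQ hx f ⟨M, hM⟩ ⟨j, J, hJ⟩ k ↦ ?_⟩
  · obtain ⟨Z, γ, hγ, hZ, hcard, -, rfl, -, hquad⟩ := h.exists_nodes_of_isTypeII hs
      (n' := fun k ↦ if hk : k < m + 1 then n ⟨k, hk⟩ else 0) (fun k ↦ dif_pos k.isLt) hQ
    refine ⟨?_, fun x hx k p hp ↦ ?_⟩
    · obtain ⟨x, hx, hxZ⟩ := exists_isZeroEnumeration hγ hcard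
      refine ⟨x, hx, fun i ↦ ?_⟩
      rw [hhull, interior_Icc]
      exact hZ _ (hxZ i)
    · rw [hquad k p hp]
      exact ((hx.sum_eq hγ).2 _).symm
  · obtain ⟨Z, γ, w, hγ, -, rfl, hw, -⟩ := h.exists_positive_weights_of_isTypeII hs hQ
    have hmem := (hx.sum_eq hγ).1
    rcases (hs k).sign with hc | hc
    · refine Or.inl ⟨?_, fun i ↦ ?_⟩
      · exact (hs k).nonneg hc
      · obtain ⟨h1, h2⟩ := hw k (x i) (hmem i)
        rw [h2, hc]
        simpa using h1
    · refine Or.inr ⟨?_, fun i ↦ ?_⟩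
      · exact (hs k).nonpos hc
      · obtain ⟨h1, h2⟩ := hw k (x i) (hmem i)
        rw [h2, hc]
        simpa using h1
  · choose Z γ w hγ hZ hQZ hw hexact using fun N ↦ h.exists_positive_weights_of_isTypeII hs (hQ N)
    have hfin := (hs k).finite
    have hfinj := (hs j).finite
    have hnull : ∀ i : Fin (m + 1), absDensity (μ 0) (chain μ i 1) (Set.Icc (l 0) (r 0))ᶜ = 0 :=
      fun i ↦ absDensity_compl_eq_zero (h.null_compl 0 (by omega))
    rw [hhull] at hM
    rw [HasRSIntegralOn, ← hl, ← hr, (hs j).distribution_eq] at hJ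
    have hcc : ∀ i, c i * c i = 1 := fun i ↦ by rcases (hs i).sign with h | h <;> simp [h]
    -- A second factor `c j` cancels the sign of the integrator, which becomes that of a positive
    -- measure.
    have hJ' := hJ.const_mul (hs j).sign
    simp only [← mul_assoc, hcc, one_mul] at hJ'
    -- Continuity almost everywhere passes from index `j` to `μ 0` and from there to index `k`.
    have hcont : ∀ᵐ x ∂absDensity (μ 0) (chain μ k 1), ContinuousWithinAt f (Set.Icc (l 0) (r 0)) x :=
      (h.ae_absDensity_iff (by omega)).2
        ((h.ae_absDensity_iff (by omega)).1 (hJ'.ae_continuousWithinAt hlr (hnull j)))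
    have hsand := isSandwiched_of_ae_continuousWithinAt hlr.le (hnull k) hM hcont
    refine ⟨c k * ∫ t, f t ∂absDensity (μ 0) (chain μ k 1), ?_, ?_, ?_, ?_⟩
    · rw [HasRSIntegralOn, ← hl, ← hr, (hs k).distribution_eq]
      exact (hsand.hasRSIntegral hlr (hnull k)).const_mul (hs k).sign
    · rw [VectorMeasure.Integrable, (hs k).variation_eq]
      exact (integrable_and_tendsto_lowerEnvelope hlr.le (hnull k) hM hcont).1
    · rw [(hs k).integral_eq_smul, smul_eq_mul]
    · have hlim := hsand.tendsto_quadrature (hnull k) hZ (w := fun N ↦ w N k)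
        (fun N z hz ↦ (hw N k z hz).1.le)
        (fun p ↦ (Filter.eventually_gt_atTop p.natDegree).mono fun N hN ↦ hexact N k p hN)
      have hlim' := (Complex.continuous_ofReal.tendsto _).comp (hlim.const_mul (c k))
      refine hlim'.congr fun N ↦ ?_
      have hx' := hx N
      rw [hQZ N] at hx'
      rw [((hx'.sum_eq (hγ N)).2 fun z ↦ weight (Q N) (P N k) z * (f z : ℂ)), Function.comp_apply,
        Finset.mul_sum]
      push_cast
      refine Finset.sum_congr rfl fun z hz ↦ ?_
      rw [(hw N k z hz).2]
      ring
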